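/- **Setting.** Let $p$ be a prime and let $F$ be the unramified quadratic field extension of $\mathbf Q_p$ (the completion at $p$ of a quadratic field in which $p$ is inert), with ring of integers $\mathcal O$, non-trivial automorphism $x\mapsto x^c$, norm $\mathrm N$ and normalized absolute value $|\cdot|_F$. Let $x\mapsto x^*$ be the main involution of $\mathrm M_2(F)$. Put $V=\{x\in \mathrm M_2(F): x^*=x^c\}$, a quadratic space over $\mathbf Q_p$ with $\mathrm n(x)=xx^*$ and $(x,y)=\mathrm n(x+y)-\mathrm n(x)-\mathrm n(y)$. The group $H^0(\mathbf Q_p)=(\mathrm{GL}_2(F)\times\mathbf Q_p^\times)/F^\times$, where $z\in F^\times$ is embedded as $(z,\mathrm N(z))$, acts on $V$ by $\varrho(a,\alpha)x=\alpha^{-1}ax(a^c)^*$, with similitude $\nu(a,\alpha)=\alpha^{-2}\mathrm N(\det a)$; put $H^0_1(\mathbf Q_p)=\ker\nu$, with a Haar measure $dh$. Let $\omega(h)\varphi(x)=\varphi(h^{-1}x)$ for $h\in H^0_1(\mathbf Q_p)$ and functions $\varphi$ on $\mathbf X=V\oplus V$, and let $\mathcal B_\omega(\varphi_1,\varphi_2)=\int_{\mathbf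 X}\varphi_1(x)\overline{\varphi_2(x)}\,dx$, where $dx$ is the self-dual measure for $(\cdot,\cdot)$ and the standard additive character $\psi_p$ of $\mathbf Q_p$. Let $N^+$ be a square-free positive integer, let $n=\mathrm{ord}_p(N^+)\in\{0,1\}$, let $R\subset\mathrm M_2(\mathcal O)$ be the order of matrices with lower left entry in $p^n\mathcal O$, let $\varphi^\star$ be the characteristic function of $L\oplus L$ with $L=R\cap V$, and let $\mathcal U_p=H_1^0(\mathbf Q_p)\cap (R^\times\times\mathbf Z_p^\times)/\mathcal O^\times$. Let $\pi$ be an irreducible admissible unitary representation of $\mathrm{PGL}_2(F)$ of conductor $p^n$ which is an unramified principal series $\pi(\mu,\nu)$ (normalized induction, $\mu\nu^{-1}\neq|\cdot|_F^{\pm1}$) or a special representation $\mathrm{St}\otimes(\chi\circ\det)$; such are the local components at an inert prime $p$ of the cuspidal representation generated by a newform on $\mathrm{PGL}_2$ over a real quadratic field of a level whose $p$-part is $p^{n}$. Let $\sigma=\pi\boxtimes\mathbf 1$ be the corresponding representation of $H^0(\mathbf Q_p)$, let $f^\dagger$ be a new vector of $\pi$ (a nonzero vector fixed by $R^\times$),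 and let $\mathcal B_\sigma$ be the invariant positive definite Hermitian form with $\mathcal B_\sigma(f^\dagger,f^\dagger)=1$. Define $$\mathcal Z_p(\varphi^\star,f^\dagger)=\int_{H^0_1(\mathbf Q_p)}\mathcal B_\omega(\omega(h)\varphi^\star,\varphi^\star)\,\mathcal B_\sigma(\sigma(h)f^\dagger,f^\dagger)\,dh .$$ Put $\zeta_p(s)=(1-p^{-s})^{-1}$, and let $L(s,\mathrm{As}^+(\pi))$ be $L(s,\mu|_{\mathbf Q_p^\times})L(s,\mu\nu)L(s,\nu|_{\mathbf Q_p^\times})$ if $\pi=\pi(\mu,\nu)$ is an unramified principal series, and $L(s+1,\chi|_{\mathbf Q_p^\times})L(s,\tau\chi|_{\mathbf Q_p^\times})$ if $\pi=\mathrm{St}\otimes(\chi\circ\det)$, where $\tau$ is the quadratic character of $\mathbf Q_p^\times$ attached to $F/\mathbf Q_p$. **Proposition.** The integral $\mathcal Z_p(\varphi^\star,f^\dagger)$ converges absolutely. (i) If $p\nmid N^+$, then $$\mathcal Z_p(\varphi^\star,f^\dagger)=\mathrm{vol}(\mathcal U_p)\cdot\frac{L(1,\mathrm{As}^+(\pi))}{\zeta_p(2)\zeta_p(4)}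 .$$ (ii) If $p\mid N^+$, then $f^\dagger$ is an eigenvector of the Atkin–Lehner element $\eta=\left(\begin{pmatrix}0&1\\-\varpi&0\end{pmatrix},1\right)\in H^0(\mathbf Q_p)$, for any uniformizer $\varpi$ of $F$, with eigenvalue $\varepsilon_p\in\{\pm1\}$, and $$\mathcal Z_p(\varphi^\star,f^\dagger)=\mathrm{vol}(\mathcal U_p)\cdot p^{-2}(1+\varepsilon_p)\cdot\frac{L(1,\mathrm{As}^+(\pi))}{\zeta_p(1)\zeta_p(2)} .$$ -/

import Mathlib

open scoped MatrixGroups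
open MeasureTheory

noncomputable section

namespace AsaiZeta

/-! ## The quadratic extension `F / ℚ_p` -/

section Field

variable (p : ℕ) [Fact p.Prime]
variable (F : Type*) [NormedField F] [NormedAlgebra ℚ_[p] F] [Algebra.IsQuadraticExtension ℚ_[p] F]

theorem card_gal : Nat.card (F ≃ₐ[ℚ_[p]] F) = 2 := by
  rw [IsGalois.card_aut_eq_finrank, Algebra.IsQuadraticExtension.finrank_eq_two]

theorem exists_galConj : ∃ c : F ≃ₐ[ℚ_[p]] F, c ≠ 1 := by
  have h : 1 < Nat.card (F ≃ₐ[ℚ_[p]] F) := by rw [card_gal]; norm_num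
  have : Nontrivial (F ≃ₐ[ℚ_[p]] F) := Finite.one_lt_card_iff_nontrivial.1 h
  exact exists_ne 1

/-- The non-trivial automorphism `x ↦ x^c` of `F / ℚ_p`. -/
def galConj : F ≃ₐ[ℚ_[p]] F := Classical.choose (exists_galConj p F)

theorem galConj_ne_one : galConj p F ≠ 1 := Classical.choose_spec (exists_galConj p F)

theorem univ_gal [Fintype (F ≃ₐ[ℚ_[p]] F)] [DecidableEq (F ≃ₐ[ℚ_[p]] F)] :
    (Finset.univ : Finset (F ≃ₐ[ℚ_[p]] F)) = {1, galConj p F} := by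
  symm
  apply Finset.eq_univ_of_card
  rw [Finset.card_pair (galConj_ne_one p F).symm, ← Nat.card_eq_fintype_card, card_gal]

theorem norm_eq (z : F) : algebraMap ℚ_[p] F (Algebra.norm ℚ_[p] z) = z * galConj p F z := by
  classical
  rw [Algebra.norm_eq_prod_automorphisms, univ_gal, Finset.prod_pair (galConj_ne_one p F).symm]
  rfl

theorem trace_eq (z : F) : algebraMap ℚ_[p] F (Algebra.trace ℚ_[p] F z) = z + galConj p F z := by
  classical
  rw [trace_eq_sum_automorphisms, univ_gal, Finset.sum_pair (galConj_ne_one p F).symm]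
  rfl

theorem galConj_galConj (z : F) : galConj p F (galConj p F z) = z := by
  have h := pow_card_eq_one' (G := F ≃ₐ[ℚ_[p]] F) (x := galConj p F)
  rw [card_gal] at h
  have := congrArg (fun e : F ≃ₐ[ℚ_[p]] F => e z) h
  simpa [pow_two] using this

/-! ## The quadratic space `V = {x ∈ M₂(F) : x^* = x^c}` and the group `H⁰` -/

/-- The quadratic space `V`; the main involution `*` of `M₂` is the adjugate. -/
def quadSpace : Submodule ℚ_[p] (Matrix (Fin 2) (Fin 2) F) where
  carrier := {x | x.adjugate = x.map (galConj p F)}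
  zero_mem' := by
    ext i j
    fin_cases i <;> fin_cases j <;> simp
  add_mem' := by
    intro x y hx hy
    simp only [Set.mem_ofPred_eq, ← Matrix.ext_iff, Matrix.adjugate_fin_two, Matrix.map_apply,
      Fin.forall_fin_two, Matrix.add_apply, map_add] at hx hy ⊢
    simp only [Matrix.of_apply, Matrix.cons_val', Matrix.cons_val_zero, Matrix.cons_val_one,
      Matrix.cons_val_fin_one] at hx hy ⊢
    obtain ⟨⟨h1, h2⟩, h3, h4⟩ := hx
    obtain ⟨⟨k1, k2⟩, k3, k4⟩ := hy
    refine ⟨⟨?_, ?_⟩, ?_, ?_⟩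
    · rw [h1, k1]
    · rw [← h2, ← k2]; ring
    · rw [← h3, ← k3]; ring
    · rw [h4, k4]
  smul_mem' := by
    intro r x hx
    simp only [Set.mem_ofPred_eq, ← Matrix.ext_iff, Matrix.adjugate_fin_two, Matrix.map_apply,
      Fin.forall_fin_two, Matrix.smul_apply, map_smul] at hx ⊢
    simp only [Matrix.of_apply, Matrix.cons_val', Matrix.cons_val_zero, Matrix.cons_val_one,
      Matrix.cons_val_fin_one] at hx ⊢
    obtain ⟨⟨h1, h2⟩, h3, h4⟩ := hx
    refine ⟨⟨?_, ?_⟩, ?_, ?_⟩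
    · rw [h1]
    · rw [← h2, smul_neg]
    · rw [← h3, smul_neg]
    · rw [h4]

/-- The quadratic form `n(x) = x x^* = det x ∈ ℚ_p` on `V`, as half of the trace from `F` to `ℚ_p`
(see `algebraMap_quadForm`). -/
def quadForm (x : quadSpace p F) : ℚ_[p] :=
  2⁻¹ * Algebra.trace ℚ_[p] F (x : Matrix (Fin 2) (Fin 2) F).det

theorem algebraMap_quadForm (x : quadSpace p F) :
    algebraMap ℚ_[p] F (quadForm p F x) = (x : Matrix (Fin 2) (Fin 2) F).det := by
  have hx : (x : Matrix (Fin 2) (Fin 2) F).adjugate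
      = (x : Matrix (Fin 2) (Fin 2) F).map (galConj p F) := x.2
  have h : galConj p F (x : Matrix (Fin 2) (Fin 2) F).det
      = (x : Matrix (Fin 2) (Fin 2) F).det := by
    have h1 := AlgEquiv.map_det (galConj p F) (x : Matrix (Fin 2) (Fin 2) F)
    have h2 : (galConj p F).mapMatrix (x : Matrix (Fin 2) (Fin 2) F)
        = (x : Matrix (Fin 2) (Fin 2) F).adjugate := hx.symm
    rw [h1, h2, Matrix.det_adjugate]
    simp
  have : CharZero F := charZero_of_injective_algebraMap (algebraMap ℚ_[p] F).injective
  rw [quadForm, map_mul, trace_eq, h, map_inv₀, map_ofNat]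
  field_simp
  ring

/-- The bilinear form `(x, y) = n(x + y) - n(x) - n(y)` on `V`. -/
def bilin (x y : quadSpace p F) : ℚ_[p] :=
  quadForm p F (x + y) - quadForm p F x - quadForm p F y

/-- The embedding `z ↦ (z, N(z))` of `F^×` in `GL₂(F) × ℚ_p^×`. -/
def embUnits : Fˣ →* GL (Fin 2) F × ℚ_[p]ˣ :=
  (Matrix.GeneralLinearGroup.scalar (Fin 2)).prod (Units.map (Algebra.norm ℚ_[p]))

instance : (embUnits p F).range.Normal where
  conj_mem := by
    rintro _ ⟨z, rfl⟩ g
    refine ⟨z, ?_⟩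
    have h : g * embUnits p F z = embUnits p F z * g := by
      ext1
      · exact (Matrix.GeneralLinearGroup.scalar_commute z g.1).symm
      · exact mul_comm _ _
    rw [h, mul_inv_cancel_right]

/-- The group `H⁰(ℚ_p) = (GL₂(F) × ℚ_p^×) / F^×`. -/
abbrev H0 : Type _ := (GL (Fin 2) F × ℚ_[p]ˣ) ⧸ (embUnits p F).range

/-- The map `x ↦ α⁻¹ a x (a^c)^*` on `V`. -/
def rhoAux (g : GL (Fin 2) F × ℚ_[p]ˣ) : quadSpace p F →ₗ[ℚ_[p]] quadSpace p F where
  toFun x := ⟨(g.2⁻¹ : ℚ_[p]ˣ).val • ((g.1 : Matrix (Fin 2) (Fin 2) F)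
      * (x : Matrix (Fin 2) (Fin 2) F)
      * ((g.1 : Matrix (Fin 2) (Fin 2) F).map (galConj p F)).adjugate), by
    refine Submodule.smul_mem _ _ ?_
    have hx : (x : Matrix (Fin 2) (Fin 2) F).adjugate
      = (galConj p F).mapMatrix (x : Matrix (Fin 2) (Fin 2) F) := x.2
    set a := (g.1 : Matrix (Fin 2) (Fin 2) F)
    change (a * x.1 * ((galConj p F).mapMatrix a).adjugate).adjugate
      = (galConj p F).mapMatrix (a * x.1 * ((galConj p F).mapMatrix a).adjugate)
    have h1 : (galConj p F).mapMatrix (((galConj p F).mapMatrix a).adjugate) = a.adjugate := by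
      have h2 := RingHom.map_adjugate ((galConj p F : F ≃+* F) : F →+* F)
        ((galConj p F).mapMatrix a)
      refine h2.trans (congrArg _ ?_)
      ext i j
      exact galConj_galConj p F _
    rw [Matrix.adjugate_mul_distrib, Matrix.adjugate_mul_distrib, map_mul, map_mul, h1, hx,
      Matrix.adjugate_adjugate _ (by simp), mul_assoc]
    simp⟩
  map_add' x y := by
    ext1
    simp [mul_add, add_mul]
  map_smul' r x := by
    ext1
    simp [smul_comm r]

/-- The action `ϱ(a, α) x = α⁻¹ a x (a^c)^*` of `H⁰(ℚ_p)` on `V`. -/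
def rho : Representation ℚ_[p] (H0 p F) (quadSpace p F) :=
  QuotientGroup.lift _
    { toFun := rhoAux p F
      map_one' := by
        ext1 x
        ext1
        have : ((1 : Matrix (Fin 2) (Fin 2) F).map (galConj p F)) = 1 := by simp
        simp [rhoAux, this]
      map_mul' := by
        intro g h
        ext1 x
        ext1
        have : (((g.1 : Matrix (Fin 2) (Fin 2) F) * (h.1 : Matrix (Fin 2) (Fin 2) F)).map (galConj p F))
            = (g.1 : Matrix (Fin 2) (Fin 2) F).map (galConj p F)
              * (h.1 : Matrix (Fin 2) (Fin 2) F).map (galConj p F) := by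
          exact map_mul (galConj p F).mapMatrix _ _
        simp [rhoAux, this, Matrix.adjugate_mul_distrib, mul_assoc, smul_smul, mul_comm] }
    (by
      rintro _ ⟨z, rfl⟩
      rw [MonoidHom.mem_ker]
      ext1 x
      ext1
      have hz : algebraMap ℚ_[p] F (Algebra.norm ℚ_[p] (z : F)) = (z : F) * galConj p F z :=
        norm_eq p F z
      have hz0 : (z : F) * galConj p F z ≠ 0 := by simp
      have h1 : (((embUnits p F z).1 : GL (Fin 2) F) : Matrix (Fin 2) (Fin 2) F)
          = Matrix.scalar (Fin 2) (z : F) := rfl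
      have h2 : (((embUnits p F z).2⁻¹ : ℚ_[p]ˣ) : ℚ_[p])
          = (Algebra.norm ℚ_[p] (z : F))⁻¹ := by
        rw [Units.val_inv_eq_inv_val]; rfl
      have h3 : ((Matrix.scalar (Fin 2) (z : F)).map (galConj p F)).adjugate
          = Matrix.scalar (Fin 2) (galConj p F z) := by
        ext i j
        fin_cases i <;> fin_cases j <;> simp
      change (((embUnits p F z).2⁻¹ : ℚ_[p]ˣ) : ℚ_[p]) •
          ((((embUnits p F z).1 : GL (Fin 2) F) : Matrix (Fin 2) (Fin 2) F) * x.1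
            * ((((embUnits p F z).1 : GL (Fin 2) F) : Matrix (Fin 2) (Fin 2) F).map
              (galConj p F)).adjugate) = x.1
      rw [h2, h1, h3, ← algebraMap_smul F, map_inv₀, hz]
      ext i j
      simp only [Matrix.scalar_apply, Matrix.smul_apply, smul_eq_mul, Matrix.mul_diagonal,
        Matrix.diagonal_mul]
      field_simp)

/-- The similitude character `ν(ϱ(a, α)) = α⁻² N(det a)`. -/
def nu : H0 p F →* ℚ_[p]ˣ :=
  QuotientGroup.lift _
    ((Units.map (Algebra.norm ℚ_[p])).comp
        (Matrix.GeneralLinearGroup.det.comp (MonoidHom.fst (GL (Fin 2) F) ℚ_[p]ˣ))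
      * ((zpowGroupHom (-2)).comp (MonoidHom.snd (GL (Fin 2) F) ℚ_[p]ˣ)))
    (by
      rintro _ ⟨z, rfl⟩
      rw [MonoidHom.mem_ker]
      have h : Matrix.GeneralLinearGroup.det (embUnits p F z).1 = z * z := by
        ext1
        change (Matrix.scalar (Fin 2) (z : F)).det = _
        simp [pow_two]
      change Units.map (Algebra.norm ℚ_[p]) (Matrix.GeneralLinearGroup.det (embUnits p F z).1)
        * (Units.map (Algebra.norm ℚ_[p]) z) ^ (-2 : ℤ) = 1
      rw [h, map_mul]
      group)

/-- The group `H⁰₁(ℚ_p) = {h ∈ H⁰(ℚ_p) : ν(h) = 1} ≃ SO(V)`. -/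
def H10 : Subgroup (H0 p F) := (nu p F).ker

instance : MeasurableSpace (H10 p F) := borel _
instance : BorelSpace (H10 p F) := ⟨rfl⟩

/-! ## The local Weil representation and the pairing `B_ω` -/

/-- The space `X = V ⊕ V`. -/
abbrev X : Type _ := quadSpace p F × quadSpace p F

instance : MeasurableSpace (X p F) := borel _
instance : BorelSpace (X p F) := ⟨rfl⟩

theorem norm_p_pow_mul_le (x : ℚ_[p]) : ‖(p : ℚ_[p]) ^ (-x.valuation).toNat * x‖ ≤ 1 := by
  rcases eq_or_ne x 0 with rfl | hx
  · simp
  have hp : (1 : ℝ) ≤ p := by exact_mod_cast (Fact.out : p.Prime).one_le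
  have hp0 : (p : ℝ) ≠ 0 := by positivity
  rw [norm_mul, norm_pow, Padic.norm_p, Padic.norm_eq_zpow_neg_valuation hx, inv_pow,
    ← zpow_natCast, ← zpow_neg, ← zpow_add₀ hp0]
  exact zpow_le_one_of_nonpos₀ hp (by have := Int.self_le_toNat (-x.valuation); omega)

/-- The fractional part of `x ∈ ℚ_p`: the rational `m / p ^ n ∈ [0, 1)` with
`x - m / p ^ n ∈ ℤ_p`. -/
def fracPart (x : ℚ_[p]) : ℚ :=
  (PadicInt.appr (⟨(p : ℚ_[p]) ^ (-x.valuation).toNat * x, norm_p_pow_mul_le p x⟩ : ℤ_[p])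
    (-x.valuation).toNat : ℚ) / (p : ℚ) ^ (-x.valuation).toNat

/-- The standard additive character `ψ_p(x) = exp(-2πi {x}_p)` of `ℚ_p`. -/
def psi (x : ℚ_[p]) : ℂ :=
  Complex.exp (-(2 * Real.pi * Complex.I * (fracPart p x : ℂ)))

/-- The Fourier transform on `X`, with respect to `ψ_p`, the bilinear form of `V` and the measure
`dx`. -/
def fourier (dx : Measure (X p F)) (φ : X p F → ℂ) (y : X p F) : ℂ :=
  ∫ x, φ x * psi p (bilin p F x.1 y.1 + bilin p F x.2 y.2) ∂dx

/-- `dx` is self-dual: Fourier inversion `φ^^(x) = φ(-x)` holds for every Bruhat-Schwartz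
function. -/
def IsSelfDual (dx : Measure (X p F)) : Prop :=
  ∀ φ : X p F → ℂ, IsLocallyConstant φ → HasCompactSupport φ →
    ∀ x, fourier p F dx (fourier p F dx φ) x = φ (-x)

/-- The Weil representation of `H⁰₁(ℚ_p)` on functions on `X`: `(ω(h)φ)(x) = φ(h⁻¹ x)`
(the factor `|ν(h)|⁻²` is `1`). -/
def weil (h : H10 p F) (φ : X p F → ℂ) (x : X p F) : ℂ :=
  φ (rho p F (h : H0 p F)⁻¹ x.1, rho p F (h : H0 p F)⁻¹ x.2)

/-- The Hermitian pairing `B_ω(φ₁, φ₂) = ∫ φ₁(x) \overline{φ₂(x)} dx`. -/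
def weilPairing (dx : Measure (X p F)) (φ₁ φ₂ : X p F → ℂ) : ℂ :=
  ∫ x, φ₁ x * (starRingEnd ℂ) (φ₂ x) ∂dx

/-! ## Eichler orders, the lattice `L`, the test function, the group `U_p` -/

section Order

variable [IsUltrametricDist F]

/-- The standard Eichler order of level `p ^ n` in `M₂(O_F)`: integral matrices whose lower left
entry lies in `p ^ n O_F`. -/
def eichlerOrder (n : ℕ) : Subring (Matrix (Fin 2) (Fin 2) F) where
  carrier := {g | (∀ i j, ‖g i j‖ ≤ 1) ∧ ‖g 1 0‖ ≤ ‖((p : F) ^ n)‖}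
  zero_mem' := by simp
  one_mem' := by
    refine ⟨fun i j => ?_, by simp⟩
    fin_cases i <;> fin_cases j <;> simp
  add_mem' := by
    rintro a b ⟨ha, ha'⟩ ⟨hb, hb'⟩
    exact ⟨fun i j => (IsUltrametricDist.norm_add_le_max _ _).trans (max_le (ha i j) (hb i j)),
      (IsUltrametricDist.norm_add_le_max _ _).trans (max_le ha' hb')⟩
  neg_mem' := by
    rintro a ⟨ha, ha'⟩
    exact ⟨fun i j => by simpa using ha i j, by simpa using ha'⟩
  mul_mem' := by
    rintro a b ⟨ha, ha'⟩ ⟨hb, hb'⟩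
    refine ⟨fun i j => ?_, ?_⟩
    · rw [Matrix.mul_apply, Fin.sum_univ_two]
      refine (IsUltrametricDist.norm_add_le_max _ _).trans (max_le ?_ ?_) <;> rw [norm_mul]
      · exact mul_le_one₀ (ha _ _) (norm_nonneg _) (hb _ _)
      · exact mul_le_one₀ (ha _ _) (norm_nonneg _) (hb _ _)
    · rw [Matrix.mul_apply, Fin.sum_univ_two]
      refine (IsUltrametricDist.norm_add_le_max _ _).trans (max_le ?_ ?_) <;> rw [norm_mul]
      · exact (mul_le_of_le_one_right (norm_nonneg _) (hb _ _)).trans ha'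
      · exact (mul_le_of_le_one_left (norm_nonneg _) (ha _ _)).trans hb'

/-- The unit group `R^×` of the Eichler order `R` of level `p ^ n`. -/
def K0 (n : ℕ) : Subgroup (GL (Fin 2) F) := (eichlerOrder p F n).toSubmonoid.units

/-- The lattice `L = R ∩ V`, for the Eichler order `R` of level `p ^ n`. -/
def lattice (n : ℕ) : Set (quadSpace p F) :=
  {x | (x : Matrix (Fin 2) (Fin 2) F) ∈ eichlerOrder p F n}

/-- The test function `φ^⋆`: the characteristic function of `L ⊕ L`. -/
def phiStar (n : ℕ) : X p F → ℂ :=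
  (lattice p F n ×ˢ lattice p F n).indicator (fun _ => 1)

/-- The unit group `ℤ_p^×` in `ℚ_p^×`. -/
def unitsZp : Subgroup ℚ_[p]ˣ where
  carrier := {u | ‖(u : ℚ_[p])‖ = 1}
  one_mem' := by simp
  mul_mem' := by
    intro a b ha hb
    simp only [Set.mem_ofPred_eq] at ha hb ⊢
    simp [ha, hb]
  inv_mem' := by
    intro a ha
    simp only [Set.mem_ofPred_eq] at ha ⊢
    simp [ha]

/-- The group `U_p = H⁰₁(ℚ_p) ∩ (R^× × ℤ_p^×) / O_F^×`, for the Eichler order `R` of level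
`p ^ n`. -/
def openCompact (n : ℕ) : Subgroup (H10 p F) :=
  (((K0 p F n).prod (unitsZp p)).map (QuotientGroup.mk' (embUnits p F).range)).subgroupOf (H10 p F)

end Order

end Field

/-! ## Representations of `GL₂(F)` and of `PGL₂(F)` -/

section Rep

variable (p : ℕ) [Fact p.Prime]
variable (F : Type*) [NormedField F] [NormedAlgebra ℚ_[p] F] [Algebra.IsQuadraticExtension ℚ_[p] F]

/-- The representation of `GL₂(F)` by right translation on all complex functions on `GL₂(F)`. -/
def rightTranslation : Representation ℂ (GL (Fin 2) F) (GL (Fin 2) F → ℂ) where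
  toFun g :=
    { toFun := fun f x => f (x * g)
      map_add' := fun _ _ => rfl
      map_smul' := fun _ _ => rfl }
  map_one' := by
    ext f x
    simp
  map_mul' g h := by
    ext f x
    simp [mul_assoc]

/-- For a function `θ` of the diagonal entries, the space of functions `f` on `GL₂(F)` that are
right invariant under some open subgroup and satisfy `f(t g) = θ(a, d) f(g)` for all upper
triangular `t` with diagonal entries `a, d`. -/
def induced (θ : Fˣ → Fˣ → ℂ) : Submodule ℂ (GL (Fin 2) F → ℂ) where
  carrier := {f | (∀ (t g : GL (Fin 2) F) (a d : Fˣ), t 1 0 = 0 → t 0 0 = a → t 1 1 = d →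
      f (t * g) = θ a d * f g) ∧
    ∃ U : Subgroup (GL (Fin 2) F), IsOpen (U : Set (GL (Fin 2) F)) ∧
      ∀ g, ∀ u ∈ U, f (g * u) = f g}
  zero_mem' := ⟨by simp, ⊤, by simp, by simp⟩
  add_mem' := by
    rintro f f' ⟨h, U, hU, hf⟩ ⟨h', U', hU', hf'⟩
    refine ⟨fun t g a d h0 h1 h2 => ?_, U ⊓ U', hU.inter hU', fun g u hu => ?_⟩
    · simp only [Pi.add_apply, h t g a d h0 h1 h2, h' t g a d h0 h1 h2, mul_add]
    · simp only [Pi.add_apply, hf g u hu.1, hf' g u hu.2]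
  smul_mem' := by
    rintro z f ⟨h, U, hU, hf⟩
    refine ⟨fun t g a d h0 h1 h2 => ?_, U, hU, fun g u hu => ?_⟩
    · simp only [Pi.smul_apply, h t g a d h0 h1 h2, smul_eq_mul]
      ring
    · simp only [Pi.smul_apply, hf g u hu]

theorem induced_le_comap (θ : Fˣ → Fˣ → ℂ) (g : GL (Fin 2) F) :
    induced F θ ≤ (induced F θ).comap (rightTranslation F g) := by
  rintro f ⟨h, U, hU, hf⟩
  refine ⟨fun t x a d h0 h1 h2 => ?_, U.comap (MulAut.conj g⁻¹).toMonoidHom, ?_, fun x u hu => ?_⟩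
  · change f (t * x * g) = _ * f (x * g)
    rw [mul_assoc, h t _ a d h0 h1 h2]
  · refine hU.preimage ?_
    change Continuous fun x : GL (Fin 2) F => g⁻¹ * x * (g⁻¹)⁻¹
    fun_prop
  · change f (x * u * g) = f (x * g)
    have hu' : g⁻¹ * u * (g⁻¹)⁻¹ ∈ U := hu
    rw [← hf (x * g) _ hu']
    congr 1
    group

/-- The representation of `GL₂(F)` by right translation on `induced F θ`. -/
def inducedRep (θ : Fˣ → Fˣ → ℂ) : Representation ℂ (GL (Fin 2) F) (induced F θ) :=
  (rightTranslation F).subrepresentation (induced F θ) (induced_le_comap F θ)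

/-- The normalized absolute value of `F` (the norm of `F` extends that of `ℚ_p`). -/
def absF (x : F) : ℝ := ‖x‖ ^ Module.finrank ℚ_[p] F

/-- The principal series `π(μ, ν)`: right translation on smooth functions with
`f(t g) = μ(a) ν(d) |a / d|^{1/2} f(g)`. -/
def principalSeries (μ ν : Fˣ →* ℂˣ) :=
  inducedRep F (fun a d => (μ a : ℂ) * ν d * ((absF p F (a / d) ^ (1 / 2 : ℝ) : ℝ) : ℂ))

/-- The constant functions among the smooth functions on `B \ GL₂(F)`. -/
def constants : Submodule ℂ (induced F (fun _ _ => 1)) where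
  carrier := {f | ∃ z : ℂ, ∀ g, f.1 g = z}
  zero_mem' := ⟨0, fun _ => rfl⟩
  add_mem' := by
    rintro f f' ⟨z, h⟩ ⟨z', h'⟩
    exact ⟨z + z', fun g => by rw [← h g, ← h' g]; rfl⟩
  smul_mem' := by
    rintro c f ⟨z, h⟩
    exact ⟨c * z, fun g => by rw [← h g]; rfl⟩

/-- The Steinberg representation `St` of `GL₂(F)`: smooth functions on `B \ GL₂(F) = P¹(F)` modulo
constants. -/
def steinberg :
    Representation ℂ (GL (Fin 2) F) (induced F (fun _ _ => 1) ⧸ constants F) :=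
  (inducedRep F (fun _ _ => 1)).quotient (constants F) (by
    rintro g f ⟨z, h⟩
    exact ⟨z, fun x => h (x * g)⟩)

/-- The twist `ρ ⊗ (χ ∘ det)`. -/
def twist {W : Type*} [AddCommGroup W] [Module ℂ W] (ρ : Representation ℂ (GL (Fin 2) F) W)
    (χ : Fˣ →* ℂˣ) : Representation ℂ (GL (Fin 2) F) W where
  toFun g := (χ (Matrix.GeneralLinearGroup.det g) : ℂ) • ρ g
  map_one' := by simp
  map_mul' g h := by
    ext v
    simp [smul_smul, mul_comm]

/-! ## Local `L`-factors -/

/-- For an unramified extension `E` of `ℚ_p` (uniformizer `p`, residue field with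
`p ^ [E : ℚ_p]` elements), the `L`-factor `L(s, χ)` of a character `χ` of `E^×`. -/
def charL (E : Type*) [NormedField E] [NormedAlgebra ℚ_[p] E] (χ : Eˣ → ℂ) (s : ℂ) : ℂ :=
  open Classical in
  if ∀ u : Eˣ, ‖(u : E)‖ = 1 → χ u = 1 then
    (1 - χ (Units.map (algebraMap ℚ_[p] E).toMonoidHom
        (Units.mk0 (p : ℚ_[p]) (by exact_mod_cast (Fact.out : p.Prime).ne_zero)))
      * ((p : ℂ) ^ Module.finrank ℚ_[p] E) ^ (-s))⁻¹
  else 1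

/-- The Euler factor `ζ_p(s) = (1 - p^{-s})⁻¹`. -/
def zetaP (s : ℂ) : ℂ := (1 - (p : ℂ) ^ (-s))⁻¹

/-- The inclusion `ℚ_p^× → F^×`. -/
def incl : ℚ_[p]ˣ →* Fˣ := Units.map (algebraMap ℚ_[p] F).toMonoidHom

/-- The quadratic character `τ` of `ℚ_p^×` attached to `F / ℚ_p`: `1` on norms from `F^×` and `-1`
on the other elements. -/
def tau (x : ℚ_[p]ˣ) : ℂ :=
  open Classical in
  if ∃ z : F, Algebra.norm ℚ_[p] z = (x : ℚ_[p]) then 1 else -1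

variable {V : Type*} [AddCommGroup V] [Module ℂ V]

/-- A representation of `PGL₂(F)`, as a representation of `GL₂(F)`. -/
def toGL (π : Representation ℂ (PGL(2, F)) V) : Representation ℂ (GL (Fin 2) F) V :=
  π.comp Matrix.ProjGenLinGroup.mk

/-- `L` is the Asai `L`-function `s ↦ L(s, As⁺(π))` of `π`, for `π` either an unramified principal
series `π(μ, ν)` or a special representation `St ⊗ (χ ∘ det)`. -/
inductive IsAsaiL (π : Representation ℂ (PGL(2, F)) V) : (ℂ → ℂ) → Prop
  | principal (μ ν : Fˣ →* ℂˣ)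
      (hμ : ∀ u : Fˣ, ‖(u : F)‖ = 1 → μ u = 1) (hν : ∀ u : Fˣ, ‖(u : F)‖ = 1 → ν u = 1)
      (h₁ : ¬ ∀ x : Fˣ, ((μ x / ν x : ℂˣ) : ℂ) = (absF p F x : ℂ))
      (h₂ : ¬ ∀ x : Fˣ, ((μ x / ν x : ℂˣ) : ℂ) = ((absF p F x)⁻¹ : ℂ))
      (e : Nonempty ((toGL F π).Equiv (principalSeries p F μ ν))) :
      IsAsaiL π fun s =>
        charL p ℚ_[p] (fun x => (μ (incl p F x) : ℂ)) s
          * charL p F (fun x => (μ x : ℂ) * ν x) s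
          * charL p ℚ_[p] (fun x => (ν (incl p F x) : ℂ)) s
  | special (χ : Fˣ →* ℂˣ) (hχ : Continuous χ)
      (e : Nonempty ((toGL F π).Equiv (twist F (steinberg F) χ))) :
      IsAsaiL π fun s =>
        charL p ℚ_[p] (fun x => (χ (incl p F x) : ℂ)) (s + 1)
          * charL p ℚ_[p] (fun x => tau p F x * (χ (incl p F x) : ℂ)) s

/-- The projection `H⁰(ℚ_p) → PGL₂(F)`, `(a, α) ↦ a`. -/
def toPGL : H0 p F →* PGL(2, F) :=
  QuotientGroup.lift _
    (Matrix.ProjGenLinGroup.mk.comp (MonoidHom.fst (GL (Fin 2) F) ℚ_[p]ˣ))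
    (by
      rintro _ ⟨z, rfl⟩
      exact Matrix.ProjGenLinGroup.mk_scalar z)

/-- The representation `σ = π ⊠ 1` of `H⁰(ℚ_p)`. -/
def sigma (π : Representation ℂ (PGL(2, F)) V) : Representation ℂ (H0 p F) V :=
  π.comp (toPGL p F)

/-- `B` is a `G`-invariant positive definite Hermitian form for the representation `π`. -/
structure IsInvariantForm {G : Type*} [Group G] (π : Representation ℂ G V)
    (B : V →ₗ[ℂ] V →ₗ⋆[ℂ] ℂ) : Prop where
  invariant : ∀ g v w, B (π g v) (π g w) = B v w
  symm : ∀ v w, B w v = (starRingEnd ℂ) (B v w)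
  pos : ∀ v, v ≠ 0 → 0 < (B v v).re

/-- `f` is a new vector of `π`, of conductor `p ^ n`: it is nonzero and fixed by the units of the
Eichler order of level `p ^ n`, while those of level `p ^ m` with `m < n` fix no nonzero vector. -/
structure IsNewVector [IsUltrametricDist F] (π : Representation ℂ (PGL(2, F)) V) (n : ℕ) (f : V) :
    Prop where
  ne_zero : f ≠ 0
  fixed : ∀ k ∈ K0 p F n, toGL F π k f = f
  minimal : ∀ m < n, ∀ v : V, (∀ k ∈ K0 p F m, toGL F π k v = v) → v = 0

/-- The Atkin-Lehner element `η = ((0, 1; -ϖ, 0), 1)` of `H⁰(ℚ_p)`. -/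
def atkinLehner (ϖ : Fˣ) : H0 p F :=
  QuotientGroup.mk (Matrix.GeneralLinearGroup.mkOfDetNeZero !![0, 1; -(ϖ : F), 0] (by simp), 1)

/-- The integrand `h ↦ B_ω(ω(h)φ, φ) B(σ(h)f, f)` of the local zeta integral. -/
def zetaIntegrand (dx : Measure (X p F)) (π : Representation ℂ (PGL(2, F)) V)
    (B : V →ₗ[ℂ] V →ₗ⋆[ℂ] ℂ) (φ : X p F → ℂ) (f : V) (h : H10 p F) : ℂ :=
  weilPairing p F dx (weil p F h φ) φ * B (sigma p F π (h : H0 p F) f) f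

/-- The local zeta integral `Z_p(φ, f) = ∫_{H⁰₁(ℚ_p)} B_ω(ω(h)φ, φ) B(σ(h)f, f) dh`. -/
def zetaIntegral (dh : Measure (H10 p F)) (dx : Measure (X p F))
    (π : Representation ℂ (PGL(2, F)) V) (B : V →ₗ[ℂ] V →ₗ⋆[ℂ] ℂ) (φ : X p F → ℂ) (f : V) : ℂ :=
  ∫ h, zetaIntegrand p F dx π B φ f h ∂dh

end Rep

end AsaiZeta

end

namespace AsaiZeta

section Field

set_option linter.unusedSectionVars false

variable (p : ℕ) [Fact p.Prime]

theorem one_lt_prime : (1 : ℝ) < p := by exact_mod_cast (Fact.out : p.Prime).one_lt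

theorem norm_sub_le_max' {E : Type*} [SeminormedAddCommGroup E] [IsUltrametricDist E] (x y : E) :
    ‖x - y‖ ≤ max ‖x‖ ‖y‖ := by
  simpa [sub_eq_add_neg] using IsUltrametricDist.norm_add_le_max x (-y)

theorem existsUnique_digit (u : ℚ_[p]) (hu : ‖u‖ ≤ 1) :
    ∃! i : ℕ, i ∈ Finset.range p ∧ ‖u - i‖ < 1 := by
  obtain ⟨n, hn, hm⟩ := PadicInt.exists_mem_range (⟨u, hu⟩ : ℤ_[p])
  rw [PadicInt.maximalIdeal_eq_span_p, Ideal.mem_span_singleton, ← PadicInt.norm_lt_one_iff_dvd] at hm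
  have hm' : ‖u - n‖ < 1 := hm
  refine ⟨n, ⟨Finset.mem_range.2 hn, hm'⟩, ?_⟩
  rintro j ⟨hj, hj'⟩
  rw [Finset.mem_range] at hj
  have h1 : ‖(((n : ℤ) - j : ℤ) : ℚ_[p])‖ < 1 := by
    have : (((n : ℤ) - j : ℤ) : ℚ_[p]) = (u - j) - (u - n) := by push_cast; ring
    rw [this]
    exact (norm_sub_le_max' _ _).trans_lt (max_lt hj' hm')
  rw [Padic.norm_intCast_lt_one_iff] at h1
  obtain ⟨k, hk⟩ := h1
  have hk0 : k = 0 := by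
    have hp : (0 : ℤ) < p := by exact_mod_cast (Fact.out : p.Prime).pos
    have h2 : (p : ℤ) * k < p * 1 := by omega
    have h3 : (p : ℤ) * (-1) < p * k := by omega
    have := lt_of_mul_lt_mul_left h2 hp.le
    have := lt_of_mul_lt_mul_left h3 hp.le
    omega
  subst hk0
  omega

variable (F : Type*) [NormedField F] [NormedAlgebra ℚ_[p] F] [Algebra.IsQuadraticExtension ℚ_[p] F]

theorem properSpace (p : ℕ) [Fact p.Prime] (F : Type*) [NormedField F] [NormedAlgebra ℚ_[p] F]
    [Algebra.IsQuadraticExtension ℚ_[p] F] : ProperSpace F :=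
  FiniteDimensional.proper ℚ_[p] F

theorem norm_prime : ‖(p : F)‖ = (p : ℝ)⁻¹ := by
  have := norm_algebraMap' F (p : ℚ_[p])
  rwa [map_natCast, Padic.norm_p] at this

theorem prime_ne_zero : (p : F) ≠ 0 := by
  rw [← norm_pos_iff, norm_prime p F]
  have := one_lt_prime p
  positivity

theorem continuous_galConj : Continuous (galConj p F) :=
  LinearMap.continuous_of_finiteDimensional (galConj p F).toLinearMap

theorem norm_galConj (z : F) : ‖galConj p F z‖ = ‖z‖ := by
  have key : ∀ z : F, ‖galConj p F z‖ ≤ ‖z‖ := by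
    intro z
    let φ : F →L[ℚ_[p]] F := LinearMap.toContinuousLinearMap (galConj p F).toLinearMap
    have hφ : ∀ z, φ z = galConj p F z := fun _ => rfl
    by_contra! h
    have hz : z ≠ 0 := by
      rintro rfl
      simp at h
    have hz' : 0 < ‖z‖ := norm_pos_iff.2 hz
    obtain ⟨n, hn⟩ := pow_unbounded_of_one_lt ‖φ‖ ((one_lt_div hz').2 h)
    have h1 := φ.le_opNorm (z ^ n)
    rw [hφ, map_pow, norm_pow, norm_pow] at h1
    rw [div_pow, lt_div_iff₀ (by positivity)] at hn
    exact absurd h1 (not_le.2 hn)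
  refine le_antisymm (key z) ?_
  have := key (galConj p F z)
  rwa [galConj_galConj] at this

theorem exists_algebraMap_of_galConj_eq (z : F) (h : galConj p F z = z) :
    ∃ r : ℚ_[p], algebraMap ℚ_[p] F r = z := by
  refine ⟨2⁻¹ * Algebra.trace ℚ_[p] F z, ?_⟩
  have : CharZero F := charZero_of_injective_algebraMap (algebraMap ℚ_[p] F).injective
  rw [map_mul, trace_eq, h, map_inv₀, map_ofNat]
  field_simp
  ring

theorem exists_galConj_ne : ∃ x : F, galConj p F x ≠ x := by
  by_contra! h
  exact galConj_ne_one p F (AlgEquiv.ext h)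

theorem norm_algebraNorm (z : F) : ‖Algebra.norm ℚ_[p] z‖ = ‖z‖ ^ 2 := by
  rw [← norm_algebraMap' F, norm_eq, norm_mul, norm_galConj, sq]

theorem exists_norm_one_smul (hinert : ∀ x : F, x ≠ 0 → ∃ k : ℤ, ‖x‖ = (p : ℝ) ^ k) (x : F)
    (hx : x ≠ 0) : ∃ r : ℚ_[p], r ≠ 0 ∧ ‖algebraMap ℚ_[p] F r * x‖ = 1 := by
  obtain ⟨k, hk⟩ := hinert x hx
  have hp : (p : ℝ) ≠ 0 := by have := one_lt_prime p; positivity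
  have hp' : (p : ℚ_[p]) ≠ 0 := by exact_mod_cast (Fact.out : p.Prime).ne_zero
  refine ⟨(p : ℚ_[p]) ^ k, zpow_ne_zero _ hp', ?_⟩
  rw [norm_mul, norm_algebraMap', norm_zpow, Padic.norm_p, hk, inv_zpow, inv_mul_cancel₀]
  exact zpow_ne_zero _ hp

theorem norm_lt_iff (hinert : ∀ x : F, x ≠ 0 → ∃ k : ℤ, ‖x‖ = (p : ℝ) ^ k) (x y : F) (hy : y ≠ 0) :
    ‖x‖ < ‖y‖ ↔ ‖x‖ * p ≤ ‖y‖ := by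
  have hp := one_lt_prime p
  have hy' := norm_pos_iff.2 hy
  rcases eq_or_ne x 0 with rfl | hx
  · simp [hy]
  obtain ⟨k, hk⟩ := hinert x hx
  obtain ⟨l, hl⟩ := hinert y hy
  rw [hk, hl, ← zpow_add_one₀ (by positivity), zpow_lt_zpow_iff_right₀ hp,
    zpow_le_zpow_iff_right₀ hp]
  omega

theorem exists_orthogonal (hinert : ∀ x : F, x ≠ 0 → ∃ k : ℤ, ‖x‖ = (p : ℝ) ^ k)
    [IsUltrametricDist F] :
    ∃ θ : F, ∀ u v : ℚ_[p],
      ‖algebraMap ℚ_[p] F u + algebraMap ℚ_[p] F v * θ‖ = max ‖u‖ ‖v‖ := by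
  have := properSpace p F
  obtain ⟨x, hx⟩ := exists_galConj_ne p F
  let S : Submodule ℚ_[p] F := LinearMap.range (Algebra.linearMap ℚ_[p] F)
  have hS : IsClosed (S : Set F) := Submodule.closed_of_finiteDimensional S
  obtain ⟨y, ⟨r, rfl⟩, hy⟩ := hS.exists_infDist_eq_dist ⟨0, S.zero_mem⟩ x
  have hmin : ∀ s : ℚ_[p], ‖x - algebraMap ℚ_[p] F r‖ ≤ ‖x - algebraMap ℚ_[p] F s‖ := by
    intro s
    have := Metric.infDist_le_dist_of_mem (x := x) (s := (S : Set F)) (y := algebraMap ℚ_[p] F s)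
      ⟨s, rfl⟩
    rw [hy, dist_eq_norm, dist_eq_norm] at this
    exact this
  have hne : x - algebraMap ℚ_[p] F r ≠ 0 := by
    intro h
    rw [sub_eq_zero] at h
    rw [h] at hx
    exact hx (AlgEquiv.commutes _ _)
  obtain ⟨s, hs, h1⟩ := exists_norm_one_smul p F hinert _ hne
  refine ⟨algebraMap ℚ_[p] F s * (x - algebraMap ℚ_[p] F r), fun u v => ?_⟩
  have hs' : algebraMap ℚ_[p] F s ≠ 0 := by simpa using hs
  have hv : ‖v‖ ≤ ‖algebraMap ℚ_[p] F u
      + algebraMap ℚ_[p] F v * (algebraMap ℚ_[p] F s * (x - algebraMap ℚ_[p] F r))‖ := by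
    rcases eq_or_ne v 0 with rfl | hv
    · simp
    have hv' : algebraMap ℚ_[p] F v ≠ 0 := by simpa using hv
    have h2 := hmin (r - u / (v * s))
    have h3 : algebraMap ℚ_[p] F u
        + algebraMap ℚ_[p] F v * (algebraMap ℚ_[p] F s * (x - algebraMap ℚ_[p] F r))
        = algebraMap ℚ_[p] F v * (algebraMap ℚ_[p] F s
          * (x - algebraMap ℚ_[p] F (r - u / (v * s)))) := by
      simp only [map_sub, map_div₀, map_mul]
      field_simp
      ring
    rw [norm_mul] at h1
    have h4 := mul_le_mul_of_nonneg_left h2 (norm_nonneg (algebraMap ℚ_[p] F s))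
    rw [h1, ← norm_mul] at h4
    rw [h3, norm_mul, norm_algebraMap']
    exact le_mul_of_one_le_right (norm_nonneg _) h4
  apply le_antisymm
  · refine (IsUltrametricDist.norm_add_le_max _ _).trans ?_
    rw [norm_mul, h1, norm_algebraMap', norm_algebraMap', mul_one]
  · refine max_le ?_ hv
    have h5 : algebraMap ℚ_[p] F u = (algebraMap ℚ_[p] F u
      + algebraMap ℚ_[p] F v * (algebraMap ℚ_[p] F s * (x - algebraMap ℚ_[p] F r)))
      - algebraMap ℚ_[p] F v * (algebraMap ℚ_[p] F s * (x - algebraMap ℚ_[p] F r)) := by ring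
    calc ‖u‖ = ‖algebraMap ℚ_[p] F u‖ := (norm_algebraMap' _ _).symm
      _ ≤ _ := by
        conv_lhs => rw [h5]
        refine (norm_sub_le_max' _ _).trans (max_le le_rfl ?_)
        rw [norm_mul, h1, norm_algebraMap', mul_one]
        exact hv

theorem exists_coords (θ : F)
    (hθ : ∀ u v : ℚ_[p], ‖algebraMap ℚ_[p] F u + algebraMap ℚ_[p] F v * θ‖ = max ‖u‖ ‖v‖) (z : F) :
    ∃ u v : ℚ_[p], z = algebraMap ℚ_[p] F u + algebraMap ℚ_[p] F v * θ := by
  have h0 : θ - galConj p F θ ≠ 0 := by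
    intro h
    obtain ⟨r, hr⟩ := exists_algebraMap_of_galConj_eq p F θ (sub_eq_zero.1 h).symm
    have h1 := hθ (-r) 1
    rw [map_neg, hr] at h1
    simp at h1
    have := le_max_right ‖r‖ (1 : ℝ)
    linarith
  have h0' : galConj p F θ - θ ≠ 0 := by
    intro h; apply h0; rw [← neg_sub, h, neg_zero]
  obtain ⟨v, hv⟩ := exists_algebraMap_of_galConj_eq p F
    ((z - galConj p F z) / (θ - galConj p F θ)) (by
      rw [map_div₀, map_sub, map_sub, galConj_galConj, galConj_galConj, div_eq_div_iff h0' h0]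
      ring)
  obtain ⟨u, hu⟩ := exists_algebraMap_of_galConj_eq p F (z - algebraMap ℚ_[p] F v * θ) (by
      rw [map_sub, map_mul, AlgEquiv.commutes, hv]
      field_simp
      ring)
  exact ⟨u, v, by rw [hu]; ring⟩

/-- A system of representatives of the residue field of `F`. -/
structure IsDigits (D : Finset F) : Prop where
  card : D.card = p ^ 2
  norm_le : ∀ b ∈ D, ‖b‖ ≤ 1
  existsUnique : ∀ z : F, ‖z‖ ≤ 1 → ∃! b, b ∈ D ∧ ‖z - b‖ < 1

theorem exists_isDigits (hinert : ∀ x : F, x ≠ 0 → ∃ k : ℤ, ‖x‖ = (p : ℝ) ^ k)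
    [IsUltrametricDist F] : ∃ D : Finset F, IsDigits p F D := by
  classical
  obtain ⟨θ, hθ⟩ := exists_orthogonal p F hinert
  let g : ℕ × ℕ → F := fun ij => algebraMap ℚ_[p] F ij.1 + algebraMap ℚ_[p] F ij.2 * θ
  have hsub : ∀ (u v : ℚ_[p]) (ij : ℕ × ℕ), ‖algebraMap ℚ_[p] F u + algebraMap ℚ_[p] F v * θ - g ij‖
      = max ‖u - ij.1‖ ‖v - ij.2‖ := by
    intro u v ij
    rw [← hθ]
    congr 1
    simp only [g, map_sub]
    ring
  have hnat : ∀ i : ℕ, ‖(i : ℚ_[p])‖ ≤ 1 := fun i => by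
    simpa using Padic.norm_int_le_one (p := p) i
  refine ⟨(Finset.range p ×ˢ Finset.range p).image g, ?_, ?_, ?_⟩
  · rw [Finset.card_image_of_injOn, Finset.card_product, Finset.card_range, sq]
    rintro ⟨i, j⟩ hij ⟨i', j'⟩ hij' h
    simp only [Finset.coe_product, Set.mem_prod, Finset.mem_coe] at hij hij'
    have h1 : ‖g (i, j) - g (i', j')‖ = 0 := by rw [h, sub_self, norm_zero]
    have h2 := hsub i j (i', j')
    change ‖g (i, j) - _‖ = _ at h2
    rw [h1] at h2
    have h3 : ‖(i : ℚ_[p]) - i'‖ < 1 := by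
      have := le_max_left ‖(i : ℚ_[p]) - i'‖ ‖(j : ℚ_[p]) - j'‖
      simp only at h2
      linarith
    have h4 : ‖(j : ℚ_[p]) - j'‖ < 1 := by
      have := le_max_right ‖(i : ℚ_[p]) - i'‖ ‖(j : ℚ_[p]) - j'‖
      simp only at h2
      linarith
    have e1 := (existsUnique_digit p i (hnat i)).unique ⟨hij.1, by simp⟩ ⟨hij'.1, h3⟩
    have e2 := (existsUnique_digit p j (hnat j)).unique ⟨hij.2, by simp⟩ ⟨hij'.2, h4⟩
    rw [e1, e2]
  · intro b hb
    obtain ⟨ij, -, rfl⟩ := Finset.mem_image.1 hb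
    rw [hθ]
    exact max_le (hnat _) (hnat _)
  · intro z hz
    obtain ⟨u, v, rfl⟩ := exists_coords p F θ hθ z
    rw [hθ, max_le_iff] at hz
    obtain ⟨i, ⟨hi, hi'⟩, hiu⟩ := existsUnique_digit p u hz.1
    obtain ⟨j, ⟨hj, hj'⟩, hju⟩ := existsUnique_digit p v hz.2
    refine ⟨g (i, j), ⟨Finset.mem_image_of_mem _ (Finset.mem_product.2 ⟨hi, hj⟩), ?_⟩, ?_⟩
    · rw [hsub]
      exact max_lt hi' hj'
    · rintro b ⟨hb, hb'⟩
      obtain ⟨⟨i', j'⟩, hij, rfl⟩ := Finset.mem_image.1 hb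
      rw [hsub, max_lt_iff] at hb'
      rw [Finset.mem_product] at hij
      rw [hiu i' ⟨hij.1, hb'.1⟩, hju j' ⟨hij.2, hb'.2⟩]

theorem exists_trace_zero_unit (hinert : ∀ x : F, x ≠ 0 → ∃ k : ℤ, ‖x‖ = (p : ℝ) ^ k) :
    ∃ δ : F, ‖δ‖ = 1 ∧ galConj p F δ = -δ := by
  obtain ⟨x, hx⟩ := exists_galConj_ne p F
  obtain ⟨r, -, hr⟩ := exists_norm_one_smul p F hinert (x - galConj p F x) (sub_ne_zero.2 hx.symm)
  refine ⟨_, hr, ?_⟩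
  rw [map_mul, AlgEquiv.commutes, map_sub, galConj_galConj]
  ring

theorem exists_algebraMap_mul_of_galConj_eq_neg {δ : F} (hδ : ‖δ‖ = 1) (hc : galConj p F δ = -δ)
    (z : F) (h : galConj p F z = -z) : ∃ r : ℚ_[p], z = algebraMap ℚ_[p] F r * δ := by
  have h0 : δ ≠ 0 := by rintro rfl; simp at hδ
  obtain ⟨r, hr⟩ := exists_algebraMap_of_galConj_eq p F (z / δ) (by
    rw [map_div₀, h, hc, neg_div_neg_eq])
  exact ⟨r, by rw [hr]; field_simp⟩

theorem norm_trace_le [IsUltrametricDist F] (z : F) : ‖Algebra.trace ℚ_[p] F z‖ ≤ ‖z‖ := by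
  rw [← norm_algebraMap' F, trace_eq]
  refine (IsUltrametricDist.norm_add_le_max _ _).trans ?_
  rw [norm_galConj, max_self]

theorem exists_norm_trace_eq_one (hinert : ∀ x : F, x ≠ 0 → ∃ k : ℤ, ‖x‖ = (p : ℝ) ^ k)
    [IsUltrametricDist F] : ∃ z : F, ‖z‖ ≤ 1 ∧ ‖Algebra.trace ℚ_[p] F z‖ = 1 := by
  rcases eq_or_ne p 2 with hp | hp
  · obtain ⟨θ, hθ⟩ := exists_orthogonal p F hinert
    have hθ1 : ‖θ‖ = 1 := by simpa using hθ 0 1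
    refine ⟨θ, hθ1.le, ?_⟩
    by_contra hne
    have hlt : ‖Algebra.trace ℚ_[p] F θ‖ < 1 :=
      lt_of_le_of_ne ((norm_trace_le p F θ).trans hθ1.le) hne
    set n := Algebra.norm ℚ_[p] θ with hn
    have hn1 : ‖n‖ = 1 := by rw [hn, norm_algebraNorm, hθ1]; norm_num
    have h2 : ‖(2 : ℚ_[p])‖ < 1 := by
      have := Padic.norm_p_lt_one (p := p)
      have hpc : ((p : ℕ) : ℚ_[p]) = ((2 : ℕ) : ℚ_[p]) := congrArg _ hp
      rw [show ((p : ℕ) : ℚ_[p]) = 2 by rw [hpc]; norm_num] at this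
      exact this
    have hn2 : ‖n ^ 2 - n‖ < 1 := by
      obtain ⟨i, ⟨hi, hi'⟩, -⟩ := existsUnique_digit p n hn1.le
      have hi1 : i = 1 := by
        rw [Finset.mem_range] at hi
        rcases (show i = 0 ∨ i = 1 by omega) with rfl | rfl
        · simp [hn1] at hi'
        · rfl
      subst hi1
      have : n ^ 2 - n = n * (n - (1 : ℕ)) := by push_cast; ring
      rw [this, norm_mul, hn1, one_mul]
      exact hi'
    have e : (algebraMap ℚ_[p] F n + θ) ^ 2
        = algebraMap ℚ_[p] F (n ^ 2 - n) + algebraMap ℚ_[p] F 2 * (algebraMap ℚ_[p] F n * θ)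
          + algebraMap ℚ_[p] F (Algebra.trace ℚ_[p] F θ) * θ := by
      rw [trace_eq, map_sub, map_pow, map_ofNat, hn, norm_eq]
      ring
    have h3 : ‖algebraMap ℚ_[p] F n + θ‖ = 1 := by
      have := hθ n 1
      rwa [map_one, one_mul, hn1, norm_one, max_self] at this
    have h4 : ‖(algebraMap ℚ_[p] F n + θ) ^ 2‖ < 1 := by
      rw [e]
      refine (IsUltrametricDist.norm_add_le_max _ _).trans_lt (max_lt
        ((IsUltrametricDist.norm_add_le_max _ _).trans_lt (max_lt ?_ ?_)) ?_)
      · rwa [norm_algebraMap']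
      · rw [norm_mul, norm_mul, norm_algebraMap', norm_algebraMap', hn1, hθ1]
        simpa using h2
      · rwa [norm_mul, norm_algebraMap', hθ1, mul_one]
    rw [norm_pow, h3] at h4
    norm_num at h4
  · refine ⟨1, by simp, ?_⟩
    rw [← norm_algebraMap' F, trace_eq, map_one, show (1 : F) + 1 = algebraMap ℚ_[p] F (2 : ℤ) by
      push_cast; rw [map_ofNat]; norm_num, norm_algebraMap']
    refine le_antisymm (Padic.norm_int_le_one _) ?_
    by_contra! h
    rw [Padic.norm_intCast_lt_one_iff] at h
    have h' : p ∣ 2 := by exact_mod_cast h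
    exact hp ((Nat.prime_dvd_prime_iff_eq Fact.out Nat.prime_two).1 h')

end Field

end AsaiZeta

namespace AsaiZeta

section Norms

set_option linter.unusedSectionVars false

variable (p : ℕ) [Fact p.Prime]

theorem exists_root_quadratic (a b c x : ℚ_[p]) (ha : ‖a‖ ≤ 1) (hb : ‖b‖ ≤ 1) (hc : ‖c‖ ≤ 1)
    (hx : ‖x‖ ≤ 1) (h : ‖a * x ^ 2 + b * x + c‖ < 1) (hd : ‖2 * a * x + b‖ = 1) :
    ∃ y : ℚ_[p], a * y ^ 2 + b * y + c = 0 := by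
  let A : ℤ_[p] := ⟨a, ha⟩
  let B : ℤ_[p] := ⟨b, hb⟩
  let C : ℤ_[p] := ⟨c, hc⟩
  let x' : ℤ_[p] := ⟨x, hx⟩
  let f : Polynomial ℤ_[p] := Polynomial.C A * Polynomial.X ^ 2 + Polynomial.C B * Polynomial.X
    + Polynomial.C C
  have hf : ∀ y, f.aeval y = A * y ^ 2 + B * y + C := fun y => by simp [f]
  have hf' : f.derivative.aeval x' = 2 * A * x' + B := by
    simp [f]
    ring
  have e1 : ‖f.aeval x'‖ < 1 := by rw [hf]; exact h
  have e2 : ‖f.derivative.aeval x'‖ = 1 := by rw [hf']; exact hd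
  obtain ⟨y, hy, -⟩ := hensels_lemma (p := p) (F := f) (a := x') (by rw [e2]; simpa using e1)
  rw [hf] at hy
  exact ⟨y, congrArg Subtype.val hy⟩

theorem norm_unit_sub_unit_of_two (hp : p = 2) (u v : ℚ_[p]) (hu : ‖u‖ = 1) (hv : ‖v‖ = 1) :
    ‖u - v‖ < 1 := by
  have key : ∀ u : ℚ_[p], ‖u‖ = 1 → ‖u - (1 : ℕ)‖ < 1 := by
    intro u hu
    obtain ⟨i, ⟨hi, hi'⟩, -⟩ := existsUnique_digit p u hu.le
    rw [Finset.mem_range] at hi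
    rcases (show i = 0 ∨ i = 1 by omega) with rfl | rfl
    · simp [hu] at hi'
    · exact hi'
  rw [show u - v = (u - (1 : ℕ)) - (v - (1 : ℕ)) by ring]
  exact (norm_sub_le_max' _ _).trans_lt (max_lt (key u hu) (key v hv))

variable (F : Type*) [NormedField F] [NormedAlgebra ℚ_[p] F] [Algebra.IsQuadraticExtension ℚ_[p] F]

theorem exists_norm_eq_of_unit [IsUltrametricDist F]
    (hinert : ∀ x : F, x ≠ 0 → ∃ k : ℤ, ‖x‖ = (p : ℝ) ^ k)
    (u : ℚ_[p]) (hu : ‖u‖ = 1) : ∃ z : F, Algebra.norm ℚ_[p] z = u := by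
  have hinj := (algebraMap ℚ_[p] F).injective
  rcases eq_or_ne p 2 with hp | hp
  · obtain ⟨z, hz, ht⟩ := exists_norm_trace_eq_one p F hinert
    have hz1 : ‖z‖ = 1 := le_antisymm hz (ht ▸ norm_trace_le p F z)
    have hn : ‖Algebra.norm ℚ_[p] z‖ = 1 := by rw [norm_algebraNorm, hz1, one_pow]
    have hlt := norm_unit_sub_unit_of_two p hp _ _ hn hu
    obtain ⟨y, hy⟩ := exists_root_quadratic p 1 (Algebra.trace ℚ_[p] F z)
      (Algebra.norm ℚ_[p] z - u) 0 (by simp) ht.le hlt.le (by simp) (by simpa using hlt)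
      (by simpa using ht)
    refine ⟨algebraMap ℚ_[p] F y + z, ?_⟩
    apply hinj
    have := congrArg (algebraMap ℚ_[p] F) hy
    simp only [map_add, map_mul, map_sub, map_pow, map_one, map_zero, trace_eq, norm_eq] at this
    rw [norm_eq, map_add, AlgEquiv.commutes]
    linear_combination this
  · obtain ⟨δ, hδ, hc⟩ := exists_trace_zero_unit p F hinert
    set n := Algebra.norm ℚ_[p] δ with hn
    have hn1 : ‖n‖ = 1 := by rw [hn, norm_algebraNorm, hδ, one_pow]
    have hnF : algebraMap ℚ_[p] F n = -δ ^ 2 := by rw [hn, norm_eq, hc]; ring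
    suffices h : ∃ x y : ℚ_[p], x ^ 2 + n * y ^ 2 = u by
      obtain ⟨x, y, h⟩ := h
      refine ⟨algebraMap ℚ_[p] F x + algebraMap ℚ_[p] F y * δ, hinj ?_⟩
      rw [norm_eq, map_add, map_mul, AlgEquiv.commutes, AlgEquiv.commutes, hc, ← h, map_add,
        map_mul, map_pow, map_pow, hnF]
      ring
    have h2 : ‖(2 : ℚ_[p])‖ = 1 := by
      have h2' : (2 : ℚ_[p]) = ((2 : ℤ) : ℚ_[p]) := by norm_num
      rw [h2']
      refine le_antisymm (Padic.norm_int_le_one _) ?_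
      by_contra! h
      rw [Padic.norm_intCast_lt_one_iff] at h
      have h' : p ∣ 2 := by exact_mod_cast h
      exact hp ((Nat.prime_dvd_prime_iff_eq Fact.out Nat.prime_two).1 h')
    let n' : ℤ_[p] := ⟨n, hn1.le⟩
    let u' : ℤ_[p] := ⟨u, hu.le⟩
    have hn0 : PadicInt.toZMod n' ≠ 0 := by
      intro h
      rw [← RingHom.mem_ker, PadicInt.ker_toZMod, PadicInt.maximalIdeal_eq_span_p,
        Ideal.mem_span_singleton, ← PadicInt.norm_lt_one_iff_dvd] at h
      exact absurd hn1 h.ne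
    obtain ⟨a, b, hab⟩ := FiniteField.exists_root_sum_quadratic (R := ZMod p)
      (f := Polynomial.X ^ 2)
      (g := Polynomial.C (PadicInt.toZMod n') * Polynomial.X ^ 2
        + Polynomial.C 0 * Polynomial.X + Polynomial.C (-PadicInt.toZMod u'))
      (Polynomial.degree_X_pow 2) (Polynomial.degree_quadratic hn0) (by
        rw [ZMod.card]
        exact (Fact.out : p.Prime).eq_two_or_odd.resolve_left hp)
    obtain ⟨x, rfl⟩ := ZMod.ringHom_surjective (PadicInt.toZMod (p := p)) a
    obtain ⟨y, rfl⟩ := ZMod.ringHom_surjective (PadicInt.toZMod (p := p)) b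
    have hker : x ^ 2 + n' * y ^ 2 - u' ∈ RingHom.ker (PadicInt.toZMod (p := p)) := by
      rw [RingHom.mem_ker, map_sub, map_add, map_mul, map_pow, map_pow]
      simp at hab
      linear_combination hab
    rw [PadicInt.ker_toZMod, PadicInt.maximalIdeal_eq_span_p,
        Ideal.mem_span_singleton, ← PadicInt.norm_lt_one_iff_dvd] at hker
    have hlt : ‖(x : ℚ_[p]) ^ 2 + n * (y : ℚ_[p]) ^ 2 - u‖ < 1 := hker
    have hx := x.2
    have hy := y.2
    have hny : ‖n * (y : ℚ_[p]) ^ 2‖ ≤ 1 := by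
      rw [norm_mul, hn1, one_mul, norm_pow]
      exact pow_le_one₀ (norm_nonneg _) hy
    have hxx : ‖(x : ℚ_[p]) ^ 2‖ ≤ 1 := by
      rw [norm_pow]
      exact pow_le_one₀ (norm_nonneg _) hx
    rcases hx.eq_or_lt with hx1 | hx1
    · obtain ⟨z, hz⟩ := exists_root_quadratic p 1 0 (n * (y : ℚ_[p]) ^ 2 - u) x (by simp) (by simp)
        ((norm_sub_le_max' _ _).trans (max_le hny hu.le)) hx
        (by rw [one_mul, zero_mul, add_zero, ← add_sub_assoc]; exact hlt)
        (by rw [mul_one, add_zero, norm_mul, h2, hx1, one_mul])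
      exact ⟨z, y, by linear_combination hz⟩
    · have hy1 : ‖(y : ℚ_[p])‖ = 1 := by
        refine hy.eq_or_lt.resolve_right fun hy1 => ?_
        have h3 : ‖u‖ < 1 := by
          rw [show u = ((x : ℚ_[p]) ^ 2 + n * (y : ℚ_[p]) ^ 2)
            - ((x : ℚ_[p]) ^ 2 + n * (y : ℚ_[p]) ^ 2 - u) by ring]
          refine (norm_sub_le_max' _ _).trans_lt (max_lt
            ((IsUltrametricDist.norm_add_le_max _ _).trans_lt (max_lt ?_ ?_)) hlt)
          · rw [norm_pow]
            exact pow_lt_one₀ (norm_nonneg _) hx1 two_ne_zero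
          · rw [norm_mul, hn1, one_mul, norm_pow]
            exact pow_lt_one₀ (norm_nonneg _) hy1 two_ne_zero
        exact absurd hu h3.ne
      obtain ⟨z, hz⟩ := exists_root_quadratic p n 0 ((x : ℚ_[p]) ^ 2 - u) y hn1.le (by simp)
        ((norm_sub_le_max' _ _).trans (max_le hxx hu.le)) hy
        (by
          rw [zero_mul, add_zero]
          convert hlt using 2
          ring)
        (by rw [add_zero, norm_mul, norm_mul, h2, hn1, hy1, one_mul, one_mul])
      exact ⟨x, z, by linear_combination hz⟩

theorem tau_of_unit [IsUltrametricDist F]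
    (hinert : ∀ x : F, x ≠ 0 → ∃ k : ℤ, ‖x‖ = (p : ℝ) ^ k)
    (u : ℚ_[p]ˣ) (hu : ‖(u : ℚ_[p])‖ = 1) : tau p F u = 1 :=
  if_pos (exists_norm_eq_of_unit p F hinert u hu)

theorem tau_prime (hinert : ∀ x : F, x ≠ 0 → ∃ k : ℤ, ‖x‖ = (p : ℝ) ^ k)
    (u : ℚ_[p]ˣ) (hu : (u : ℚ_[p]) = p) : tau p F u = -1 := by
  refine if_neg ?_
  rintro ⟨z, hz⟩
  have hp := one_lt_prime p
  have h := norm_algebraNorm p F z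
  rw [hz, hu, Padic.norm_p] at h
  obtain ⟨k, hk⟩ := hinert z (by
    rintro rfl
    simp at h
    have := (Fact.out : p.Prime).ne_zero
    contradiction)
  rw [hk, ← zpow_natCast, ← zpow_mul, ← zpow_neg_one] at h
  have := zpow_right_injective₀ (by linarith) hp.ne' h
  push_cast at this
  omega

end Norms

end AsaiZeta

namespace AsaiZeta

section Character

variable (p : ℕ) [Fact p.Prime]

theorem norm_sub_fracPart_le (x : ℚ_[p]) : ‖x - (fracPart p x : ℚ_[p])‖ ≤ 1 := by
  set n := (-x.valuation).toNat with hn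
  have hp : (0 : ℝ) < p := by have := one_lt_prime p; positivity
  have hp' : (p : ℚ_[p]) ≠ 0 := by exact_mod_cast (Fact.out : p.Prime).ne_zero
  let y : ℤ_[p] := ⟨(p : ℚ_[p]) ^ n * x, norm_p_pow_mul_le p x⟩
  have h := PadicInt.appr_spec n y
  rw [← PadicInt.norm_le_pow_iff_mem_span_pow] at h
  have h' : ‖(p : ℚ_[p]) ^ n * x - (y.appr n : ℚ_[p])‖ ≤ (p : ℝ) ^ (-n : ℤ) := h
  have e : x - (fracPart p x : ℚ_[p])
      = ((p : ℚ_[p]) ^ n)⁻¹ * ((p : ℚ_[p]) ^ n * x - (y.appr n : ℚ_[p])) := by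
    have : fracPart p x = (y.appr n : ℚ) / (p : ℚ) ^ n := rfl
    rw [this]
    push_cast
    field_simp
  rw [e, norm_mul, norm_inv, norm_pow, Padic.norm_p, inv_pow, inv_inv]
  calc (p : ℝ) ^ n * _ ≤ (p : ℝ) ^ n * (p : ℝ) ^ (-n : ℤ) := by gcongr
    _ = 1 := by rw [zpow_neg, zpow_natCast, mul_inv_cancel₀ (by positivity)]

theorem exists_fracPart_eq (x : ℚ_[p]) : ∃ (a : ℤ) (n : ℕ), fracPart p x = a / (p : ℚ) ^ n :=
  ⟨(PadicInt.appr ⟨_, norm_p_pow_mul_le p x⟩ (-x.valuation).toNat : ℕ), (-x.valuation).toNat, by rw [fracPart, Int.cast_natCast]⟩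

theorem exists_int_eq_of_norm_le (a : ℤ) (n : ℕ) (h : ‖((a / (p : ℚ) ^ n : ℚ) : ℚ_[p])‖ ≤ 1) :
    ∃ m : ℤ, (a / (p : ℚ) ^ n : ℚ) = m := by
  have hp : (0 : ℝ) < p := by have := one_lt_prime p; positivity
  have hp' : (p : ℚ) ≠ 0 := by exact_mod_cast (Fact.out : p.Prime).ne_zero
  push_cast at h
  rw [norm_div, norm_pow, Padic.norm_p, div_le_one (by positivity), inv_pow, ← zpow_natCast,
    ← zpow_neg, Padic.norm_int_le_pow_iff_dvd] at h
  obtain ⟨m, rfl⟩ := h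
  refine ⟨m, ?_⟩
  push_cast
  field_simp

theorem psi_eq_of_norm_sub_le (x : ℚ_[p]) (a : ℤ) (n : ℕ)
    (h : ‖x - ((a / (p : ℚ) ^ n : ℚ) : ℚ_[p])‖ ≤ 1) :
    psi p x = Complex.exp (-(2 * Real.pi * Complex.I * ((a / (p : ℚ) ^ n : ℚ) : ℂ))) := by
  have hp' : (p : ℚ) ≠ 0 := by exact_mod_cast (Fact.out : p.Prime).ne_zero
  obtain ⟨b, m, hb⟩ := exists_fracPart_eq p x
  have h1 := norm_sub_fracPart_le p x
  obtain ⟨c, hc⟩ := exists_int_eq_of_norm_le p (b * p ^ n - a * p ^ m) (m + n) (by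
    have e : (((b * p ^ n - a * p ^ m : ℤ) / (p : ℚ) ^ (m + n) : ℚ))
        = fracPart p x - a / (p : ℚ) ^ n := by
      rw [hb]
      push_cast
      rw [pow_add]
      field_simp
    rw [e, Rat.cast_sub]
    rw [show ((fracPart p x : ℚ_[p]) - ((a / (p : ℚ) ^ n : ℚ) : ℚ_[p]))
      = (x - ((a / (p : ℚ) ^ n : ℚ) : ℚ_[p])) - (x - (fracPart p x : ℚ_[p])) by ring]
    exact (norm_sub_le_max' _ _).trans (max_le h h1))
  have e : fracPart p x = a / (p : ℚ) ^ n + c := by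
    rw [← hc, hb]
    push_cast
    field_simp
    ring
  rw [psi, e, Complex.exp_eq_exp_iff_exists_int]
  refine ⟨-c, ?_⟩
  push_cast
  ring

theorem psi_add (x y : ℚ_[p]) : psi p (x + y) = psi p x * psi p y := by
  have hp' : (p : ℚ) ≠ 0 := by exact_mod_cast (Fact.out : p.Prime).ne_zero
  obtain ⟨a, m, ha⟩ := exists_fracPart_eq p x
  obtain ⟨b, n, hb⟩ := exists_fracPart_eq p y
  have e : (((a * p ^ n + b * p ^ m : ℤ) / (p : ℚ) ^ (m + n) : ℚ)) = fracPart p x + fracPart p y := by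
    rw [ha, hb]
    push_cast
    rw [pow_add]
    field_simp
  rw [psi_eq_of_norm_sub_le p (x + y) (a * p ^ n + b * p ^ m) (m + n), e, psi, psi,
    ← Complex.exp_add]
  · push_cast
    ring_nf
  · rw [e]
    push_cast
    rw [show x + y - ((fracPart p x : ℚ_[p]) + fracPart p y)
      = (x - fracPart p x) + (y - fracPart p y) by ring]
    exact (IsUltrametricDist.norm_add_le_max _ _).trans
      (max_le (norm_sub_fracPart_le p x) (norm_sub_fracPart_le p y))

theorem psi_of_norm_le_one (x : ℚ_[p]) (hx : ‖x‖ ≤ 1) : psi p x = 1 := by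
  rw [psi_eq_of_norm_sub_le p x 0 0 (by simpa using hx)]
  simp

theorem psi_inv_prime_ne_one : psi p (p : ℚ_[p])⁻¹ ≠ 1 := by
  have hp := (Fact.out : p.Prime).one_lt
  rw [psi_eq_of_norm_sub_le p _ 1 1 (by simp), Ne, Complex.exp_eq_one_iff]
  rintro ⟨n, hn⟩
  have h1 : (2 * Real.pi * Complex.I : ℂ) ≠ 0 := by
    simp [Real.pi_ne_zero, Complex.I_ne_zero]
  have h2 : (-(1 / (p : ℂ)) : ℂ) = n := by
    apply mul_left_cancel₀ h1
    push_cast at hn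
    linear_combination hn
  have hp0 : (p : ℂ) ≠ 0 := by
    have : p ≠ 0 := by omega
    exact_mod_cast this
  field_simp at h2
  have h3 : (-1 : ℤ) = p * n := by exact_mod_cast h2
  have h4 : (p : ℤ) ∣ 1 := ⟨-n, by linarith⟩
  have := Int.le_of_dvd one_pos h4
  omega

end Character

noncomputable section QuadSpace

set_option linter.unusedSectionVars false

variable (p : ℕ) [Fact p.Prime]
variable (F : Type*) [NormedField F] [NormedAlgebra ℚ_[p] F] [Algebra.IsQuadraticExtension ℚ_[p] F]

theorem mem_quadSpace_iff (x : Matrix (Fin 2) (Fin 2) F) : x ∈ quadSpace p F ↔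
    x 1 1 = galConj p F (x 0 0) ∧ galConj p F (x 0 1) = -x 0 1 ∧ galConj p F (x 1 0) = -x 1 0 := by
  change x.adjugate = x.map (galConj p F) ↔ _
  rw [← Matrix.ext_iff]
  simp only [Fin.forall_fin_two, Matrix.adjugate_fin_two, Matrix.map_apply, Matrix.of_apply,
    Matrix.cons_val', Matrix.cons_val_zero, Matrix.cons_val_one, Matrix.cons_val_fin_one]
  constructor
  · rintro ⟨⟨h1, h2⟩, h3, h4⟩
    exact ⟨h1, h2.symm, h3.symm⟩
  · rintro ⟨h1, h2, h3⟩
    refine ⟨⟨h1, h2.symm⟩, h3.symm, ?_⟩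
    rw [h1, galConj_galConj]

/-- The element of `V` with first row `a, b` and lower left entry `c`. -/
def vec (a b c : F) (hb : galConj p F b = -b) (hc : galConj p F c = -c) : quadSpace p F :=
  ⟨!![a, b; c, galConj p F a], (mem_quadSpace_iff p F _).2 ⟨by simp, by simpa using hb,
    by simpa using hc⟩⟩

theorem bilin_eq (x y : quadSpace p F) : algebraMap ℚ_[p] F (bilin p F x y) =
    x.1 0 0 * galConj p F (y.1 0 0) + galConj p F (x.1 0 0) * y.1 0 0
      - x.1 0 1 * y.1 1 0 - x.1 1 0 * y.1 0 1 := by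
  rw [bilin, map_sub, map_sub, algebraMap_quadForm, algebraMap_quadForm, algebraMap_quadForm,
    Matrix.det_fin_two, Matrix.det_fin_two, Matrix.det_fin_two]
  have hx := ((mem_quadSpace_iff p F x.1).1 x.2).1
  have hy := ((mem_quadSpace_iff p F y.1).1 y.2).1
  simp only [Submodule.coe_add, Matrix.add_apply, hx, hy]
  ring

theorem bilin_add_left (x x' y : quadSpace p F) :
    bilin p F (x + x') y = bilin p F x y + bilin p F x' y := by
  apply (algebraMap ℚ_[p] F).injective
  rw [map_add, bilin_eq, bilin_eq, bilin_eq]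
  simp only [Submodule.coe_add, Matrix.add_apply, map_add]
  ring

theorem bilin_smul_left (r : ℚ_[p]) (x y : quadSpace p F) :
    bilin p F (r • x) y = r * bilin p F x y := by
  apply (algebraMap ℚ_[p] F).injective
  rw [map_mul, bilin_eq, bilin_eq]
  simp only [Submodule.coe_smul, Matrix.smul_apply, Algebra.smul_def]
  simp only [map_mul, AlgEquiv.commutes]
  ring

variable [IsUltrametricDist F]

/-- The lattice of elements of `V` with integral diagonal, upper right entry in `p ^ i O` and lower
left entry in `p ^ j O`. -/
def boxLattice (i j : ℕ) : AddSubgroup (quadSpace p F) where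
  carrier := {x | ‖x.1 0 0‖ ≤ 1 ∧ ‖x.1 0 1‖ ≤ (p : ℝ)⁻¹ ^ i ∧ ‖x.1 1 0‖ ≤ (p : ℝ)⁻¹ ^ j}
  zero_mem' := by
    refine ⟨?_, ?_, ?_⟩ <;> simp
  add_mem' := by
    rintro x y ⟨h1, h2, h3⟩ ⟨k1, k2, k3⟩
    exact ⟨(IsUltrametricDist.norm_add_le_max _ _).trans (max_le h1 k1),
      (IsUltrametricDist.norm_add_le_max _ _).trans (max_le h2 k2),
      (IsUltrametricDist.norm_add_le_max _ _).trans (max_le h3 k3)⟩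
  neg_mem' := by
    rintro x ⟨h1, h2, h3⟩
    exact ⟨by simpa using h1, by simpa using h2, by simpa using h3⟩

theorem mem_boxLattice {i j : ℕ} {x : quadSpace p F} : x ∈ boxLattice p F i j ↔
    ‖x.1 0 0‖ ≤ 1 ∧ ‖x.1 0 1‖ ≤ (p : ℝ)⁻¹ ^ i ∧ ‖x.1 1 0‖ ≤ (p : ℝ)⁻¹ ^ j := Iff.rfl

theorem norm_prime_pow (n : ℕ) : ‖(p : F) ^ n‖ = (p : ℝ)⁻¹ ^ n := by
  rw [norm_pow, norm_prime]

theorem inv_prime_pow_le_one (n : ℕ) : (p : ℝ)⁻¹ ^ n ≤ 1 :=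
  pow_le_one₀ (by positivity) (inv_le_one_of_one_le₀ (one_lt_prime p).le)

theorem mem_lattice_iff {n : ℕ} {x : quadSpace p F} : x ∈ lattice p F n ↔ x ∈ boxLattice p F 0 n := by
  change ((∀ i j, ‖x.1 i j‖ ≤ 1) ∧ ‖x.1 1 0‖ ≤ ‖((p : F) ^ n)‖) ↔ _
  rw [norm_prime_pow, mem_boxLattice]
  simp only [Fin.forall_fin_two, pow_zero]
  have hx := ((mem_quadSpace_iff p F x.1).1 x.2).1
  rw [hx, norm_galConj]
  have := inv_prime_pow_le_one p n
  constructor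
  · rintro ⟨⟨⟨h1, h2⟩, h3, h4⟩, h5⟩
    exact ⟨h1, h2, h5⟩
  · rintro ⟨h1, h2, h3⟩
    exact ⟨⟨⟨h1, h2⟩, h3.trans this, h1⟩, h3⟩

theorem norm_bilin_le {x y : quadSpace p F} (hx : x ∈ boxLattice p F 0 0)
    (hy : y ∈ boxLattice p F 0 0) : ‖bilin p F x y‖ ≤ 1 := by
  rw [mem_boxLattice, pow_zero] at hx hy
  obtain ⟨h1, h2, h3⟩ := hx
  obtain ⟨k1, k2, k3⟩ := hy
  rw [← norm_algebraMap' F, bilin_eq]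
  refine (norm_sub_le_max' _ _).trans (max_le ((norm_sub_le_max' _ _).trans (max_le
    ((IsUltrametricDist.norm_add_le_max _ _).trans (max_le ?_ ?_)) ?_)) ?_) <;> rw [norm_mul]
  · rw [norm_galConj]; exact mul_le_one₀ h1 (norm_nonneg _) k1
  · rw [norm_galConj]; exact mul_le_one₀ h1 (norm_nonneg _) k1
  · exact mul_le_one₀ h2 (norm_nonneg _) k3
  · exact mul_le_one₀ h3 (norm_nonneg _) k2

theorem exists_one_lt_norm_bilin (hinert : ∀ x : F, x ≠ 0 → ∃ k : ℤ, ‖x‖ = (p : ℝ) ^ k)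
    (y : quadSpace p F) (hy : y ∉ boxLattice p F 0 0) :
    ∃ x ∈ boxLattice p F 0 0, 1 < ‖bilin p F x y‖ := by
  simp only [mem_boxLattice, pow_zero, not_and_or, not_le] at hy
  obtain ⟨δ, hδ, hc⟩ := exists_trace_zero_unit p F hinert
  obtain ⟨z, hz, ht⟩ := exists_norm_trace_eq_one p F hinert
  rcases hy with hy | hy | hy
  · have h0 : y.1 0 0 ≠ 0 := by
      intro h
      rw [h] at hy
      simp at hy
      linarith
    obtain ⟨r, hr, hr1⟩ := exists_norm_one_smul p F hinert _ h0
    have hr0 : algebraMap ℚ_[p] F r ≠ 0 := by simpa using hr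
    have h0' : galConj p F (y.1 0 0) ≠ 0 := by simpa using h0
    refine ⟨vec p F (z / (algebraMap ℚ_[p] F r * galConj p F (y.1 0 0))) 0 0 (by simp) (by simp),
      ?_, ?_⟩
    · rw [mem_boxLattice]
      simp only [vec, Matrix.of_apply, Matrix.cons_val', Matrix.cons_val_zero, Matrix.cons_val_one,
        Matrix.cons_val_fin_one, norm_zero, pow_zero, zero_le_one, and_true, norm_div, norm_mul,
        norm_galConj]
      rw [← norm_mul, hr1, div_one]
      exact hz
    · rw [← norm_algebraMap' F, bilin_eq]
      simp only [vec, Matrix.of_apply, Matrix.cons_val', Matrix.cons_val_zero, Matrix.cons_val_one,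
        Matrix.cons_val_fin_one, zero_mul, sub_zero, map_div₀, map_mul, galConj_galConj,
        AlgEquiv.commutes]
      have e : z / (algebraMap ℚ_[p] F r * galConj p F (y.1 0 0)) * galConj p F (y.1 0 0)
          + galConj p F z / (algebraMap ℚ_[p] F r * y.1 0 0) * y.1 0 0
          = algebraMap ℚ_[p] F (Algebra.trace ℚ_[p] F z) / algebraMap ℚ_[p] F r := by
        rw [trace_eq]
        field_simp
      rw [e, norm_div, norm_algebraMap', ht, norm_algebraMap']
      rw [norm_mul, norm_algebraMap'] at hr1
      have hr' : 0 < ‖r‖ := norm_pos_iff.2 hr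
      rw [lt_div_iff₀ hr', one_mul]
      by_contra! hge
      have := mul_lt_mul_of_pos_left hy hr'
      linarith
  · refine ⟨vec p F 0 0 δ (by simp) hc, ?_, ?_⟩
    · rw [mem_boxLattice]
      simp [vec, hδ]
    · rw [← norm_algebraMap' F, bilin_eq]
      simpa [vec, hδ] using hy
  · refine ⟨vec p F 0 δ 0 hc (by simp), ?_, ?_⟩
    · rw [mem_boxLattice]
      simp [vec, hδ]
    · rw [← norm_algebraMap' F, bilin_eq]
      simpa [vec, hδ] using hy

theorem exists_psi_bilin_ne_one (hinert : ∀ x : F, x ≠ 0 → ∃ k : ℤ, ‖x‖ = (p : ℝ) ^ k)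
    (y : quadSpace p F) (hy : y ∉ boxLattice p F 0 0) :
    ∃ x ∈ boxLattice p F 0 0, psi p (bilin p F x y) ≠ 1 := by
  obtain ⟨x, hx, h⟩ := exists_one_lt_norm_bilin p F hinert y hy
  have h0 : bilin p F x y ≠ 0 := by
    intro h0
    rw [h0, norm_zero] at h
    linarith
  have hp := one_lt_prime p
  have hr : ‖(p : ℚ_[p])⁻¹ / bilin p F x y‖ ≤ 1 := by
    rw [norm_div, norm_inv, Padic.norm_p, inv_inv, div_le_one (by linarith)]
    by_contra! hlt
    have h1 := (Padic.norm_le_pow_iff_norm_lt_pow_add_one (bilin p F x y) 0).2 (by simpa using hlt)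
    rw [zpow_zero] at h1
    linarith
  refine ⟨((p : ℚ_[p])⁻¹ / bilin p F x y) • x, ?_, ?_⟩
  · rw [mem_boxLattice] at hx ⊢
    simp only [Submodule.coe_smul, Matrix.smul_apply, norm_smul]
    exact ⟨mul_le_one₀ hr (norm_nonneg _) hx.1,
      (mul_le_of_le_one_left (norm_nonneg _) hr).trans hx.2.1,
      (mul_le_of_le_one_left (norm_nonneg _) hr).trans hx.2.2⟩
  · rw [bilin_smul_left, div_mul_cancel₀ _ h0]
    exact psi_inv_prime_ne_one p

end QuadSpace

end AsaiZeta

namespace AsaiZeta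

section Translates

/-- A set that is the disjoint union of finitely many left translates of `A`. -/
@[to_additive]
theorem measure_eq_card_mul {G ι : Type*} [Group G] [MeasurableSpace G] [MeasurableMul G]
    (μ : Measure G) [μ.IsMulLeftInvariant] (s : Finset ι) (g : ι → G) {A B : Set G}
    (hA : MeasurableSet A) (h : ∀ x ∈ B, ∃! i, i ∈ s ∧ (g i)⁻¹ * x ∈ A)
    (h' : ∀ i ∈ s, ∀ x, (g i)⁻¹ * x ∈ A → x ∈ B) : μ B = s.card * μ A := by
  have hB : B = ⋃ i ∈ s, (fun x => (g i)⁻¹ * x) ⁻¹' A := by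
    ext x
    simp only [Set.mem_iUnion, Set.mem_preimage, exists_prop]
    exact ⟨fun hx => (h x hx).exists, fun ⟨i, hi, hx⟩ => h' i hi x hx⟩
  rw [hB, measure_biUnion_finset]
  · simp only [measure_preimage_mul, Finset.sum_const, nsmul_eq_mul]
  · intro i hi j hj hij
    rw [Function.onFun, Set.disjoint_left]
    intro x hx hx'
    exact hij ((h x (h' i hi x hx)).unique ⟨hi, hx⟩ ⟨hj, hx'⟩)
  · intro i _
    exact measurable_const_mul _ hA

end Translates

noncomputable section Lattices

set_option linter.unusedSectionVars false

variable (p : ℕ) [Fact p.Prime]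
variable (F : Type*) [NormedField F] [NormedAlgebra ℚ_[p] F] [Algebra.IsQuadraticExtension ℚ_[p] F]

theorem continuous_entry (i j : Fin 2) : Continuous fun x : quadSpace p F => x.1 i j :=
  continuous_subtype_val.matrix_elem i j

theorem isClosed_quadSpace : IsClosed (quadSpace p F : Set (Matrix (Fin 2) (Fin 2) F)) := by
  have h : (quadSpace p F : Set (Matrix (Fin 2) (Fin 2) F))
      = {x | x.adjugate = x.map (galConj p F)} := rfl
  rw [h]
  refine isClosed_eq ?_ (continuous_id.matrix_map (continuous_galConj p F))
  exact continuous_id.matrix_adjugate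

instance : LocallyCompactSpace (quadSpace p F) := by
  have := properSpace p F
  have : LocallyCompactSpace (Matrix (Fin 2) (Fin 2) F) :=
    inferInstanceAs (LocallyCompactSpace (Fin 2 → Fin 2 → F))
  exact (isClosed_quadSpace p F).isClosedEmbedding_subtypeVal.locallyCompactSpace

instance : SecondCountableTopology (quadSpace p F) := by
  have := properSpace p F
  have : SecondCountableTopology (Matrix (Fin 2) (Fin 2) F) :=
    inferInstanceAs (SecondCountableTopology (Fin 2 → Fin 2 → F))
  exact Topology.IsEmbedding.subtypeVal.secondCountableTopology

variable [IsUltrametricDist F]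

theorem isOpen_boxLattice (i j : ℕ) : IsOpen (boxLattice p F i j : Set (quadSpace p F)) := by
  have hp := one_lt_prime p
  have key : ∀ (k l : Fin 2) (r : ℝ), 0 < r → IsOpen {x : quadSpace p F | ‖x.1 k l‖ ≤ r} := by
    intro k l r hr
    have := (IsUltrametricDist.isOpen_closedBall (0 : F) hr.ne').preimage (continuous_entry p F k l)
    simpa [Set.preimage, Metric.mem_closedBall] using this
  exact (key 0 0 1 one_pos).inter ((key 0 1 _ (by positivity)).inter (key 1 0 _ (by positivity)))

theorem isCompact_boxLattice (i j : ℕ) : IsCompact (boxLattice p F i j : Set (quadSpace p F)) := by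
  have := properSpace p F
  have h : IsCompact (Set.pi Set.univ fun _ : Fin 2 => Set.pi Set.univ
      fun _ : Fin 2 => Metric.closedBall (0 : F) 1) :=
    isCompact_univ_pi fun _ => isCompact_univ_pi fun _ => isCompact_closedBall _ _
  have h' : IsCompact ((Subtype.val : quadSpace p F → Matrix (Fin 2) (Fin 2) F) ⁻¹'
      (Set.pi Set.univ fun _ : Fin 2 => Set.pi Set.univ
      fun _ : Fin 2 => Metric.closedBall (0 : F) 1)) :=
    (isClosed_quadSpace p F).isClosedEmbedding_subtypeVal.isCompact_preimage h
  refine h'.of_isClosed_subset ((boxLattice p F i j).isClosed_of_isOpen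
    (isOpen_boxLattice p F i j)) ?_
  rintro x ⟨h1, h2, h3⟩
  have hx := ((mem_quadSpace_iff p F x.1).1 x.2).1
  have h4 : ‖x.1 1 1‖ ≤ 1 := by rwa [hx, norm_galConj]
  have key : ∀ k l, ‖x.1 k l‖ ≤ 1 := Fin.forall_fin_two.2
    ⟨Fin.forall_fin_two.2 ⟨h1, h2.trans (inv_prime_pow_le_one p i)⟩,
      Fin.forall_fin_two.2 ⟨h3.trans (inv_prime_pow_le_one p j), h4⟩⟩
  exact fun k _ l _ => mem_closedBall_zero_iff.2 (key k l)

/-- The product of two copies of `boxLattice`, in `X = V ⊕ V`. -/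
def boxSq (i j : ℕ) : AddSubgroup (X p F) := (boxLattice p F i j).prod (boxLattice p F i j)

theorem mem_boxSq {i j : ℕ} {x : X p F} :
    x ∈ boxSq p F i j ↔ x.1 ∈ boxLattice p F i j ∧ x.2 ∈ boxLattice p F i j := Iff.rfl

theorem isOpen_boxSq (i j : ℕ) : IsOpen (boxSq p F i j : Set (X p F)) :=
  (isOpen_boxLattice p F i j).prod (isOpen_boxLattice p F i j)

theorem isCompact_boxSq (i j : ℕ) : IsCompact (boxSq p F i j : Set (X p F)) :=
  (isCompact_boxLattice p F i j).prod (isCompact_boxLattice p F i j)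

theorem measurableSet_boxSq (i j : ℕ) : MeasurableSet (boxSq p F i j : Set (X p F)) :=
  (isOpen_boxSq p F i j).measurableSet

theorem existsUnique_translate_boxLattice {δ : F} (hδ : ‖δ‖ = 1) (hc : galConj p F δ = -δ)
    (g : ℕ → quadSpace p F) (i j : ℕ)
    (hg : ∀ k, (g k).1 0 0 = 0 ∧ (g k).1 0 1 = k * p ^ i * δ ∧ (g k).1 1 0 = 0)
    (x : quadSpace p F) (hx : x ∈ boxLattice p F i j) :
    ∃! k : ℕ, k ∈ Finset.range p ∧ -g k + x ∈ boxLattice p F (i + 1) j := by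
  obtain ⟨h1, h2, h3⟩ := hx
  have hp := one_lt_prime p
  obtain ⟨r, hr⟩ := exists_algebraMap_mul_of_galConj_eq_neg p F hδ hc (x.1 0 1)
    ((mem_quadSpace_iff p F x.1).1 x.2).2.1
  have hp0 := prime_ne_zero p F
  have hr1 : ‖r * (p : ℚ_[p]) ^ (-i : ℤ)‖ ≤ 1 := by
    rw [norm_mul, norm_zpow, Padic.norm_p, ← norm_algebraMap' F]
    rw [hr, norm_mul, hδ, mul_one] at h2
    rw [zpow_neg, zpow_natCast, ← div_eq_mul_inv, div_le_one (by positivity)]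
    exact h2
  have hp1 : (p : ℚ_[p]) ≠ 0 := by exact_mod_cast (Fact.out : p.Prime).ne_zero
  have key : ∀ k : ℕ, -g k + x ∈ boxLattice p F (i + 1) j ↔ ‖r * (p : ℚ_[p]) ^ (-i : ℤ) - (k : ℚ_[p])‖ < 1 := by
    intro k
    obtain ⟨g1, g2, g3⟩ := hg k
    have e : -(g k).1 0 1 + x.1 0 1
        = algebraMap ℚ_[p] F (r * (p : ℚ_[p]) ^ (-i : ℤ) - (k : ℚ_[p])) * (p ^ i * δ) := by
      rw [g2, hr, map_sub, map_mul, map_zpow₀, map_natCast, map_natCast]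
      rw [zpow_neg, zpow_natCast]
      field_simp
      ring
    rw [mem_boxLattice]
    simp only [Submodule.coe_add, Submodule.coe_neg, Matrix.add_apply, Matrix.neg_apply, e, g1, g3,
      neg_zero, zero_add, h1, h3, true_and, and_true]
    rw [norm_mul, norm_mul, hδ, mul_one, norm_algebraMap', norm_prime_pow, pow_succ']
    rw [mul_le_mul_iff_left₀ (by positivity)]
    have := Padic.norm_le_pow_iff_norm_lt_pow_add_one (r * (p : ℚ_[p]) ^ (-i : ℤ) - (k : ℚ_[p])) (-1)
    simpa using this
  simp only [key]
  exact existsUnique_digit p _ hr1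

theorem measure_boxSq_succ (hinert : ∀ x : F, x ≠ 0 → ∃ k : ℤ, ‖x‖ = (p : ℝ) ^ k)
    (dx : Measure (X p F)) [dx.IsAddHaarMeasure] (i j : ℕ) :
    dx (boxSq p F i j) = p ^ 2 * dx (boxSq p F (i + 1) j) := by
  have hp := one_lt_prime p
  obtain ⟨δ, hδ, hc⟩ := exists_trace_zero_unit p F hinert
  let g : ℕ → quadSpace p F := fun k => vec p F 0 (k * p ^ i * δ) 0 (by simp [hc]) (by simp)
  have hg : ∀ k, (g k).1 0 0 = 0 ∧ (g k).1 0 1 = k * p ^ i * δ ∧ (g k).1 1 0 = 0 :=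
    fun k => by simp [g, vec]
  have hgm : ∀ k, g k ∈ boxLattice p F i j := by
    intro k
    rw [mem_boxLattice, (hg k).1, (hg k).2.1, (hg k).2.2]
    refine ⟨by simp, ?_, by simp⟩
    rw [norm_mul, norm_mul, hδ, mul_one, norm_prime_pow]
    refine mul_le_of_le_one_left (by positivity) ?_
    have := norm_algebraMap' F (k : ℚ_[p])
    rw [map_natCast] at this
    rw [this]
    simpa using Padic.norm_int_le_one (p := p) k
  have hle : boxLattice p F (i + 1) j ≤ boxLattice p F i j := by
    rintro x ⟨h1, h2, h3⟩
    refine ⟨h1, h2.trans ?_, h3⟩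
    exact pow_le_pow_of_le_one (by positivity) (inv_le_one_of_one_le₀ hp.le) (Nat.le_succ i)
  have := measure_eq_card_add dx (Finset.range p ×ˢ Finset.range p)
    (fun kl => ((g kl.1, g kl.2) : X p F)) (A := boxSq p F (i + 1) j) (B := boxSq p F i j)
    (measurableSet_boxSq p F (i + 1) j) ?_ ?_
  · rw [this, Finset.card_product, Finset.card_range]
    push_cast
    rw [sq]
  · rintro ⟨x, y⟩ ⟨hx, hy⟩
    obtain ⟨k, ⟨hk, hk'⟩, hk''⟩ := existsUnique_translate_boxLattice p F hδ hc g i j hg x hx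
    obtain ⟨l, ⟨hl, hl'⟩, hl''⟩ := existsUnique_translate_boxLattice p F hδ hc g i j hg y hy
    refine ⟨(k, l), ⟨Finset.mem_product.2 ⟨hk, hl⟩, hk', hl'⟩, ?_⟩
    rintro ⟨k', l'⟩ ⟨hkl, h1, h2⟩
    rw [Finset.mem_product] at hkl
    rw [hk'' k' ⟨hkl.1, h1⟩, hl'' l' ⟨hkl.2, h2⟩]
  · rintro ⟨k, l⟩ - ⟨x, y⟩ ⟨hx, hy⟩
    have h1 : -g k + x ∈ boxLattice p F i j := hle hx
    have h2 : -g l + y ∈ boxLattice p F i j := hle hy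
    exact ⟨(AddSubgroup.add_mem_cancel_left _ (neg_mem (hgm k))).1 h1,
      (AddSubgroup.add_mem_cancel_left _ (neg_mem (hgm l))).1 h2⟩

theorem bilin_zero_left (y : quadSpace p F) : bilin p F 0 y = 0 := by
  have := bilin_smul_left p F 0 0 y
  simpa using this

theorem fourier_indicator_boxSq (hinert : ∀ x : F, x ≠ 0 → ∃ k : ℤ, ‖x‖ = (p : ℝ) ^ k)
    (dx : Measure (X p F)) [dx.IsAddHaarMeasure] (y : X p F) :
    fourier p F dx ((boxSq p F 0 0 : Set (X p F)).indicator fun _ => 1) y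
      = dx.real (boxSq p F 0 0) * (boxSq p F 0 0 : Set (X p F)).indicator (fun _ => (1 : ℂ)) y := by
  set φ : X p F → ℂ := (boxSq p F 0 0 : Set (X p F)).indicator fun _ => 1 with hφ
  by_cases hy : y ∈ (boxSq p F 0 0 : Set (X p F))
  · have h1 : ∀ x, φ x * psi p (bilin p F x.1 y.1 + bilin p F x.2 y.2) = φ x := by
      intro x
      by_cases hx : x ∈ (boxSq p F 0 0 : Set (X p F))
      · rw [psi_of_norm_le_one, mul_one]
        exact (IsUltrametricDist.norm_add_le_max _ _).trans (max_le
          (norm_bilin_le p F hx.1 hy.1) (norm_bilin_le p F hx.2 hy.2))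
      · rw [hφ, Set.indicator_of_notMem hx, zero_mul]
    have h2 : φ y = 1 := Set.indicator_of_mem hy _
    rw [fourier, h2, mul_one]
    simp only [h1]
    rw [hφ, integral_indicator (measurableSet_boxSq p F 0 0)]
    simp
  · have h2 : φ y = 0 := Set.indicator_of_notMem hy _
    rw [h2, mul_zero]
    obtain ⟨t, ht, hne⟩ : ∃ t ∈ boxSq p F 0 0,
        psi p (bilin p F t.1 y.1 + bilin p F t.2 y.2) ≠ 1 := by
      change ¬ (y.1 ∈ boxLattice p F 0 0 ∧ y.2 ∈ boxLattice p F 0 0) at hy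
      rw [not_and_or] at hy
      rcases hy with hy | hy
      · obtain ⟨x, hx, h⟩ := exists_psi_bilin_ne_one p F hinert y.1 hy
        exact ⟨(x, 0), ⟨hx, zero_mem _⟩, by rwa [bilin_zero_left, add_zero]⟩
      · obtain ⟨x, hx, h⟩ := exists_psi_bilin_ne_one p F hinert y.2 hy
        exact ⟨(0, x), ⟨zero_mem _, hx⟩, by rwa [bilin_zero_left, zero_add]⟩
    set I := fourier p F dx φ y with hI
    have h3 : I = psi p (bilin p F t.1 y.1 + bilin p F t.2 y.2) * I := by
      conv_lhs => rw [hI, fourier, ← integral_add_left_eq_self _ t]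
      rw [hI, fourier, ← integral_const_mul]
      congr 1
      ext x
      have h4 : φ (t + x) = φ x := by
        have : t + x ∈ (boxSq p F 0 0 : Set (X p F)) ↔ x ∈ (boxSq p F 0 0 : Set (X p F)) :=
          AddSubgroup.add_mem_cancel_left _ ht
        by_cases hx : x ∈ (boxSq p F 0 0 : Set (X p F))
        · rw [hφ, Set.indicator_of_mem hx, Set.indicator_of_mem (this.2 hx)]
        · rw [hφ, Set.indicator_of_notMem hx, Set.indicator_of_notMem (mt this.1 hx)]
      rw [h4, Prod.fst_add, Prod.snd_add, bilin_add_left, bilin_add_left,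
        add_add_add_comm, psi_add]
      ring
    have h4 : (1 - psi p (bilin p F t.1 y.1 + bilin p F t.2 y.2)) * I = 0 := by
      linear_combination h3
    exact (mul_eq_zero.1 h4).resolve_left (sub_ne_zero.2 hne.symm)

theorem measure_boxSq_zero (hinert : ∀ x : F, x ≠ 0 → ∃ k : ℤ, ‖x‖ = (p : ℝ) ^ k)
    (dx : Measure (X p F)) [dx.IsAddHaarMeasure] (hdx : IsSelfDual p F dx) :
    dx.real (boxSq p F 0 0) = 1 := by
  have hclopen : IsClopen (boxSq p F 0 0 : Set (X p F)) :=
    ⟨(boxSq p F 0 0).isClosed_of_isOpen (isOpen_boxSq p F 0 0), isOpen_boxSq p F 0 0⟩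
  set φ : X p F → ℂ := (boxSq p F 0 0 : Set (X p F)).indicator fun _ => 1 with hφ
  have h1 : IsLocallyConstant φ :=
    ((LocallyConstant.const _ (1 : ℂ)).indicator hclopen).isLocallyConstant
  have h2 : HasCompactSupport φ :=
    HasCompactSupport.intro (isCompact_boxSq p F 0 0) fun x hx => Set.indicator_of_notMem hx _
  have h3 := hdx φ h1 h2 0
  have h4 : fourier p F dx φ = fun y => dx.real (boxSq p F 0 0) * φ y :=
    funext (fourier_indicator_boxSq p F hinert dx)
  have h5 : fourier p F dx (fourier p F dx φ) 0
      = dx.real (boxSq p F 0 0) * fourier p F dx φ 0 := by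
    conv_lhs => rw [h4]
    rw [fourier, fourier, ← integral_const_mul]
    congr 1
    ext x
    ring
  have h0 : φ 0 = 1 := Set.indicator_of_mem (zero_mem (boxSq p F 0 0)) _
  rw [h5, fourier_indicator_boxSq p F hinert, ← hφ, neg_zero, h0, mul_one] at h3
  have h6 : dx.real (boxSq p F 0 0) * dx.real (boxSq p F 0 0) = 1 := by exact_mod_cast h3
  nlinarith [measureReal_nonneg (μ := dx) (s := (boxSq p F 0 0 : Set (X p F)))]

theorem measureReal_boxSq (hinert : ∀ x : F, x ≠ 0 → ∃ k : ℤ, ‖x‖ = (p : ℝ) ^ k)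
    (dx : Measure (X p F)) [dx.IsAddHaarMeasure] (i j : ℕ) :
    dx.real (boxSq p F i j) = (p : ℝ)⁻¹ ^ (2 * i) * dx.real (boxSq p F 0 j) := by
  have hp := one_lt_prime p
  induction i with
  | zero => simp
  | succ i ih =>
    have h : dx.real (boxSq p F i j) = p ^ 2 * dx.real (boxSq p F (i + 1) j) := by
      rw [Measure.real, Measure.real, measure_boxSq_succ p F hinert dx i j, ENNReal.toReal_mul]
      simp
    rw [h] at ih
    have hp2 : (p : ℝ) ^ 2 ≠ 0 := by positivity
    apply mul_left_cancel₀ hp2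
    rw [ih, mul_add, pow_add, inv_pow (p : ℝ) (2 * 1)]
    field_simp
    ring

end Lattices

end AsaiZeta

namespace AsaiZeta

noncomputable section Group

set_option linter.unusedSectionVars false

variable (p : ℕ) [Fact p.Prime]

/-- The prime `p` as a unit of `ℚ_p`. -/
def primeUnit : ℚ_[p]ˣ := Units.mk0 (p : ℚ_[p]) (by exact_mod_cast (Fact.out : p.Prime).ne_zero)

variable (F : Type*) [NormedField F] [NormedAlgebra ℚ_[p] F] [Algebra.IsQuadraticExtension ℚ_[p] F]

theorem nu_mk (g : GL (Fin 2) F) (α : ℚ_[p]ˣ) : (nu p F (QuotientGroup.mk (g, α)) : ℚ_[p])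
    = Algebra.norm ℚ_[p] (g.1.det) * ((α : ℚ_[p]) ^ 2)⁻¹ := by
  change ((Units.map (Algebra.norm ℚ_[p]) (Matrix.GeneralLinearGroup.det g)
    * α ^ (-2 : ℤ) : ℚ_[p]ˣ) : ℚ_[p]) = _
  rw [Units.val_mul, zpow_neg, Units.val_inv_eq_inv_val]
  rfl

theorem mk_mem_H10_iff (g : GL (Fin 2) F) (α : ℚ_[p]ˣ) :
    (QuotientGroup.mk (g, α) : H0 p F) ∈ H10 p F ↔
      Algebra.norm ℚ_[p] (g.1.det) = (α : ℚ_[p]) ^ 2 := by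
  rw [H10, MonoidHom.mem_ker, ← Units.val_inj, nu_mk, Units.val_one, ← div_eq_mul_inv,
    div_eq_one_iff_eq (by simp)]

/-- The class of `(g, α)` in `H⁰₁`. -/
def mkH (g : GL (Fin 2) F) (α : ℚ_[p]ˣ) (h : Algebra.norm ℚ_[p] (g.1.det) = (α : ℚ_[p]) ^ 2) :
    H10 p F :=
  ⟨QuotientGroup.mk (g, α), (mk_mem_H10_iff p F g α).2 h⟩

theorem exists_eq_mkH (h : H10 p F) : ∃ g α hg, h = mkH p F g α hg := by
  obtain ⟨h, hh⟩ := h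
  obtain ⟨⟨g, α⟩, rfl⟩ := QuotientGroup.mk_surjective h
  exact ⟨g, α, (mk_mem_H10_iff p F g α).1 hh, rfl⟩

theorem norm_det_mul {g g' : GL (Fin 2) F} {α α' : ℚ_[p]ˣ}
    (h : Algebra.norm ℚ_[p] (g.1.det) = (α : ℚ_[p]) ^ 2)
    (h' : Algebra.norm ℚ_[p] (g'.1.det) = (α' : ℚ_[p]) ^ 2) :
    Algebra.norm ℚ_[p] ((g * g').1.det) = ((α * α' : ℚ_[p]ˣ) : ℚ_[p]) ^ 2 := by
  rw [Units.val_mul, Matrix.det_mul, map_mul, h, h', Units.val_mul, mul_pow]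

theorem mkH_mul (g g' : GL (Fin 2) F) (α α' : ℚ_[p]ˣ) (h h') :
    mkH p F g α h * mkH p F g' α' h' = mkH p F (g * g') (α * α') (norm_det_mul p F h h') := rfl

theorem mkH_eq_iff (g g' : GL (Fin 2) F) (α α' : ℚ_[p]ˣ) (h h') :
    mkH p F g α h = mkH p F g' α' h' ↔ ∃ z : Fˣ,
      g' = g * Matrix.GeneralLinearGroup.scalar (Fin 2) z ∧
        α' = α * Units.map (Algebra.norm ℚ_[p]) z := by
  rw [Subtype.ext_iff]
  change (QuotientGroup.mk (g, α) : H0 p F) = QuotientGroup.mk (g', α') ↔ _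
  rw [QuotientGroup.eq]
  constructor
  · rintro ⟨z, hz⟩
    refine ⟨z, ?_, ?_⟩
    · have := congrArg Prod.fst hz
      change Matrix.GeneralLinearGroup.scalar (Fin 2) z = g⁻¹ * g' at this
      rw [this, mul_inv_cancel_left]
    · have := congrArg Prod.snd hz
      change Units.map (Algebra.norm ℚ_[p]) z = α⁻¹ * α' at this
      rw [this, mul_inv_cancel_left]
  · rintro ⟨z, rfl, rfl⟩
    refine ⟨z, ?_⟩
    change _ = (g⁻¹ * _, α⁻¹ * _)
    rw [inv_mul_cancel_left, inv_mul_cancel_left]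
    rfl

/-- The set of classes of `(g, α)` for which `P g` holds. -/
def cell (P : GL (Fin 2) F → Prop) : Set (H10 p F) := {h | ∃ g α hg, h = mkH p F g α hg ∧ P g}

theorem mkH_mem_cell {P : GL (Fin 2) F → Prop}
    (hP : ∀ g z, P g → P (g * Matrix.GeneralLinearGroup.scalar (Fin 2) z))
    (g : GL (Fin 2) F) (α : ℚ_[p]ˣ) (h) : mkH p F g α h ∈ cell p F P ↔ P g := by
  constructor
  · rintro ⟨g', α', h', e, hg'⟩
    obtain ⟨z, rfl, -⟩ := (mkH_eq_iff p F _ _ _ _ _ _).1 e.symm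
    exact hP g' z hg'
  · intro hg
    exact ⟨g, α, h, rfl, hg⟩

/-! ### Some matrices -/

theorem scalar_apply_eq (z : Fˣ) : (Matrix.GeneralLinearGroup.scalar (Fin 2) z).1
    = !![(z : F), 0; 0, (z : F)] := by
  ext i j
  fin_cases i <;> fin_cases j <;> rfl

/-- The upper triangular unipotent matrix with upper right entry `b`. -/
def upper (b : F) : GL (Fin 2) F :=
  Matrix.GeneralLinearGroup.mkOfDetNeZero !![1, b; 0, 1] (by simp)

/-- The lower triangular unipotent matrix with lower left entry `c`. -/
def lower (c : F) : GL (Fin 2) F :=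
  Matrix.GeneralLinearGroup.mkOfDetNeZero !![1, 0; c, 1] (by simp)

/-- The diagonal matrix with entries `a, d`. -/
def dia (a d : Fˣ) : GL (Fin 2) F :=
  Matrix.GeneralLinearGroup.mkOfDetNeZero !![(a : F), 0; 0, (d : F)] (by simp)

/-- The Weyl element. -/
def swap : GL (Fin 2) F :=
  Matrix.GeneralLinearGroup.mkOfDetNeZero !![0, -1; 1, 0] (by simp)

/-- The matrix with rows `(0, 1)` and `(-ϖ, 0)`. -/
def alMatrix (ϖ : Fˣ) : GL (Fin 2) F :=
  Matrix.GeneralLinearGroup.mkOfDetNeZero !![0, 1; -(ϖ : F), 0] (by simp)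

/-- The prime `p` as a unit of `F`. -/
def primeF : Fˣ := Units.mk0 (p : F) (prime_ne_zero p F)

theorem upper_val (b : F) : (upper F b).1 = !![1, b; 0, 1] := rfl
theorem lower_val (b : F) : (lower F b).1 = !![1, 0; b, 1] := rfl
theorem dia_val (a d : Fˣ) : (dia F a d).1 = !![(a : F), 0; 0, (d : F)] := rfl
theorem swap_val : (swap F).1 = !![0, -1; 1, 0] := rfl
theorem alMatrix_val (ϖ : Fˣ) : (alMatrix F ϖ).1 = !![0, 1; -(ϖ : F), 0] := rfl
theorem primeF_val : ((primeF p F : Fˣ) : F) = p := rfl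
theorem primeUnit_val : ((primeUnit p : ℚ_[p]ˣ) : ℚ_[p]) = p := rfl

theorem norm_natCast_pow (m : ℕ) : Algebra.norm ℚ_[p] ((p : F) ^ m) = ((p : ℚ_[p]) ^ m) ^ 2 := by
  rw [← map_natCast (algebraMap ℚ_[p] F) p, ← map_pow, Algebra.norm_algebraMap,
    Algebra.IsQuadraticExtension.finrank_eq_two]

/-- The class of `(diag(p ^ m, 1), p ^ m)` in `H⁰₁`. -/
def torusH (m : ℕ) : H10 p F := mkH p F (dia F (primeF p F ^ m) 1) (primeUnit p ^ m) (by
  rw [dia_val, Matrix.det_fin_two_of]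
  simpa [primeF_val, primeUnit_val] using norm_natCast_pow p F m)

/-- The class of `(upper b, 1)` in `H⁰₁`. -/
def upperH (b : F) : H10 p F := mkH p F (upper F b) 1 (by simp [upper_val])

/-- The class of the Weyl element in `H⁰₁`. -/
def swapH : H10 p F := mkH p F (swap F) 1 (by simp [swap_val])

/-- The class of the Atkin-Lehner element in `H⁰₁`. -/
def alH : H10 p F := mkH p F (alMatrix F (primeF p F)) (primeUnit p) (by
  rw [alMatrix_val, Matrix.det_fin_two_of]
  simpa [primeF_val, primeUnit_val] using norm_natCast_pow p F 1)

theorem alH_mul_alH : alH p F * alH p F = 1 := by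
  have e : (1 : H10 p F) = mkH p F 1 1 (by simp) := rfl
  rw [e, alH, mkH_mul, eq_comm, mkH_eq_iff]
  refine ⟨-primeF p F, ?_, ?_⟩
  · ext1
    rw [Units.val_mul, Units.val_mul, alMatrix_val, scalar_apply_eq, Units.val_one]
    simp
  · ext1
    have := norm_natCast_pow p F 1
    simp only [pow_one] at this
    have h2 : Algebra.norm ℚ_[p] (-(p : F)) = (p : ℚ_[p]) ^ 2 := by
      rw [← this, ← neg_one_mul, map_mul, ← map_one (algebraMap ℚ_[p] F), ← map_neg,
        Algebra.norm_algebraMap, Algebra.IsQuadraticExtension.finrank_eq_two]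
      simp
    simp [primeUnit_val, primeF_val, h2, sq]

theorem upperH_mul_upperH (b b' : F) : upperH p F b * upperH p F b' = upperH p F (b + b') := by
  rw [upperH, upperH, upperH, mkH_mul]
  congr 1
  · ext1
    rw [Units.val_mul, upper_val, upper_val, upper_val]
    simp [add_comm]
  · rw [mul_one]

theorem torusH_mul_torusH (m n : ℕ) : torusH p F m * torusH p F n = torusH p F (m + n) := by
  rw [torusH, torusH, torusH, mkH_mul]
  congr 1
  · ext1
    rw [Units.val_mul, dia_val, dia_val, dia_val]
    simp [pow_add]
  · rw [pow_add]

theorem torusH_one_mul_upperH (b : F) :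
    torusH p F 1 * upperH p F b = upperH p F (p * b) * torusH p F 1 := by
  rw [torusH, upperH, upperH, mkH_mul, mkH_mul]
  congr 1
  · ext1
    rw [Units.val_mul, Units.val_mul, dia_val, upper_val, upper_val]
    simp [primeF_val]
  · rw [mul_comm]

/-! ### The compact open subgroup -/

variable [IsUltrametricDist F]

theorem norm_le_one_mem_eichler {n : ℕ} {M : Matrix (Fin 2) (Fin 2) F} : M ∈ eichlerOrder p F n ↔
    (∀ i j, ‖M i j‖ ≤ 1) ∧ ‖M 1 0‖ ≤ (p : ℝ)⁻¹ ^ n := by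
  rw [← norm_prime_pow p F n]
  rfl

theorem norm_det_le_one {M : Matrix (Fin 2) (Fin 2) F} (h : ∀ i j, ‖M i j‖ ≤ 1) : ‖M.det‖ ≤ 1 := by
  rw [Matrix.det_fin_two]
  refine (norm_sub_le_max' _ _).trans (max_le ?_ ?_) <;> rw [norm_mul]
  · exact mul_le_one₀ (h _ _) (norm_nonneg _) (h _ _)
  · exact mul_le_one₀ (h _ _) (norm_nonneg _) (h _ _)

theorem mem_K0_iff {n : ℕ} {g : GL (Fin 2) F} : g ∈ K0 p F n ↔
    (∀ i j, ‖g.1 i j‖ ≤ 1) ∧ ‖g.1 1 0‖ ≤ (p : ℝ)⁻¹ ^ n ∧ ‖g.1.det‖ = 1 := by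
  rw [K0, Submonoid.mem_units_iff]
  change g.1 ∈ eichlerOrder p F n ∧ (g⁻¹).1 ∈ eichlerOrder p F n ↔ _
  rw [norm_le_one_mem_eichler, norm_le_one_mem_eichler]
  constructor
  · rintro ⟨⟨h1, h2⟩, h3, h4⟩
    refine ⟨h1, h2, le_antisymm (norm_det_le_one F h1) ?_⟩
    have h5 : ‖g.1.det‖ * ‖(g⁻¹).1.det‖ = 1 := by
      rw [← norm_mul, ← Matrix.det_mul, ← Units.val_mul, mul_inv_cancel, Units.val_one,
        Matrix.det_one, norm_one]
    have h6 := norm_det_le_one F h3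
    nlinarith [norm_nonneg g.1.det, norm_nonneg (g⁻¹).1.det]
  · rintro ⟨h1, h2, h3⟩
    have h5 : (g⁻¹).1 = (g.1.det)⁻¹ • g.1.adjugate := by
      rw [Matrix.coe_units_inv, Matrix.inv_def, Ring.inverse_eq_inv']
    refine ⟨⟨h1, h2⟩, ?_, ?_⟩
    · intro i j
      rw [h5, Matrix.smul_apply, norm_smul, norm_inv, h3, inv_one, one_mul, Matrix.adjugate_fin_two]
      revert i j
      simp [Fin.forall_fin_two, h1]
    · rw [h5, Matrix.smul_apply, norm_smul, norm_inv, h3, inv_one, one_mul, Matrix.adjugate_fin_two]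
      simpa using h2

theorem norm_eq_one_of_mem_K0 {n : ℕ} {g : GL (Fin 2) F} (hg : g ∈ K0 p F n) {α : ℚ_[p]ˣ}
    (h : Algebra.norm ℚ_[p] (g.1.det) = (α : ℚ_[p]) ^ 2) : ‖(α : ℚ_[p])‖ = 1 := by
  have h1 := congrArg norm h
  rw [norm_algebraNorm, (mem_K0_iff p F |>.1 hg).2.2, norm_pow, one_pow] at h1
  exact (pow_eq_one_iff_of_nonneg (norm_nonneg _) two_ne_zero).1 h1.symm

theorem mkH_mem_openCompact {n : ℕ} {g : GL (Fin 2) F} (hg : g ∈ K0 p F n) (α : ℚ_[p]ˣ) (h) :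
    mkH p F g α h ∈ openCompact p F n := by
  rw [openCompact, Subgroup.mem_subgroupOf]
  exact ⟨(g, α), ⟨hg, norm_eq_one_of_mem_K0 p F hg h⟩, rfl⟩

theorem exists_of_mem_openCompact {n : ℕ} {h : H10 p F} (hh : h ∈ openCompact p F n) :
    ∃ g α hg, h = mkH p F g α hg ∧ g ∈ K0 p F n := by
  rw [openCompact, Subgroup.mem_subgroupOf] at hh
  obtain ⟨⟨g, α⟩, ⟨h1, h2⟩, h3⟩ := hh
  have h4 : (QuotientGroup.mk (g, α) : H0 p F) = h.1 := h3
  exact ⟨g, α, (mk_mem_H10_iff p F g α).1 (h4 ▸ h.2), Subtype.ext h4.symm, h1⟩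

theorem isOpen_eichlerOrder (n : ℕ) :
    IsOpen (eichlerOrder p F n : Set (Matrix (Fin 2) (Fin 2) F)) := by
  have hp := one_lt_prime p
  have key : ∀ (k l : Fin 2) (r : ℝ), 0 < r →
      IsOpen {x : Matrix (Fin 2) (Fin 2) F | ‖x k l‖ ≤ r} := by
    intro k l r hr
    have := (IsUltrametricDist.isOpen_closedBall (0 : F) hr.ne').preimage
      (continuous_id.matrix_elem k l)
    simpa [Set.preimage, Metric.mem_closedBall] using this
  have e : (eichlerOrder p F n : Set (Matrix (Fin 2) (Fin 2) F))
      = (⋂ i, ⋂ j, {x | ‖x i j‖ ≤ 1}) ∩ {x | ‖x 1 0‖ ≤ (p : ℝ)⁻¹ ^ n} := by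
    ext x
    rw [SetLike.mem_coe, norm_le_one_mem_eichler]
    simp
  rw [e]
  exact (isOpen_iInter_of_finite fun i => isOpen_iInter_of_finite fun j => key i j 1 one_pos).inter
    (key 1 0 _ (by positivity))

theorem isCompact_eichlerOrder (n : ℕ) :
    IsCompact (eichlerOrder p F n : Set (Matrix (Fin 2) (Fin 2) F)) := by
  have := properSpace p F
  have h : IsCompact (Set.pi Set.univ fun _ : Fin 2 => Set.pi Set.univ
      fun _ : Fin 2 => Metric.closedBall (0 : F) 1) :=
    isCompact_univ_pi fun _ => isCompact_univ_pi fun _ => isCompact_closedBall _ _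
  refine IsCompact.of_isClosed_subset (X := Matrix (Fin 2) (Fin 2) F) h
    ((eichlerOrder p F n).toAddSubgroup.isClosed_of_isOpen (isOpen_eichlerOrder p F n)) ?_
  intro x hx k _ l _
  exact mem_closedBall_zero_iff.2 (((norm_le_one_mem_eichler p F).1 hx).1 k l)

theorem isOpen_K0 (n : ℕ) : IsOpen (K0 p F n : Set (GL (Fin 2) F)) :=
  Submonoid.isOpen_units (isOpen_eichlerOrder p F n)

theorem isCompact_K0 (n : ℕ) : IsCompact (K0 p F n : Set (GL (Fin 2) F)) :=
  Submonoid.units_isCompact (isCompact_eichlerOrder p F n)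

theorem isOpen_unitsZp : IsOpen (unitsZp p : Set ℚ_[p]ˣ) := by
  have := (IsUltrametricDist.isOpen_sphere (0 : ℚ_[p]) one_ne_zero).preimage
    (Units.continuous_val (M := ℚ_[p]))
  simpa [Set.preimage, unitsZp] using this

theorem isCompact_unitsZp : IsCompact (unitsZp p : Set ℚ_[p]ˣ) := by
  let S : Submonoid ℚ_[p] :=
    { carrier := Metric.closedBall 0 1
      one_mem' := by simp
      mul_mem' := by
        intro a b ha hb
        rw [mem_closedBall_zero_iff] at *
        rw [norm_mul]
        exact mul_le_one₀ ha (norm_nonneg _) hb }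
  have hS : IsCompact (S : Set ℚ_[p]) := isCompact_closedBall _ _
  have := Submonoid.units_isCompact hS
  refine this.of_isClosed_subset ((unitsZp p).isClosed_of_isOpen (isOpen_unitsZp p)) ?_
  intro u hu
  have hu1 : ‖(u : ℚ_[p])‖ = 1 := hu
  have h1 : (u : ℚ_[p]) ∈ Metric.closedBall (0 : ℚ_[p]) 1 := by simp [hu1]
  have h2 : ((u⁻¹ : ℚ_[p]ˣ) : ℚ_[p]) ∈ Metric.closedBall (0 : ℚ_[p]) 1 := by simp [hu1]
  exact ⟨h1, h2⟩

theorem isOpen_openCompact (n : ℕ) : IsOpen (openCompact p F n : Set (H10 p F)) := by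
  have h1 : IsOpen ((K0 p F n : Set (GL (Fin 2) F)) ×ˢ (unitsZp p : Set ℚ_[p]ˣ)) :=
    (isOpen_K0 p F n).prod (isOpen_unitsZp p)
  have h2 := QuotientGroup.isOpenMap_coe (N := (embUnits p F).range) _ h1
  exact h2.preimage continuous_subtype_val

theorem isCompact_openCompact (n : ℕ) : IsCompact (openCompact p F n : Set (H10 p F)) := by
  rw [Subtype.isCompact_iff]
  have h1 : IsCompact (((K0 p F n : Set (GL (Fin 2) F)) ×ˢ (unitsZp p : Set ℚ_[p]ˣ)) ∩
      {x | x.1.1.det * galConj p F x.1.1.det = algebraMap ℚ_[p] F ((x.2 : ℚ_[p]) ^ 2)}) := by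
    refine ((isCompact_K0 p F n).prod (isCompact_unitsZp p)).inter_right (isClosed_eq ?_ ?_)
    · have h2 : Continuous fun x : GL (Fin 2) F × ℚ_[p]ˣ => x.1.1.det :=
        (Units.continuous_val.comp continuous_fst).matrix_det
      exact h2.mul ((continuous_galConj p F).comp h2)
    · exact (continuous_algebraMap ℚ_[p] F).comp
        ((Units.continuous_val.comp continuous_snd).pow 2)
  convert h1.image (QuotientGroup.continuous_mk (N := (embUnits p F).range)) using 1
  ext h
  constructor
  · rintro ⟨h, hh, rfl⟩
    obtain ⟨g, α, hg, rfl, hk⟩ := exists_of_mem_openCompact p F hh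
    refine ⟨(g, α), ⟨⟨hk, norm_eq_one_of_mem_K0 p F hk hg⟩, ?_⟩, rfl⟩
    change g.1.det * galConj p F g.1.det = algebraMap ℚ_[p] F ((α : ℚ_[p]) ^ 2)
    rw [← norm_eq, hg]
  · rintro ⟨⟨g, α⟩, ⟨⟨hk, -⟩, hg⟩, rfl⟩
    change g.1.det * galConj p F g.1.det = algebraMap ℚ_[p] F ((α : ℚ_[p]) ^ 2) at hg
    rw [← norm_eq] at hg
    have hg' := (algebraMap ℚ_[p] F).injective hg
    exact ⟨mkH p F g α hg', mkH_mem_openCompact p F hk α hg', rfl⟩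

end Group

end AsaiZeta

namespace AsaiZeta

section Cells

theorem integral_of_countable_partition {X ι : Type*} [MeasurableSpace X] [Countable ι]
    (μ : Measure X) (A : ι → Set X) (hA : ∀ i, MeasurableSet (A i))
    (hd : Pairwise (Function.onFun Disjoint A)) (hU : ⋃ i, A i = Set.univ)
    (hfin : ∀ i, μ (A i) ≠ ⊤) (f : X → ℂ) (v : ι → ℂ) (hv : ∀ i, ∀ x ∈ A i, f x = v i)
    (hs : Summable fun i => μ.real (A i) * ‖v i‖) :
    Integrable f μ ∧ HasSum (fun i => μ.real (A i) * v i) (∫ x, f x ∂μ) := by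
  have h1 : ∀ i, IntegrableOn f (A i) μ := fun i =>
    (integrableOn_const (hfin i)).congr_fun (fun x hx => (hv i x hx).symm) (hA i)
  have h2 : IntegrableOn f (⋃ i, A i) μ := by
    refine integrableOn_iUnion_of_summable_integral_norm h1 ?_
    refine hs.congr fun i => ?_
    rw [setIntegral_congr_fun (g := fun _ => ‖v i‖) (hA i) (fun x hx => by
      simp only [hv i x hx]), setIntegral_const, smul_eq_mul]
  have h3 := hasSum_integral_iUnion hA hd h2
  rw [hU, integrableOn_univ] at h2
  rw [hU, setIntegral_univ] at h3
  refine ⟨h2, h3.congr_fun fun i => ?_⟩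
  rw [setIntegral_congr_fun (g := fun _ => v i) (hA i) (hv i), setIntegral_const]
  simp

end Cells

noncomputable section CellSets

set_option linter.unusedSectionVars false

variable (p : ℕ) [Fact p.Prime]
variable (F : Type*) [NormedField F] [NormedAlgebra ℚ_[p] F] [Algebra.IsQuadraticExtension ℚ_[p] F]
variable [IsUltrametricDist F]

theorem IsDigits.existsUnique_div {D : Finset F} (hD : IsDigits p F D)
    (hinert : ∀ x : F, x ≠ 0 → ∃ k : ℤ, ‖x‖ = (p : ℝ) ^ k) (b d : F) (hd : d ≠ 0)
    (h : ‖b‖ ≤ ‖d‖) : ∃! x, x ∈ D ∧ ‖(b - x * d) / p‖ ≤ ‖d‖ := by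
  have hd' : 0 < ‖d‖ := norm_pos_iff.2 hd
  have hp := one_lt_prime p
  have := hD.existsUnique (b / d) (by rwa [norm_div, div_le_one hd'])
  convert this using 4 with x
  have e : b / d - x = (b - x * d) / d := by field_simp
  rw [e, norm_div _ d, div_lt_one hd', norm_lt_iff p F hinert _ _ hd, norm_div, norm_prime,
    div_inv_eq_mul]

/-- The cell of `h` with `h` in `N(O) diag(p ^ m, 1) K`, `K = GL₂(O)`, modulo centre. -/
def sphCell (m : ℕ) (g : GL (Fin 2) F) : Prop :=
  ‖g.1 0 0‖ ≤ max ‖g.1 1 0‖ ‖g.1 1 1‖ ∧ ‖g.1 0 1‖ ≤ max ‖g.1 1 0‖ ‖g.1 1 1‖ ∧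
    ‖g.1.det‖ = (p : ℝ)⁻¹ ^ m * max ‖g.1 1 0‖ ‖g.1 1 1‖ ^ 2

/-- The cell of `h` with `h` in `N(O) diag(p ^ m, 1) I`, `I` the Iwahori subgroup, modulo centre. -/
def iwaCell (m : ℕ) (g : GL (Fin 2) F) : Prop :=
  ‖g.1 1 0‖ < ‖g.1 1 1‖ ∧ ‖g.1 0 1‖ ≤ ‖g.1 1 1‖ ∧
    ‖g.1.det‖ = (p : ℝ)⁻¹ ^ m * ‖g.1 1 1‖ ^ 2

theorem mul_scalar_apply (g : GL (Fin 2) F) (z : Fˣ) (i j : Fin 2) :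
    (g * Matrix.GeneralLinearGroup.scalar (Fin 2) z).1 i j = g.1 i j * z := by
  rw [Units.val_mul, scalar_apply_eq, Matrix.mul_apply, Fin.sum_univ_two]
  fin_cases j <;> simp

theorem det_mul_scalar (g : GL (Fin 2) F) (z : Fˣ) :
    (g * Matrix.GeneralLinearGroup.scalar (Fin 2) z).1.det = g.1.det * z ^ 2 := by
  rw [Units.val_mul, scalar_apply_eq, Matrix.det_mul, Matrix.det_fin_two_of]
  ring

theorem sphCell_scalar {m : ℕ} (g : GL (Fin 2) F) (z : Fˣ) (h : sphCell p F m g) :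
    sphCell p F m (g * Matrix.GeneralLinearGroup.scalar (Fin 2) z) := by
  obtain ⟨h1, h2, h3⟩ := h
  have hz : 0 < ‖(z : F)‖ := by simp
  rw [sphCell, det_mul_scalar]
  simp only [mul_scalar_apply, norm_mul, norm_pow]
  rw [← max_mul_of_nonneg _ _ hz.le]
  refine ⟨by gcongr, by gcongr, ?_⟩
  rw [h3]
  ring

theorem iwaCell_scalar {m : ℕ} (g : GL (Fin 2) F) (z : Fˣ) (h : iwaCell p F m g) :
    iwaCell p F m (g * Matrix.GeneralLinearGroup.scalar (Fin 2) z) := by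
  obtain ⟨h1, h2, h3⟩ := h
  have hz : 0 < ‖(z : F)‖ := by simp
  rw [iwaCell, det_mul_scalar]
  simp only [mul_scalar_apply, norm_mul, norm_pow]
  refine ⟨by gcongr, by gcongr, ?_⟩
  rw [h3]
  ring

/-- The step of the recursion between cells. -/
def stepGL (b : F) : GL (Fin 2) F := upper F b * dia F (primeF p F ^ 1) 1

/-- The step of the recursion between cells, in `H⁰₁`. -/
def stepH (b : F) : H10 p F := upperH p F b * torusH p F 1

theorem stepH_inv_mul_mkH (b : F) (g : GL (Fin 2) F) (α : ℚ_[p]ˣ) (h) :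
    ∃ α' h', (stepH p F b)⁻¹ * mkH p F g α h = mkH p F ((stepGL p F b)⁻¹ * g) α' h' :=
  ⟨(1 * primeUnit p ^ 1)⁻¹ * α,
    (mk_mem_H10_iff p F _ _).1 ((stepH p F b)⁻¹ * mkH p F g α h).2, rfl⟩

theorem inv_mul_val {g g' : GL (Fin 2) F} {M : Matrix (Fin 2) (Fin 2) F} (h : g.1 * M = g'.1) :
    (g⁻¹ * g').1 = M := by
  rw [Units.val_mul, ← h, ← mul_assoc, ← Units.val_mul, inv_mul_cancel, Units.val_one, one_mul]

theorem stepGL_inv_mul (b : F) (g : GL (Fin 2) F) : ((stepGL p F b)⁻¹ * g).1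
    = !![(g.1 0 0 - b * g.1 1 0) / p, (g.1 0 1 - b * g.1 1 1) / p; g.1 1 0, g.1 1 1] := by
  have := prime_ne_zero p F
  apply inv_mul_val
  rw [stepGL, Units.val_mul, upper_val, dia_val]
  ext i j
  fin_cases i <;> fin_cases j <;> simp [primeF_val] <;> field_simp <;> ring

theorem det_stepGL_inv_mul (b : F) (g : GL (Fin 2) F) :
    ((stepGL p F b)⁻¹ * g).1.det = g.1.det / p := by
  rw [stepGL_inv_mul, Matrix.det_fin_two_of, Matrix.det_fin_two]
  ring

theorem det_ne_zero (g : GL (Fin 2) F) : g.1.det ≠ 0 := g.det_ne_zero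

theorem max_pos (g : GL (Fin 2) F) : 0 < max ‖g.1 1 0‖ ‖g.1 1 1‖ := by
  by_contra! h
  rw [max_le_iff] at h
  have h1 := norm_le_zero_iff.1 h.1
  have h2 := norm_le_zero_iff.1 h.2
  apply det_ne_zero F g
  rw [Matrix.det_fin_two, h1, h2]
  ring

theorem existsUnique_sph_aux {D : Finset F} (hD : IsDigits p F D)
    (hinert : ∀ x : F, x ≠ 0 → ∃ k : ℤ, ‖x‖ = (p : ℝ) ^ k) (a b c d : F) (hd : d ≠ 0)
    (hc : ‖c‖ ≤ ‖d‖) (hb : ‖b‖ ≤ ‖d‖) (hdet : ‖a * d - b * c‖ * p ≤ ‖d‖ ^ 2) :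
    ∃! x, x ∈ D ∧ ‖(a - x * c) / p‖ ≤ ‖d‖ ∧ ‖(b - x * d) / p‖ ≤ ‖d‖ := by
  have hd' : 0 < ‖d‖ := norm_pos_iff.2 hd
  have hp := one_lt_prime p
  convert hD.existsUnique_div p F hinert b d hd hb using 4 with x
  refine ⟨And.right, fun h => ⟨?_, h⟩⟩
  have e : (a - x * c) * d = (a * d - b * c) + c * (b - x * d) := by ring
  rw [norm_div, norm_prime, div_inv_eq_mul] at h ⊢
  have h1 : ‖(a - x * c) * d‖ * p ≤ ‖d‖ ^ 2 := by
    rw [e]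
    refine (mul_le_mul_of_nonneg_right (IsUltrametricDist.norm_add_le_max _ _)
      (by positivity)).trans ?_
    rw [max_mul_of_nonneg _ _ (by positivity)]
    refine max_le hdet ?_
    rw [norm_mul, mul_assoc, sq]
    exact mul_le_mul hc h (by positivity) (by positivity)
  rw [norm_mul, sq] at h1
  exact le_of_mul_le_mul_right (by linarith) hd'

theorem sphCell_step {D : Finset F} (hD : IsDigits p F D)
    (hinert : ∀ x : F, x ≠ 0 → ∃ k : ℤ, ‖x‖ = (p : ℝ) ^ k) {m : ℕ} {g : GL (Fin 2) F}
    (h : sphCell p F (m + 1) g) : ∃! x, x ∈ D ∧ sphCell p F m ((stepGL p F x)⁻¹ * g) := by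
  obtain ⟨h1, h2, h3⟩ := h
  have hr := max_pos F g
  have hp := one_lt_prime p
  have hdet : ‖g.1.det‖ * p ≤ max ‖g.1 1 0‖ ‖g.1 1 1‖ ^ 2 := by
    rw [h3, pow_succ]
    have := inv_prime_pow_le_one p m
    calc _ = (p : ℝ)⁻¹ ^ m * max ‖g.1 1 0‖ ‖g.1 1 1‖ ^ 2 := by field_simp
      _ ≤ _ := mul_le_of_le_one_left (by positivity) this
  have hdet' : ∀ x, ‖((stepGL p F x)⁻¹ * g).1.det‖
      = (p : ℝ)⁻¹ ^ m * max ‖g.1 1 0‖ ‖g.1 1 1‖ ^ 2 := by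
    intro x
    rw [det_stepGL_inv_mul, norm_div, norm_prime, h3, pow_succ]
    field_simp
  simp only [sphCell, hdet']
  simp only [stepGL_inv_mul]
  simp only [Matrix.of_apply, Matrix.cons_val', Matrix.cons_val_zero, Matrix.cons_val_one,
    Matrix.cons_val_fin_one, and_true]
  rw [Matrix.det_fin_two] at hdet
  clear hdet' h3
  rcases le_total ‖g.1 1 0‖ ‖g.1 1 1‖ with hcd | hcd
  · rw [max_eq_right hcd] at *
    exact existsUnique_sph_aux p F hD hinert _ _ _ _ (norm_pos_iff.1 hr) hcd h2 hdet
  · rw [max_eq_left hcd] at *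
    rw [norm_sub_rev] at hdet
    obtain ⟨x, ⟨hx, k1, k2⟩, hu⟩ := existsUnique_sph_aux p F hD hinert (g.1 0 1) (g.1 0 0) (g.1 1 1)
      (g.1 1 0) (norm_pos_iff.1 hr) hcd h1 hdet
    exact ⟨x, ⟨hx, k2, k1⟩, fun y hy => hu y ⟨hy.1, hy.2.2, hy.2.1⟩⟩

theorem sphCell_of_step {D : Finset F} (hD : IsDigits p F D) {m : ℕ} {g : GL (Fin 2) F} {x : F}
    (hx : x ∈ D) (h : sphCell p F m ((stepGL p F x)⁻¹ * g)) : sphCell p F (m + 1) g := by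
  have hp := one_lt_prime p
  have hp0 := prime_ne_zero p F
  obtain ⟨h1, h2, h3⟩ := h
  rw [det_stepGL_inv_mul, norm_div, norm_prime] at h3
  simp only [stepGL_inv_mul] at h1 h2 h3
  simp only [Matrix.of_apply, Matrix.cons_val', Matrix.cons_val_zero, Matrix.cons_val_one,
    Matrix.cons_val_fin_one] at h1 h2 h3
  set r := max ‖g.1 1 0‖ ‖g.1 1 1‖ with hr
  have hr0 : 0 < r := max_pos F g
  have key : ∀ a c : F, ‖(a - x * c) / p‖ ≤ r → ‖c‖ ≤ r → ‖a‖ ≤ r := by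
    intro a c h hc
    rw [norm_div, norm_prime, div_inv_eq_mul] at h
    rw [show a = (a - x * c) + x * c by ring]
    refine (IsUltrametricDist.norm_add_le_max _ _).trans (max_le ?_ ?_)
    · exact (le_mul_of_one_le_right (norm_nonneg _) hp.le).trans h
    · rw [norm_mul]
      exact (mul_le_of_le_one_left (norm_nonneg _) (hD.norm_le x hx)).trans hc
  refine ⟨key _ _ h1 (le_max_left _ _), key _ _ h2 (le_max_right _ _), ?_⟩
  rw [← hr, pow_succ, mul_right_comm, ← h3]
  field_simp

theorem iwaCell_step {D : Finset F} (hD : IsDigits p F D)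
    (hinert : ∀ x : F, x ≠ 0 → ∃ k : ℤ, ‖x‖ = (p : ℝ) ^ k) {m : ℕ} {g : GL (Fin 2) F}
    (h : iwaCell p F (m + 1) g) : ∃! x, x ∈ D ∧ iwaCell p F m ((stepGL p F x)⁻¹ * g) := by
  obtain ⟨h1, h2, h3⟩ := h
  have hp := one_lt_prime p
  have hdet' : ∀ x, ‖((stepGL p F x)⁻¹ * g).1.det‖ = (p : ℝ)⁻¹ ^ m * ‖g.1 1 1‖ ^ 2 := by
    intro x
    rw [det_stepGL_inv_mul, norm_div, norm_prime, h3, pow_succ]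
    field_simp
  simp only [iwaCell, hdet']
  simp only [stepGL_inv_mul]
  simp only [Matrix.of_apply, Matrix.cons_val', Matrix.cons_val_zero, Matrix.cons_val_one,
    Matrix.cons_val_fin_one, h1, true_and, and_true]
  exact hD.existsUnique_div p F hinert _ _
    (norm_pos_iff.1 ((norm_nonneg _).trans_lt h1)) h2

theorem iwaCell_of_step {D : Finset F} (hD : IsDigits p F D) {m : ℕ} {g : GL (Fin 2) F} {x : F}
    (hx : x ∈ D) (h : iwaCell p F m ((stepGL p F x)⁻¹ * g)) : iwaCell p F (m + 1) g := by
  have hp := one_lt_prime p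
  have hp0 := prime_ne_zero p F
  obtain ⟨h1, h2, h3⟩ := h
  rw [det_stepGL_inv_mul, norm_div, norm_prime] at h3
  simp only [stepGL_inv_mul] at h1 h2 h3
  simp only [Matrix.of_apply, Matrix.cons_val', Matrix.cons_val_zero, Matrix.cons_val_one,
    Matrix.cons_val_fin_one] at h1 h2 h3
  refine ⟨h1, ?_, ?_⟩
  · rw [norm_div, norm_prime, div_inv_eq_mul] at h2
    rw [show g.1 0 1 = (g.1 0 1 - x * g.1 1 1) + x * g.1 1 1 by ring]
    refine (IsUltrametricDist.norm_add_le_max _ _).trans (max_le ?_ ?_)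
    · exact (le_mul_of_one_le_right (norm_nonneg _) hp.le).trans h2
    · rw [norm_mul]
      exact mul_le_of_le_one_left (norm_nonneg _) (hD.norm_le x hx)
  · rw [pow_succ, mul_right_comm, ← h3]
    field_simp

/-- A sequence of sets in which each is the disjoint union of the translates of the preceding one
by the steps `stepH b`. -/
structure IsStepSeq (D : Finset F) (A : ℕ → Set (H10 p F)) : Prop where
  existsUnique : ∀ m, ∀ h ∈ A (m + 1), ∃! x, x ∈ D ∧ (stepH p F x)⁻¹ * h ∈ A m
  of_step : ∀ m, ∀ x ∈ D, ∀ h, (stepH p F x)⁻¹ * h ∈ A m → h ∈ A (m + 1)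

theorem isStepSeq_sphCell {D : Finset F} (hD : IsDigits p F D)
    (hinert : ∀ x : F, x ≠ 0 → ∃ k : ℤ, ‖x‖ = (p : ℝ) ^ k) :
    IsStepSeq p F D fun m => cell p F (sphCell p F m) := by
  constructor
  · rintro m h ⟨g, α, hg, rfl, hm⟩
    convert sphCell_step p F hD hinert hm using 4 with x
    obtain ⟨α', h', e⟩ := stepH_inv_mul_mkH p F x g α hg
    rw [e, mkH_mem_cell p F (sphCell_scalar p F)]
  · intro m x hx h hm
    obtain ⟨g, α, hg, rfl⟩ := exists_eq_mkH p F h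
    obtain ⟨α', h', e⟩ := stepH_inv_mul_mkH p F x g α hg
    rw [e, mkH_mem_cell p F (sphCell_scalar p F)] at hm
    exact (mkH_mem_cell p F (sphCell_scalar p F) _ _ _).2 (sphCell_of_step p F hD hx hm)

theorem isStepSeq_iwaCell {D : Finset F} (hD : IsDigits p F D)
    (hinert : ∀ x : F, x ≠ 0 → ∃ k : ℤ, ‖x‖ = (p : ℝ) ^ k) :
    IsStepSeq p F D fun m => cell p F (iwaCell p F m) := by
  constructor
  · rintro m h ⟨g, α, hg, rfl, hm⟩
    convert iwaCell_step p F hD hinert hm using 4 with x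
    obtain ⟨α', h', e⟩ := stepH_inv_mul_mkH p F x g α hg
    rw [e, mkH_mem_cell p F (iwaCell_scalar p F)]
  · intro m x hx h hm
    obtain ⟨g, α, hg, rfl⟩ := exists_eq_mkH p F h
    obtain ⟨α', h', e⟩ := stepH_inv_mul_mkH p F x g α hg
    rw [e, mkH_mem_cell p F (iwaCell_scalar p F)] at hm
    exact (mkH_mem_cell p F (iwaCell_scalar p F) _ _ _).2 (iwaCell_of_step p F hD hx hm)

variable {p F}

theorem IsStepSeq.mul_right {D : Finset F} {A : ℕ → Set (H10 p F)} (hA : IsStepSeq p F D A)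
    (x : H10 p F) : IsStepSeq p F D fun m => {h | h * x ∈ A m} := by
  constructor
  · intro m h hm
    obtain ⟨y, ⟨hy, hy'⟩, hu⟩ := hA.existsUnique m _ hm
    rw [← mul_assoc] at hy'
    refine ⟨y, ⟨hy, hy'⟩, fun z hz => hu z ⟨hz.1, ?_⟩⟩
    rw [← mul_assoc]
    exact hz.2
  · intro m y hy h hm
    refine hA.of_step m y hy _ ?_
    rw [← mul_assoc]
    exact hm

theorem IsStepSeq.isOpen {D : Finset F} {A : ℕ → Set (H10 p F)} (hA : IsStepSeq p F D A)
    (h0 : IsOpen (A 0)) (m : ℕ) : IsOpen (A m) := by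
  induction m with
  | zero => exact h0
  | succ m ih =>
    have e : A (m + 1) = ⋃ x ∈ D, (fun h => (stepH p F x)⁻¹ * h) ⁻¹' A m := by
      ext h
      simp only [Set.mem_iUnion, Set.mem_preimage, exists_prop]
      exact ⟨fun hm => (hA.existsUnique m h hm).exists, fun ⟨x, hx, hm⟩ => hA.of_step m x hx h hm⟩
    rw [e]
    exact isOpen_biUnion fun x _ => ih.preimage (continuous_const_mul _)

theorem IsStepSeq.measure {D : Finset F} (hD : IsDigits p F D) {A : ℕ → Set (H10 p F)}
    (hA : IsStepSeq p F D A) (h0 : IsOpen (A 0)) (μ : Measure (H10 p F)) [μ.IsHaarMeasure] (m : ℕ) :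
    μ (A m) = (p ^ 2) ^ m * μ (A 0) := by
  induction m with
  | zero => simp
  | succ m ih =>
    rw [measure_eq_card_mul μ D (stepH p F) (hA.isOpen h0 m).measurableSet
      (hA.existsUnique m) (hA.of_step m), ih, hD.card, pow_succ' _ m, mul_assoc]
    push_cast
    rfl

theorem IsStepSeq.exists_eq {D : Finset F} (hD : IsDigits p F D) {A : ℕ → Set (H10 p F)}
    (hA : IsStepSeq p F D A) {m : ℕ} {h : H10 p F} (hm : h ∈ A m) :
    ∃ b : F, ‖b‖ ≤ 1 ∧ ∃ h' ∈ A 0, h = upperH p F b * torusH p F m * h' := by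
  induction m generalizing h with
  | zero =>
    refine ⟨0, by simp, h, hm, ?_⟩
    have e1 : upperH p F 0 = 1 := by
      have := upperH_mul_upperH p F 0 0
      rw [add_zero] at this
      exact mul_eq_left.1 this
    have e2 : torusH p F 0 = 1 := by
      have := torusH_mul_torusH p F 0 0
      rw [add_zero] at this
      exact mul_eq_left.1 this
    rw [e1, e2, one_mul, one_mul]
  | succ m ih =>
    obtain ⟨x, hx, hm'⟩ := (hA.existsUnique m h hm).exists
    obtain ⟨b, hb, h', hh', e⟩ := ih hm'
    refine ⟨x + p * b, ?_, h', hh', ?_⟩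
    · refine (IsUltrametricDist.norm_add_le_max _ _).trans (max_le (hD.norm_le x hx) ?_)
      rw [norm_mul, norm_prime]
      exact mul_le_one₀ (inv_le_one_of_one_le₀ (one_lt_prime p).le) (norm_nonneg _) hb
    · rw [inv_mul_eq_iff_eq_mul] at e
      rw [e, stepH, ← upperH_mul_upperH, add_comm m 1, ← torusH_mul_torusH]
      have := torusH_one_mul_upperH p F b
      calc _ = upperH p F x * (torusH p F 1 * upperH p F b) * torusH p F m * h' := by group
        _ = _ := by rw [this]; group

end CellSets

end AsaiZeta

namespace AsaiZeta

noncomputable section Partition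

set_option linter.unusedSectionVars false

variable (p : ℕ) [Fact p.Prime]
variable (F : Type*) [NormedField F] [NormedAlgebra ℚ_[p] F] [Algebra.IsQuadraticExtension ℚ_[p] F]
variable [IsUltrametricDist F]

theorem exists_scale (g : GL (Fin 2) F) (α : ℚ_[p]ˣ) (h) (z : Fˣ) :
    ∃ α' h', mkH p F g α h = mkH p F (g * Matrix.GeneralLinearGroup.scalar (Fin 2) z) α' h' := by
  have h' : Algebra.norm ℚ_[p] ((g * Matrix.GeneralLinearGroup.scalar (Fin 2) z).1.det)
      = ((α * Units.map (Algebra.norm ℚ_[p]) z : ℚ_[p]ˣ) : ℚ_[p]) ^ 2 := by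
    rw [det_mul_scalar, map_mul, h, map_pow, Units.val_mul, mul_pow]
    rfl
  exact ⟨_, h', (mkH_eq_iff p F _ _ _ _ _ _).2 ⟨z, rfl, rfl⟩⟩

theorem norm_det_le (g : GL (Fin 2) F) :
    ‖g.1.det‖ ≤ max (‖g.1 0 0‖ * ‖g.1 1 1‖) (‖g.1 0 1‖ * ‖g.1 1 0‖) := by
  rw [Matrix.det_fin_two, ← norm_mul, ← norm_mul]
  exact norm_sub_le_max' _ _

theorem cell_sphCell_zero : cell p F (sphCell p F 0) = (openCompact p F 0 : Set (H10 p F)) := by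
  ext h
  constructor
  · rintro ⟨g, α, hg, rfl, h1, h2, h3⟩
    have hr := max_pos F g
    obtain ⟨y, hy⟩ : ∃ y : F, ‖y‖ = max ‖g.1 1 0‖ ‖g.1 1 1‖ := by
      rcases max_choice ‖g.1 1 0‖ ‖g.1 1 1‖ with h | h
      · exact ⟨_, h.symm⟩
      · exact ⟨_, h.symm⟩
    have hy0 : y ≠ 0 := norm_pos_iff.1 (hy ▸ hr)
    obtain ⟨α', h', e⟩ := exists_scale p F g α hg (Units.mk0 y hy0)⁻¹
    rw [e]
    refine mkH_mem_openCompact p F ?_ _ _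
    have key : ∀ i j, ‖g.1 i j‖ ≤ ‖y‖ → ‖g.1 i j * ((Units.mk0 y hy0)⁻¹ : Fˣ)‖ ≤ 1 := by
      intro i j h
      rw [Units.val_inv_eq_inv_val, Units.val_mk0, ← div_eq_mul_inv, norm_div]
      exact div_le_one_of_le₀ h (norm_nonneg _)
    rw [← hy] at h1 h2 h3
    have h4 : ‖g.1 1 0‖ ≤ ‖y‖ := hy ▸ le_max_left _ _
    have h5 : ‖g.1 1 1‖ ≤ ‖y‖ := hy ▸ le_max_right _ _
    rw [mem_K0_iff, det_mul_scalar]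
    simp only [mul_scalar_apply, pow_zero, Fin.forall_fin_two]
    refine ⟨⟨⟨key _ _ h1, key _ _ h2⟩, key _ _ h4, key _ _ h5⟩, key _ _ h4, ?_⟩
    rw [norm_mul, h3, pow_zero, one_mul, Units.val_inv_eq_inv_val, Units.val_mk0, norm_pow,
      norm_inv, ← mul_pow, mul_inv_cancel₀ (hy ▸ hr.ne'), one_pow]
  · intro hh
    obtain ⟨g, α, hg, rfl, hk⟩ := exists_of_mem_openCompact p F hh
    refine (mkH_mem_cell p F (sphCell_scalar p F) _ _ _).2 ?_
    rw [mem_K0_iff] at hk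
    obtain ⟨h1, -, h3⟩ := hk
    have h4 := norm_det_le F g
    have hr : max ‖g.1 1 0‖ ‖g.1 1 1‖ = 1 := by
      refine le_antisymm (max_le (h1 _ _) (h1 _ _)) ?_
      rw [h3] at h4
      refine h4.trans (max_le ?_ ?_)
      · exact (mul_le_of_le_one_left (norm_nonneg _) (h1 _ _)).trans (le_max_right _ _)
      · exact (mul_le_of_le_one_left (norm_nonneg _) (h1 _ _)).trans (le_max_left _ _)
    rw [sphCell, hr, h3]
    exact ⟨h1 _ _, h1 _ _, by simp⟩

theorem cell_iwaCell_zero (hinert : ∀ x : F, x ≠ 0 → ∃ k : ℤ, ‖x‖ = (p : ℝ) ^ k) :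
    cell p F (iwaCell p F 0) = (openCompact p F 1 : Set (H10 p F)) := by
  have hp := one_lt_prime p
  ext h
  constructor
  · rintro ⟨g, α, hg, rfl, h1, h2, h3⟩
    have hr : 0 < ‖g.1 1 1‖ := (norm_nonneg _).trans_lt h1
    have hy0 : g.1 1 1 ≠ 0 := norm_pos_iff.1 hr
    obtain ⟨α', h', e⟩ := exists_scale p F g α hg (Units.mk0 (g.1 1 1) hy0)⁻¹
    rw [e]
    refine mkH_mem_openCompact p F ?_ _ _
    rw [pow_zero, one_mul] at h3
    have h0 : ‖g.1 0 0‖ ≤ ‖g.1 1 1‖ := by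
      have e1 : g.1 0 0 * g.1 1 1 = g.1.det + g.1 0 1 * g.1 1 0 := by
        rw [Matrix.det_fin_two]
        ring
      have h4 : ‖g.1 0 0‖ * ‖g.1 1 1‖ ≤ ‖g.1 1 1‖ * ‖g.1 1 1‖ := by
        rw [← norm_mul, e1, ← sq]
        refine (IsUltrametricDist.norm_add_le_max _ _).trans (max_le h3.le ?_)
        rw [norm_mul, sq]
        exact mul_le_mul h2 h1.le (norm_nonneg _) hr.le
      exact le_of_mul_le_mul_right h4 hr
    have key : ∀ i j, ‖g.1 i j * ((Units.mk0 (g.1 1 1) hy0)⁻¹ : Fˣ)‖ = ‖g.1 i j‖ / ‖g.1 1 1‖ := by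
      intro i j
      rw [Units.val_inv_eq_inv_val, Units.val_mk0, ← div_eq_mul_inv, norm_div]
    rw [mem_K0_iff, det_mul_scalar]
    simp only [mul_scalar_apply, pow_one, Fin.forall_fin_two, key]
    refine ⟨⟨⟨?_, ?_⟩, ?_, ?_⟩, ?_, ?_⟩
    · exact div_le_one_of_le₀ h0 hr.le
    · exact div_le_one_of_le₀ h2 hr.le
    · exact div_le_one_of_le₀ h1.le hr.le
    · exact div_le_one_of_le₀ le_rfl hr.le
    · rw [norm_lt_iff p F hinert _ _ hy0] at h1
      rw [div_le_iff₀ hr, inv_mul_eq_div, le_div_iff₀ (by positivity)]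
      exact h1
    · rw [norm_mul, h3, Units.val_inv_eq_inv_val, Units.val_mk0, norm_pow,
        norm_inv, ← mul_pow, mul_inv_cancel₀ hr.ne', one_pow]
  · intro hh
    obtain ⟨g, α, hg, rfl, hk⟩ := exists_of_mem_openCompact p F hh
    refine (mkH_mem_cell p F (iwaCell_scalar p F) _ _ _).2 ?_
    rw [mem_K0_iff, pow_one] at hk
    obtain ⟨h1, h2, h3⟩ := hk
    have hlt : ‖g.1 1 0‖ < 1 := h2.trans_lt (inv_lt_one_of_one_lt₀ hp)
    have hd : ‖g.1 1 1‖ = 1 := by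
      refine le_antisymm (h1 _ _) ?_
      have h4 := norm_det_le F g
      rw [h3, le_max_iff] at h4
      rcases h4 with h4 | h4
      · exact h4.trans (mul_le_of_le_one_left (norm_nonneg _) (h1 _ _))
      · exact absurd (h4.trans (mul_le_of_le_one_left (norm_nonneg _) (h1 _ _))) (not_le.2 hlt)
    rw [iwaCell, hd, h3]
    exact ⟨hlt, h1 _ _, by simp⟩

theorem exists_norm_eq_pow_mul (hinert : ∀ x : F, x ≠ 0 → ∃ k : ℤ, ‖x‖ = (p : ℝ) ^ k) (x y : F)
    (hx : x ≠ 0) (hy : y ≠ 0) (h : ‖x‖ ≤ ‖y‖) : ∃ m : ℕ, ‖x‖ = (p : ℝ)⁻¹ ^ m * ‖y‖ := by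
  have hp := one_lt_prime p
  obtain ⟨k, hk⟩ := hinert x hx
  obtain ⟨l, hl⟩ := hinert y hy
  rw [hk, hl, zpow_le_zpow_iff_right₀ hp] at h
  refine ⟨(l - k).toNat, ?_⟩
  rw [hk, hl, inv_pow, ← zpow_natCast, ← zpow_neg, ← zpow_add₀ (by positivity)]
  congr 1
  omega

theorem inv_prime_pow_injective {m n : ℕ} {r : ℝ} (hr : 0 < r)
    (h : (p : ℝ)⁻¹ ^ m * r = (p : ℝ)⁻¹ ^ n * r) : m = n := by
  have hp := one_lt_prime p
  have h1 := mul_right_cancel₀ hr.ne' h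
  rw [inv_pow, inv_pow, inv_inj] at h1
  exact pow_right_injective₀ (by positivity) hp.ne' h1

/-! ### Spherical case -/

/-- The Weyl element times the torus step. -/
def flipGL : GL (Fin 2) F := swap F * dia F (primeF p F ^ 1) 1

theorem flipGL_inv_mul (g : GL (Fin 2) F) : ((flipGL p F)⁻¹ * g).1
    = !![g.1 1 0 / p, g.1 1 1 / p; -g.1 0 0, -g.1 0 1] := by
  have := prime_ne_zero p F
  apply inv_mul_val
  rw [flipGL, Units.val_mul, swap_val, dia_val]
  ext i j
  fin_cases i <;> fin_cases j <;> simp [primeF_val] <;> field_simp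

theorem flipH_inv_mul_mkH (g : GL (Fin 2) F) (α : ℚ_[p]ˣ) (h) :
    ∃ α' h', (swapH p F * torusH p F 1)⁻¹ * mkH p F g α h
      = mkH p F ((flipGL p F)⁻¹ * g) α' h' :=
  ⟨(1 * primeUnit p ^ 1)⁻¹ * α, (mk_mem_H10_iff p F _ _).1
    ((swapH p F * torusH p F 1)⁻¹ * mkH p F g α h).2, rfl⟩

theorem sphCell_flip_iff (m : ℕ) (g : GL (Fin 2) F) : sphCell p F m ((flipGL p F)⁻¹ * g) ↔
    ‖g.1 1 0‖ * p ≤ max ‖g.1 0 0‖ ‖g.1 0 1‖ ∧ ‖g.1 1 1‖ * p ≤ max ‖g.1 0 0‖ ‖g.1 0 1‖ ∧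
      ‖g.1.det‖ * p = (p : ℝ)⁻¹ ^ m * max ‖g.1 0 0‖ ‖g.1 0 1‖ ^ 2 := by
  have hdet : ‖((flipGL p F)⁻¹ * g).1.det‖ = ‖g.1.det‖ * p := by
    rw [← div_inv_eq_mul ‖g.1.det‖, ← norm_prime p F, ← norm_div]
    congr 1
    rw [flipGL_inv_mul, Matrix.det_fin_two_of, Matrix.det_fin_two]
    ring
  rw [sphCell, hdet, flipGL_inv_mul]
  simp only [Matrix.of_apply, Matrix.cons_val', Matrix.cons_val_zero, Matrix.cons_val_one,
    Matrix.cons_val_fin_one, norm_neg, norm_div, norm_prime, div_inv_eq_mul]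

theorem sphCell_or_flip (hinert : ∀ x : F, x ≠ 0 → ∃ k : ℤ, ‖x‖ = (p : ℝ) ^ k)
    (g : GL (Fin 2) F) :
    (∃ m, sphCell p F m g) ∨ ∃ m, sphCell p F m ((flipGL p F)⁻¹ * g) := by
  have hp := one_lt_prime p
  simp only [sphCell_flip_iff]
  have hr := max_pos F g
  have hdet := norm_det_le F g
  have hd0 := det_ne_zero F g
  rcases le_or_gt (max ‖g.1 0 0‖ ‖g.1 0 1‖) (max ‖g.1 1 0‖ ‖g.1 1 1‖) with h | h
  · left
    obtain ⟨y, hy⟩ : ∃ y : F, ‖y‖ = max ‖g.1 1 0‖ ‖g.1 1 1‖ := by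
      rcases max_choice ‖g.1 1 0‖ ‖g.1 1 1‖ with h | h
      · exact ⟨_, h.symm⟩
      · exact ⟨_, h.symm⟩
    have hy0 : y ≠ 0 := norm_pos_iff.1 (hy ▸ hr)
    rw [max_le_iff, ← hy] at h
    have h4 : ‖g.1 1 0‖ ≤ ‖y‖ := hy ▸ le_max_left _ _
    have h5 : ‖g.1 1 1‖ ≤ ‖y‖ := hy ▸ le_max_right _ _
    obtain ⟨m, hm⟩ := exists_norm_eq_pow_mul p F hinert g.1.det (y ^ 2) hd0 (pow_ne_zero _ hy0) (by
      rw [norm_pow, sq]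
      exact hdet.trans (max_le (mul_le_mul h.1 h5 (norm_nonneg _) (norm_nonneg _))
        (mul_le_mul h.2 h4 (norm_nonneg _) (norm_nonneg _))))
    refine ⟨m, ?_⟩
    rw [sphCell, ← hy]
    exact ⟨h.1, h.2, by rw [hm, norm_pow]⟩
  · right
    obtain ⟨y, hy⟩ : ∃ y : F, ‖y‖ = max ‖g.1 0 0‖ ‖g.1 0 1‖ := by
      rcases max_choice ‖g.1 0 0‖ ‖g.1 0 1‖ with h | h
      · exact ⟨_, h.symm⟩
      · exact ⟨_, h.symm⟩
    have hy0 : y ≠ 0 := norm_pos_iff.1 (hy ▸ hr.trans h)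
    rw [← hy, max_lt_iff, norm_lt_iff p F hinert _ _ hy0, norm_lt_iff p F hinert _ _ hy0] at h
    have h4 : ‖g.1 0 0‖ ≤ ‖y‖ := hy ▸ le_max_left _ _
    have h5 : ‖g.1 0 1‖ ≤ ‖y‖ := hy ▸ le_max_right _ _
    have hp0 := prime_ne_zero p F
    obtain ⟨m, hm⟩ := exists_norm_eq_pow_mul p F hinert (g.1.det / p) (y ^ 2)
      (div_ne_zero hd0 hp0) (pow_ne_zero _ hy0) (by
      rw [norm_pow, sq, norm_div, norm_prime, div_inv_eq_mul]
      refine (mul_le_mul_of_nonneg_right hdet (by positivity)).trans ?_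
      rw [max_mul_of_nonneg _ _ (by positivity), mul_assoc, mul_assoc]
      exact max_le (mul_le_mul h4 h.2 (by positivity) (norm_nonneg _))
        (mul_le_mul h5 h.1 (by positivity) (norm_nonneg _)))
    refine ⟨m, ?_⟩
    rw [← hy]
    refine ⟨h.1, h.2, ?_⟩
    rw [← norm_pow, ← hm, norm_div, norm_prime, div_inv_eq_mul]

theorem not_sphCell_and_flip (m n : ℕ) (g : GL (Fin 2) F) (h : sphCell p F m g)
    (h' : sphCell p F n ((flipGL p F)⁻¹ * g)) : False := by
  have hp := one_lt_prime p
  rw [sphCell_flip_iff] at h'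
  have hr := max_pos F g
  have h1 : max ‖g.1 0 0‖ ‖g.1 0 1‖ ≤ max ‖g.1 1 0‖ ‖g.1 1 1‖ := max_le h.1 h.2.1
  have h2 : max ‖g.1 1 0‖ ‖g.1 1 1‖ * p ≤ max ‖g.1 0 0‖ ‖g.1 0 1‖ := by
    rw [max_mul_of_nonneg _ _ (by positivity)]
    exact max_le h'.1 h'.2.1
  nlinarith

theorem sphCell_injective {m n : ℕ} {g : GL (Fin 2) F} (h : sphCell p F m g)
    (h' : sphCell p F n g) : m = n :=
  inv_prime_pow_injective p (pow_pos (max_pos F g) 2) (h.2.2.symm.trans h'.2.2)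

theorem integral_spherical {D : Finset F} (hD : IsDigits p F D)
    (hinert : ∀ x : F, x ≠ 0 → ∃ k : ℤ, ‖x‖ = (p : ℝ) ^ k)
    (μ : Measure (H10 p F)) [μ.IsHaarMeasure] (J : H10 p F → ℂ) (v : ℕ → ℂ)
    (hJ : ∀ m, ∀ h ∈ cell p F (sphCell p F m), J h = v m)
    (hJ' : ∀ m h, (swapH p F * torusH p F 1)⁻¹ * h ∈ cell p F (sphCell p F m) → J h = v (m + 1))
    (hs : Summable fun m => ((p : ℂ) ^ 2) ^ m * v m) :
    Integrable J μ ∧ ∫ h, J h ∂μ = μ.real (openCompact p F 0 : Set (H10 p F))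
      * (∑' m, ((p : ℂ) ^ 2) ^ m * v m + ∑' m, ((p : ℂ) ^ 2) ^ m * v (m + 1)) := by
  have hseq := isStepSeq_sphCell p F hD hinert
  have h0 : IsOpen (cell p F (sphCell p F 0)) := by
    rw [cell_sphCell_zero]
    exact isOpen_openCompact p F 0
  have hfin : μ (openCompact p F 0 : Set (H10 p F)) ≠ ⊤ :=
    (isCompact_openCompact p F 0).measure_lt_top.ne
  let A : ℕ ⊕ ℕ → Set (H10 p F) := Sum.elim (fun m => cell p F (sphCell p F m))
    fun m => (fun h => (swapH p F * torusH p F 1)⁻¹ * h) ⁻¹' cell p F (sphCell p F m)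
  let w : ℕ ⊕ ℕ → ℂ := Sum.elim v fun m => v (m + 1)
  have hμ0 : ∀ m, μ (cell p F (sphCell p F m)) = (p ^ 2) ^ m * μ (openCompact p F 0 : Set (H10 p F)) := by
    intro m
    rw [hseq.measure hD h0, cell_sphCell_zero]
  have hμ : ∀ i, μ (A i) = (p ^ 2) ^ (Sum.elim id id i : ℕ) * μ (openCompact p F 0 : Set (H10 p F)) := by
    rintro (m | m)
    · exact hμ0 m
    · exact (measure_preimage_mul μ _ _).trans (hμ0 m)
  have hμr : ∀ i, μ.real (A i) = (p ^ 2) ^ (Sum.elim id id i : ℕ)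
      * μ.real (openCompact p F 0 : Set (H10 p F)) := by
    intro i
    rw [Measure.real, hμ, ENNReal.toReal_mul]
    simp [Measure.real]
  have hpp : ((p : ℂ) ^ 2) ≠ 0 := by
    have := (Fact.out : p.Prime).ne_zero
    positivity
  have hs' : Summable fun m => ((p : ℂ) ^ 2) ^ m * v (m + 1) := by
    have := ((summable_nat_add_iff 1).2 hs).mul_left ((p : ℂ) ^ 2)⁻¹
    refine this.congr fun m => ?_
    rw [pow_succ' _ m, mul_assoc, inv_mul_cancel_left₀ hpp]
  have hsum : HasSum (fun i => (μ.real (A i) : ℂ) * w i)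
      (μ.real (openCompact p F 0 : Set (H10 p F))
      * (∑' m, ((p : ℂ) ^ 2) ^ m * v m + ∑' m, ((p : ℂ) ^ 2) ^ m * v (m + 1))) := by
    rw [mul_add]
    refine HasSum.sum ?_ ?_
    · refine (hs.hasSum.mul_left _).congr_fun fun m => ?_
      simp only [Function.comp, hμr]
      simp [w]
      ring
    · refine (hs'.hasSum.mul_left _).congr_fun fun m => ?_
      simp only [Function.comp, hμr]
      simp [w]
      ring
  suffices h : Integrable J μ ∧ HasSum (fun i => μ.real (A i) * w i) (∫ h, J h ∂μ) from
    ⟨h.1, h.2.unique hsum⟩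
  refine integral_of_countable_partition μ A ?_ ?_ ?_ ?_ J w ?_ ?_
  · rintro (m | m)
    · exact (hseq.isOpen h0 m).measurableSet
    · exact ((hseq.isOpen h0 m).preimage (continuous_const_mul _)).measurableSet
  · intro i j hij
    rw [Function.onFun, Set.disjoint_left]
    intro h hi hj
    apply hij
    obtain ⟨g, α, hg, rfl⟩ := exists_eq_mkH p F h
    have e1 : ∀ m, mkH p F g α hg ∈ A (Sum.inl m) ↔ sphCell p F m g := fun m =>
      mkH_mem_cell p F (sphCell_scalar p F) _ _ _
    have e2 : ∀ m, mkH p F g α hg ∈ A (Sum.inr m) ↔ sphCell p F m ((flipGL p F)⁻¹ * g) := by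
      intro m
      obtain ⟨α', h', e⟩ := flipH_inv_mul_mkH p F g α hg
      change _ * _ ∈ cell p F _ ↔ _
      rw [e, mkH_mem_cell p F (sphCell_scalar p F)]
    rcases i with m | m <;> rcases j with n | n <;> simp only [e1, e2] at hi hj
    · rw [sphCell_injective p F hi hj]
    · exact (not_sphCell_and_flip p F _ _ _ hi hj).elim
    · exact (not_sphCell_and_flip p F _ _ _ hj hi).elim
    · rw [sphCell_injective p F hi hj]
  · rw [Set.eq_univ_iff_forall]
    intro h
    obtain ⟨g, α, hg, rfl⟩ := exists_eq_mkH p F h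
    rw [Set.mem_iUnion]
    rcases sphCell_or_flip p F hinert g with ⟨m, hm⟩ | ⟨m, hm⟩
    · exact ⟨Sum.inl m, (mkH_mem_cell p F (sphCell_scalar p F) _ _ _).2 hm⟩
    · refine ⟨Sum.inr m, ?_⟩
      obtain ⟨α', h', e⟩ := flipH_inv_mul_mkH p F g α hg
      change _ * _ ∈ cell p F _
      rw [e]
      exact (mkH_mem_cell p F (sphCell_scalar p F) _ _ _).2 hm
  · intro i
    rw [hμ]
    exact ENNReal.mul_ne_top (by simp) hfin
  · rintro (m | m) h hh
    · exact hJ m h hh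
    · exact hJ' m h hh
  · refine hsum.summable.norm.congr fun i => ?_
    rw [norm_mul, Complex.norm_real, Real.norm_of_nonneg measureReal_nonneg]

end Partition

end AsaiZeta

namespace AsaiZeta

noncomputable section IwahoriPartition

set_option linter.unusedSectionVars false

variable (p : ℕ) [Fact p.Prime]
variable (F : Type*) [NormedField F] [NormedAlgebra ℚ_[p] F] [Algebra.IsQuadraticExtension ℚ_[p] F]
variable [IsUltrametricDist F]

theorem alGL_mul (g : GL (Fin 2) F) : (alMatrix F (primeF p F) * g).1
    = !![g.1 1 0, g.1 1 1; -(p * g.1 0 0), -(p * g.1 0 1)] := by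
  rw [Units.val_mul, alMatrix_val]
  ext i j
  fin_cases i <;> fin_cases j <;> simp [primeF_val, Matrix.mul_apply]

theorem mul_alGL (g : GL (Fin 2) F) : (g * alMatrix F (primeF p F)).1
    = !![-(p * g.1 0 1), g.1 0 0; -(p * g.1 1 1), g.1 1 0] := by
  rw [Units.val_mul, alMatrix_val]
  ext i j
  fin_cases i <;> fin_cases j <;> simp [primeF_val, Matrix.mul_apply, mul_comm]

theorem norm_det_alMatrix : ‖(alMatrix F (primeF p F)).1.det‖ = (p : ℝ)⁻¹ := by
  rw [alMatrix_val, Matrix.det_fin_two_of]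
  simp [primeF_val, norm_prime p F]

theorem iwaCell_mul_al_iff (hinert : ∀ x : F, x ≠ 0 → ∃ k : ℤ, ‖x‖ = (p : ℝ) ^ k) (m : ℕ)
    (g : GL (Fin 2) F) : iwaCell p F m (g * alMatrix F (primeF p F)) ↔
      ‖g.1 1 1‖ ≤ ‖g.1 1 0‖ ∧ ‖g.1 0 0‖ ≤ ‖g.1 1 0‖ ∧
        ‖g.1.det‖ = (p : ℝ)⁻¹ ^ m * (p * ‖g.1 1 0‖ ^ 2) := by
  have hp := one_lt_prime p
  have hp' : (p : ℝ) ≠ 0 := by positivity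
  have hdet : ‖(g * alMatrix F (primeF p F)).1.det‖ = ‖g.1.det‖ * (p : ℝ)⁻¹ := by
    rw [Units.val_mul, Matrix.det_mul, norm_mul, norm_det_alMatrix]
  rw [iwaCell, hdet, mul_alGL]
  simp only [Matrix.of_apply, Matrix.cons_val', Matrix.cons_val_zero, Matrix.cons_val_one,
    Matrix.cons_val_fin_one, norm_neg]
  have e : ‖g.1.det‖ * (p : ℝ)⁻¹ = (p : ℝ)⁻¹ ^ m * ‖g.1 1 0‖ ^ 2 ↔
      ‖g.1.det‖ = (p : ℝ)⁻¹ ^ m * (p * ‖g.1 1 0‖ ^ 2) := by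
    rw [← div_eq_mul_inv, div_eq_iff hp']
    constructor <;> intro h <;> rw [h] <;> ring
  rw [e]
  refine and_congr_left fun h => ?_
  have h0 : g.1 1 0 ≠ 0 := by
    intro h0
    have := h.2
    rw [h0] at this
    simp [det_ne_zero F g] at this
  rw [norm_lt_iff p F hinert _ _ h0, norm_mul, norm_prime, mul_comm, mul_inv_cancel_left₀ hp']

theorem iwaCell_al_mul_iff (hinert : ∀ x : F, x ≠ 0 → ∃ k : ℤ, ‖x‖ = (p : ℝ) ^ k) (m : ℕ)
    (g : GL (Fin 2) F) : iwaCell p F m (alMatrix F (primeF p F) * g) ↔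
      ‖g.1 0 0‖ < ‖g.1 0 1‖ ∧ ‖g.1 1 1‖ < ‖g.1 0 1‖ ∧
        ‖g.1.det‖ = (p : ℝ)⁻¹ ^ (m + 1) * ‖g.1 0 1‖ ^ 2 := by
  have hp := one_lt_prime p
  have hp' : (p : ℝ) ≠ 0 := by positivity
  have hp'' : (0 : ℝ) < (p : ℝ)⁻¹ := by positivity
  have hdet : ‖(alMatrix F (primeF p F) * g).1.det‖ = (p : ℝ)⁻¹ * ‖g.1.det‖ := by
    rw [Units.val_mul, Matrix.det_mul, norm_mul, norm_det_alMatrix]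
  rw [iwaCell, hdet, alGL_mul]
  simp only [Matrix.of_apply, Matrix.cons_val', Matrix.cons_val_zero, Matrix.cons_val_one,
    Matrix.cons_val_fin_one, norm_neg]
  have e : (p : ℝ)⁻¹ * ‖g.1.det‖ = (p : ℝ)⁻¹ ^ m * ‖(p : F) * g.1 0 1‖ ^ 2 ↔
      ‖g.1.det‖ = (p : ℝ)⁻¹ ^ (m + 1) * ‖g.1 0 1‖ ^ 2 := by
    rw [norm_mul, norm_prime, mul_pow, inv_mul_eq_iff_eq_mul₀ hp', pow_succ _ m]
    constructor <;> intro h <;> rw [h] <;> field_simp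
  rw [e, norm_mul, norm_mul, norm_prime]
  rw [mul_lt_mul_iff_right₀ hp'']
  refine and_congr_right fun h => and_congr_left fun _ => ?_
  rw [norm_lt_iff p F hinert _ _ (norm_pos_iff.1 ((norm_nonneg _).trans_lt h)),
    inv_mul_eq_div, le_div_iff₀ (by positivity)]

theorem iwaCell_al_mul_al_iff (hinert : ∀ x : F, x ≠ 0 → ∃ k : ℤ, ‖x‖ = (p : ℝ) ^ k) (m : ℕ)
    (g : GL (Fin 2) F) : iwaCell p F m (alMatrix F (primeF p F) * g * alMatrix F (primeF p F)) ↔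
      ‖g.1 0 1‖ ≤ ‖g.1 0 0‖ ∧ ‖g.1 1 0‖ < ‖g.1 0 0‖ ∧
        ‖g.1.det‖ = (p : ℝ)⁻¹ ^ m * ‖g.1 0 0‖ ^ 2 := by
  have hp := one_lt_prime p
  have hp' : (p : ℝ) ≠ 0 := by positivity
  have hp'' : (0 : ℝ) < (p : ℝ)⁻¹ := by positivity
  have hdet : ‖(alMatrix F (primeF p F) * g).1.det‖ = (p : ℝ)⁻¹ * ‖g.1.det‖ := by
    rw [Units.val_mul, Matrix.det_mul, norm_mul, norm_det_alMatrix]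
  rw [iwaCell_mul_al_iff p F hinert, hdet, alGL_mul]
  simp only [Matrix.of_apply, Matrix.cons_val', Matrix.cons_val_zero, Matrix.cons_val_one,
    Matrix.cons_val_fin_one, norm_neg]
  have e : (p : ℝ)⁻¹ * ‖g.1.det‖ = (p : ℝ)⁻¹ ^ m * (p * ‖(p : F) * g.1 0 0‖ ^ 2) ↔
      ‖g.1.det‖ = (p : ℝ)⁻¹ ^ m * ‖g.1 0 0‖ ^ 2 := by
    rw [norm_mul, norm_prime, mul_pow, inv_mul_eq_iff_eq_mul₀ hp']
    constructor <;> intro h <;> rw [h] <;> field_simp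
  rw [e, norm_mul, norm_mul, norm_prime, mul_le_mul_iff_right₀ hp'']
  refine and_congr_right fun _ => and_congr_left fun h => ?_
  have h0 : g.1 0 0 ≠ 0 := by
    intro h0
    have := det_ne_zero F g
    rw [h0] at h
    simp [this] at h
  rw [norm_lt_iff p F hinert _ _ h0, inv_mul_eq_div, le_div_iff₀ (by positivity)]

theorem mem_openCompact_one_al_conj (hinert : ∀ x : F, x ≠ 0 → ∃ k : ℤ, ‖x‖ = (p : ℝ) ^ k)
    (h : H10 p F) : alH p F * h * alH p F ∈ cell p F (iwaCell p F 0) ↔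
      h ∈ cell p F (iwaCell p F 0) := by
  have key : ∀ h, h ∈ cell p F (iwaCell p F 0) →
      alH p F * h * alH p F ∈ cell p F (iwaCell p F 0) := by
    rintro h hh
    rw [cell_iwaCell_zero p F hinert] at hh
    obtain ⟨g, α, hg, rfl, hk⟩ := exists_of_mem_openCompact p F hh
    have hmem : mkH p F g α hg ∈ cell p F (iwaCell p F 0) := by
      rw [cell_iwaCell_zero p F hinert]
      exact mkH_mem_openCompact p F hk _ _
    rw [mkH_mem_cell p F (iwaCell_scalar p F)] at hmem
    obtain ⟨h1, h2, h3⟩ := hmem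
    rw [alH, mkH_mul, mkH_mul, mkH_mem_cell p F (iwaCell_scalar p F),
      iwaCell_al_mul_al_iff p F hinert]
    rw [mem_K0_iff, pow_one] at hk
    obtain ⟨k1, k2, k3⟩ := hk
    have hlt : ‖g.1 1 0‖ < 1 := k2.trans_lt (inv_lt_one_of_one_lt₀ (one_lt_prime p))
    have ha : ‖g.1 0 0‖ = 1 := by
      refine le_antisymm (k1 _ _) ?_
      have h4 := norm_det_le F g
      rw [k3, le_max_iff] at h4
      rcases h4 with h4 | h4
      · exact h4.trans (mul_le_of_le_one_right (norm_nonneg _) (k1 _ _))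
      · exact absurd (h4.trans (mul_le_of_le_one_left (norm_nonneg _) (k1 _ _))) (not_le.2 hlt)
    rw [ha, k3]
    exact ⟨k1 _ _, hlt, by simp⟩
  refine ⟨fun hh => ?_, key h⟩
  have := key _ hh
  have e : alH p F * (alH p F * h * alH p F) * alH p F
      = (alH p F * alH p F) * h * (alH p F * alH p F) := by group
  rwa [e, alH_mul_alH, one_mul, mul_one] at this

theorem norm_det_of_lt {g : GL (Fin 2) F} (h : ‖g.1 0 1‖ * ‖g.1 1 0‖ < ‖g.1 0 0‖ * ‖g.1 1 1‖) :
    ‖g.1.det‖ = ‖g.1 0 0‖ * ‖g.1 1 1‖ := by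
  rw [Matrix.det_fin_two, ← norm_mul]
  rw [← norm_mul, ← norm_mul] at h
  refine le_antisymm ((norm_sub_le_max' _ _).trans (max_le le_rfl h.le)) ?_
  by_contra! hlt
  have e : g.1 0 0 * g.1 1 1 = (g.1 0 0 * g.1 1 1 - g.1 0 1 * g.1 1 0) + g.1 0 1 * g.1 1 0 := by ring
  have := IsUltrametricDist.norm_add_le_max (g.1 0 0 * g.1 1 1 - g.1 0 1 * g.1 1 0)
    (g.1 0 1 * g.1 1 0)
  rw [← e] at this
  exact absurd this (not_le.2 (max_lt hlt h))

theorem norm_det_of_gt {g : GL (Fin 2) F} (h : ‖g.1 0 0‖ * ‖g.1 1 1‖ < ‖g.1 0 1‖ * ‖g.1 1 0‖) :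
    ‖g.1.det‖ = ‖g.1 0 1‖ * ‖g.1 1 0‖ := by
  rw [Matrix.det_fin_two, ← norm_mul]
  rw [← norm_mul, ← norm_mul] at h
  refine le_antisymm ((norm_sub_le_max' _ _).trans (max_le h.le le_rfl)) ?_
  by_contra! hlt
  have e : g.1 0 1 * g.1 1 0 = g.1 0 0 * g.1 1 1 - (g.1 0 0 * g.1 1 1 - g.1 0 1 * g.1 1 0) := by ring
  have := norm_sub_le_max' (g.1 0 0 * g.1 1 1) (g.1 0 0 * g.1 1 1 - g.1 0 1 * g.1 1 0)
  rw [← e] at this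
  exact absurd this (not_le.2 (max_lt h hlt))

theorem iwahori_covering (hinert : ∀ x : F, x ≠ 0 → ∃ k : ℤ, ‖x‖ = (p : ℝ) ^ k)
    (g : GL (Fin 2) F) : (∃ m, iwaCell p F m g) ∨
      (∃ m, iwaCell p F (m + 1) (alMatrix F (primeF p F) * g * alMatrix F (primeF p F))) ∨
      (∃ m, iwaCell p F m (g * alMatrix F (primeF p F))) ∨
      (∃ m, iwaCell p F (m + 1) (alMatrix F (primeF p F) * g)) := by
  simp only [iwaCell_al_mul_al_iff p F hinert, iwaCell_mul_al_iff p F hinert,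
    iwaCell_al_mul_iff p F hinert]
  have hp := one_lt_prime p
  have hp0 := prime_ne_zero p F
  have hdet := norm_det_le F g
  have hd0 := det_ne_zero F g
  have hdpos := norm_pos_iff.2 hd0
  have hlt := norm_lt_iff p F hinert
  simp only [iwaCell]
  set a := g.1 0 0
  set b := g.1 0 1
  set c := g.1 1 0
  set d := g.1 1 1
  have ha := norm_nonneg a
  have hb := norm_nonneg b
  have hc := norm_nonneg c
  have hd := norm_nonneg d
  by_cases h1 : ‖b‖ ≤ max ‖a‖ ‖d‖ ∧ ‖c‖ < max ‖a‖ ‖d‖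
  · obtain ⟨h1, h2⟩ := h1
    rcases le_or_gt ‖a‖ ‖d‖ with had | had
    · left
      rw [max_eq_right had] at h1 h2
      obtain ⟨m, hm⟩ := exists_norm_eq_pow_mul p F hinert g.1.det (d ^ 2) hd0
        (pow_ne_zero _ (norm_pos_iff.1 (hc.trans_lt h2))) (by
          rw [norm_pow, sq]
          exact hdet.trans (max_le (by gcongr) (by gcongr)))
      exact ⟨m, h2, h1, by rw [hm, norm_pow]⟩
    · right; left
      rw [max_eq_left had.le] at h1 h2
      have ha0 : a ≠ 0 := norm_pos_iff.1 (hd.trans_lt had)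
      rw [hlt _ _ ha0] at had
      have h2' := h2
      rw [hlt _ _ ha0] at h2'
      obtain ⟨m, hm⟩ := exists_norm_eq_pow_mul p F hinert g.1.det (p * a ^ 2) hd0
        (mul_ne_zero hp0 (pow_ne_zero _ ha0)) (by
          rw [norm_mul, norm_pow, norm_prime, inv_mul_eq_div, le_div_iff₀ (by positivity)]
          refine (mul_le_mul_of_nonneg_right hdet (by positivity)).trans ?_
          rw [max_mul_of_nonneg _ _ (by positivity), mul_assoc, mul_assoc, sq]
          exact max_le (by gcongr) (by gcongr))
      refine ⟨m, h1, h2, ?_⟩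
      rw [hm, norm_mul, norm_pow, norm_prime, pow_succ _ m, mul_assoc]
  · right; right
    rw [not_and_or, not_le, not_lt] at h1
    rcases le_or_gt ‖b‖ (‖c‖ * p) with hbc | hbc
    · left
      have hc' : ‖a‖ ≤ ‖c‖ ∧ ‖d‖ ≤ ‖c‖ := by
        rcases h1 with h1 | h1
        · have hb0 : b ≠ 0 := norm_pos_iff.1 ((le_max_of_le_left ha).trans_lt h1)
          rw [max_lt_iff, hlt _ _ hb0, hlt _ _ hb0] at h1
          exact ⟨le_of_mul_le_mul_right (h1.1.trans hbc) (by positivity),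
            le_of_mul_le_mul_right (h1.2.trans hbc) (by positivity)⟩
        · exact max_le_iff.1 h1
      have hc0 : c ≠ 0 := by
        intro h0
        rw [h0, norm_zero] at hc' hbc
        have e1 : a = 0 := norm_le_zero_iff.1 hc'.1
        have e2 : b = 0 := norm_le_zero_iff.1 (by simpa using hbc)
        simp only [e1, e2, norm_zero, zero_mul, max_self] at hdet
        linarith
      obtain ⟨m, hm⟩ := exists_norm_eq_pow_mul p F hinert g.1.det (c ^ 2 / p) hd0
        (div_ne_zero (pow_ne_zero _ hc0) hp0) (by
          rw [norm_div, norm_pow, norm_prime, div_inv_eq_mul]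
          refine hdet.trans (max_le ?_ ?_)
          · calc _ ≤ ‖c‖ * ‖c‖ := mul_le_mul hc'.1 hc'.2 hd hc
              _ ≤ _ := by rw [sq]; exact le_mul_of_one_le_right (by positivity) hp.le
          · calc _ ≤ (‖c‖ * p) * ‖c‖ := by gcongr
              _ = _ := by ring)
      refine ⟨m, hc'.2, hc'.1, ?_⟩
      rw [hm, norm_div, norm_pow, norm_prime, div_inv_eq_mul, mul_comm (p : ℝ)]
    · right
      have hb' : ‖a‖ < ‖b‖ ∧ ‖d‖ < ‖b‖ := by
        rcases h1 with h1 | h1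
        · exact max_lt_iff.1 h1
        · have h2 := (le_mul_of_one_le_right hc hp.le).trans_lt hbc
          exact max_lt_iff.1 (h1.trans_lt h2)
      have hb0 : b ≠ 0 := norm_pos_iff.1 (ha.trans_lt hb'.1)
      have hbc' : ‖c‖ * p * p ≤ ‖b‖ := by
        have h3 : ‖c / p‖ < ‖b‖ := by rwa [norm_div, norm_prime, div_inv_eq_mul]
        rw [hlt _ _ hb0] at h3
        rwa [norm_div, norm_prime, div_inv_eq_mul] at h3
      have h4 := hb'.1
      have h5 := hb'.2
      rw [hlt _ _ hb0] at h4 h5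
      obtain ⟨m, hm⟩ := exists_norm_eq_pow_mul p F hinert g.1.det (p ^ 2 * b ^ 2) hd0
        (mul_ne_zero (pow_ne_zero _ hp0) (pow_ne_zero _ hb0)) (by
          rw [norm_mul, norm_pow, norm_pow, norm_prime, inv_pow, inv_mul_eq_div,
            le_div_iff₀ (by positivity)]
          refine (mul_le_mul_of_nonneg_right hdet (by positivity)).trans ?_
          rw [max_mul_of_nonneg _ _ (by positivity)]
          refine max_le ?_ ?_
          · calc _ = (‖a‖ * p) * (‖d‖ * p) := by ring
              _ ≤ _ := by rw [sq]; gcongr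
          · calc _ = ‖b‖ * (‖c‖ * p * p) := by ring
              _ ≤ _ := by rw [sq]; gcongr)
      refine ⟨m, hb'.1, hb'.2, ?_⟩
      rw [hm, norm_mul, norm_pow, norm_pow, norm_prime]
      ring

theorem not_iwaCell_and_al_mul_al (hinert : ∀ x : F, x ≠ 0 → ∃ k : ℤ, ‖x‖ = (p : ℝ) ^ k)
    (m n : ℕ) (g : GL (Fin 2) F) (h : iwaCell p F m g)
    (h' : iwaCell p F (n + 1) (alMatrix F (primeF p F) * g * alMatrix F (primeF p F))) : False := by
  have hp := one_lt_prime p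
  rw [iwaCell_al_mul_al_iff p F hinert] at h'
  obtain ⟨h1, h2, h3⟩ := h
  obtain ⟨k1, k2, k3⟩ := h'
  have hd : 0 < ‖g.1 1 1‖ := (norm_nonneg _).trans_lt h1
  have ha : 0 < ‖g.1 0 0‖ := (norm_nonneg _).trans_lt k2
  have hdet := norm_det_of_lt F (g := g) (by
    calc _ ≤ ‖g.1 1 1‖ * ‖g.1 1 0‖ := by gcongr
      _ < ‖g.1 1 1‖ * ‖g.1 0 0‖ := by gcongr
      _ = _ := mul_comm _ _)
  rw [h3, sq, ← mul_assoc] at hdet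
  have e1 := mul_right_cancel₀ hd.ne' hdet
  have e2 : ((p : ℝ)⁻¹ ^ (n + 1)) * ‖g.1 0 0‖ = ‖g.1 1 1‖ := by
    apply mul_left_cancel₀ ha.ne'
    calc _ = (p : ℝ)⁻¹ ^ (n + 1) * ‖g.1 0 0‖ ^ 2 := by ring
      _ = (p : ℝ)⁻¹ ^ m * ‖g.1 1 1‖ ^ 2 := by rw [← k3, h3]
      _ = (p : ℝ)⁻¹ ^ m * ‖g.1 1 1‖ * ‖g.1 1 1‖ := by ring
      _ = _ := by rw [e1]
  have h4 : ‖g.1 0 0‖ ≤ ‖g.1 1 1‖ := by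
    rw [← e1]
    exact mul_le_of_le_one_left hd.le (inv_prime_pow_le_one p m)
  have h5 : (p : ℝ)⁻¹ ^ (n + 1) < 1 :=
    pow_lt_one₀ (by positivity) (inv_lt_one_of_one_lt₀ hp) (by simp)
  nlinarith

theorem not_mul_al_and_al_mul (hinert : ∀ x : F, x ≠ 0 → ∃ k : ℤ, ‖x‖ = (p : ℝ) ^ k)
    (m n : ℕ) (g : GL (Fin 2) F) (h : iwaCell p F m (g * alMatrix F (primeF p F)))
    (h' : iwaCell p F (n + 1) (alMatrix F (primeF p F) * g)) : False := by
  have hp := one_lt_prime p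
  rw [iwaCell_mul_al_iff p F hinert] at h
  rw [iwaCell_al_mul_iff p F hinert] at h'
  obtain ⟨h1, h2, h3⟩ := h
  obtain ⟨k1, k2, k3⟩ := h'
  have hb : 0 < ‖g.1 0 1‖ := (norm_nonneg _).trans_lt k1
  have hc : 0 < ‖g.1 1 0‖ := by
    refine lt_of_le_of_ne (norm_nonneg _) fun h0 => ?_
    rw [← h0] at h3
    have := norm_pos_iff.2 (det_ne_zero F g)
    simp at h3
    rw [h3] at this
    simp at this
  have hdet := norm_det_of_gt F (g := g) (by
    calc _ ≤ ‖g.1 1 0‖ * ‖g.1 1 1‖ := by gcongr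
      _ < ‖g.1 1 0‖ * ‖g.1 0 1‖ := by gcongr
      _ = _ := mul_comm _ _)
  have e1 : (p : ℝ)⁻¹ ^ m * (p * ‖g.1 1 0‖) = ‖g.1 0 1‖ := by
    apply mul_right_cancel₀ hc.ne'
    rw [← hdet, h3]
    ring
  have e2 : (p : ℝ)⁻¹ ^ (n + 1 + 1) * ‖g.1 0 1‖ = ‖g.1 1 0‖ := by
    apply mul_right_cancel₀ hb.ne'
    rw [mul_comm ‖g.1 1 0‖, ← hdet, k3]
    ring
  have h4 : ‖g.1 0 1‖ ≤ p * ‖g.1 1 0‖ := by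
    rw [← e1]
    exact mul_le_of_le_one_left (by positivity) (inv_prime_pow_le_one p m)
  have h5 : ‖g.1 1 0‖ * p * p ≤ ‖g.1 0 1‖ := by
    rw [← e2, pow_succ, pow_succ]
    calc _ = (p : ℝ)⁻¹ ^ n * ‖g.1 0 1‖ := by field_simp
      _ ≤ _ := mul_le_of_le_one_left hb.le (inv_prime_pow_le_one p n)
  have h6 : 0 < ‖g.1 1 0‖ * p := by positivity
  nlinarith

theorem iwaCell_injective {m n : ℕ} {g : GL (Fin 2) F} (h : iwaCell p F m g)
    (h' : iwaCell p F n g) : m = n :=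
  inv_prime_pow_injective p (pow_pos ((norm_nonneg _).trans_lt h.1) 2) (h.2.2.symm.trans h'.2.2)

theorem integral_iwahori {D : Finset F} (hD : IsDigits p F D)
    (hinert : ∀ x : F, x ≠ 0 → ∃ k : ℤ, ‖x‖ = (p : ℝ) ^ k)
    (μ : Measure (H10 p F)) [μ.IsHaarMeasure] (J : H10 p F → ℂ) (v : ℕ → ℂ) (ε : ℂ)
    (hε : ε * ε = 1) (hJ : ∀ m, ∀ h ∈ cell p F (iwaCell p F m), J h = v m)
    (hleft : ∀ h, J (alH p F * h) = ε * J h) (hright : ∀ h, J (h * alH p F) = ε * J h)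
    (hs : Summable fun m => ((p : ℂ) ^ 2) ^ m * v m) :
    Integrable J μ ∧ ∫ h, J h ∂μ = μ.real (openCompact p F 1 : Set (H10 p F)) * ((1 + ε)
      * (∑' m, ((p : ℂ) ^ 2) ^ m * v m + ∑' m, ((p : ℂ) ^ 2) ^ (m + 1) * v (m + 1))) := by
  have hseq := isStepSeq_iwaCell p F hD hinert
  have h0 : IsOpen (cell p F (iwaCell p F 0)) := by
    rw [cell_iwaCell_zero p F hinert]
    exact isOpen_openCompact p F 1
  have hseq' := hseq.mul_right (alH p F)
  have h0' : IsOpen {h | h * alH p F ∈ cell p F (iwaCell p F 0)} :=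
    h0.preimage (continuous_mul_const _)
  have hfin : μ (openCompact p F 1 : Set (H10 p F)) ≠ ⊤ :=
    (isCompact_openCompact p F 1).measure_lt_top.ne
  have halinv : ∀ h, alH p F * (alH p F * h) = h := fun h => by
    rw [← mul_assoc, alH_mul_alH, one_mul]
  have halinv' : ∀ h, h * alH p F * alH p F = h := fun h => by
    rw [mul_assoc, alH_mul_alH, mul_one]
  let C : ℕ → Set (H10 p F) := fun m => cell p F (iwaCell p F m)
  let A : (ℕ ⊕ ℕ) ⊕ (ℕ ⊕ ℕ) → Set (H10 p F) := Sum.elim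
    (Sum.elim C fun m => {h | h * alH p F ∈ C m})
    (Sum.elim (fun m => {h | alH p F * h ∈ C (m + 1)})
      fun m => {h | alH p F * h * alH p F ∈ C (m + 1)})
  let w : (ℕ ⊕ ℕ) ⊕ (ℕ ⊕ ℕ) → ℂ := Sum.elim
    (Sum.elim v fun m => ε * v m) (Sum.elim (fun m => ε * v (m + 1)) fun m => v (m + 1))
  let k : (ℕ ⊕ ℕ) ⊕ (ℕ ⊕ ℕ) → ℕ := Sum.elim (Sum.elim id id) (Sum.elim Nat.succ Nat.succ)
  have hμ0 : ∀ m, μ (C m) = (p ^ 2) ^ m * μ (openCompact p F 1 : Set (H10 p F)) := by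
    intro m
    rw [hseq.measure hD h0, cell_iwaCell_zero p F hinert]
  have hμ1 : ∀ m, μ {h | h * alH p F ∈ C m}
      = (p ^ 2) ^ m * μ (openCompact p F 1 : Set (H10 p F)) := by
    intro m
    rw [hseq'.measure hD h0', ← cell_iwaCell_zero p F hinert]
    congr 1
    rw [← measure_preimage_mul μ (alH p F)]
    congr 1
    ext h
    exact mem_openCompact_one_al_conj p F hinert h
  have hμ : ∀ i, μ (A i) = (p ^ 2) ^ k i * μ (openCompact p F 1 : Set (H10 p F)) := by
    rintro ((m | m) | (m | m))
    · exact hμ0 m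
    · exact hμ1 m
    · exact (measure_preimage_mul μ (alH p F) _).trans (hμ0 (m + 1))
    · exact (measure_preimage_mul μ (alH p F) {h | h * alH p F ∈ C (m + 1)}).trans (hμ1 (m + 1))
  have hμr : ∀ i, μ.real (A i) = (p ^ 2) ^ k i
      * μ.real (openCompact p F 1 : Set (H10 p F)) := by
    intro i
    rw [Measure.real, hμ, ENNReal.toReal_mul]
    simp [Measure.real]
  have hs' : Summable fun m => ((p : ℂ) ^ 2) ^ (m + 1) * v (m + 1) := (summable_nat_add_iff 1).2 hs
  set c := μ.real (openCompact p F 1 : Set (H10 p F)) with hc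
  set S := ∑' m, ((p : ℂ) ^ 2) ^ m * v m
  set S' := ∑' m, ((p : ℂ) ^ 2) ^ (m + 1) * v (m + 1)
  have hsum : HasSum (fun i => (μ.real (A i) : ℂ) * w i) (c * ((1 + ε) * (S + S'))) := by
    have e : (c : ℂ) * ((1 + ε) * (S + S')) = (c * S + (c * ε) * S) + ((c * ε) * S' + c * S') := by ring
    rw [e]
    refine HasSum.sum (HasSum.sum ?_ ?_) (HasSum.sum ?_ ?_)
    · refine (hs.hasSum.mul_left _).congr_fun fun m => ?_
      simp only [Function.comp, hμr]
      simp [w, k]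
      ring
    · refine (hs.hasSum.mul_left _).congr_fun fun m => ?_
      simp only [Function.comp, hμr]
      simp [w, k]
      ring
    · refine (hs'.hasSum.mul_left _).congr_fun fun m => ?_
      simp only [Function.comp, hμr]
      simp [w, k]
      ring
    · refine (hs'.hasSum.mul_left _).congr_fun fun m => ?_
      simp only [Function.comp, hμr]
      simp [w, k]
      ring
  suffices h : Integrable J μ ∧ HasSum (fun i => μ.real (A i) * w i) (∫ h, J h ∂μ) from
    ⟨h.1, h.2.unique hsum⟩
  refine integral_of_countable_partition μ A ?_ ?_ ?_ ?_ J w ?_ ?_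
  · rintro ((m | m) | (m | m))
    · exact (hseq.isOpen h0 m).measurableSet
    · exact (hseq'.isOpen h0' m).measurableSet
    · exact ((hseq.isOpen h0 (m + 1)).preimage (continuous_const_mul (alH p F))).measurableSet
    · exact ((hseq'.isOpen h0' (m + 1)).preimage (continuous_const_mul (alH p F))).measurableSet
  · intro i j hij
    rw [Function.onFun, Set.disjoint_left]
    intro h hi hj
    apply hij
    obtain ⟨g, α, hg, rfl⟩ := exists_eq_mkH p F h
    have e1 : ∀ m, mkH p F g α hg ∈ A (Sum.inl (Sum.inl m)) ↔ iwaCell p F m g := fun m =>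
      mkH_mem_cell p F (iwaCell_scalar p F) _ _ _
    have e2 : ∀ m, mkH p F g α hg ∈ A (Sum.inl (Sum.inr m)) ↔
        iwaCell p F m (g * alMatrix F (primeF p F)) := fun m =>
      mkH_mem_cell p F (iwaCell_scalar p F) _ _
        (norm_det_mul p F hg ((mk_mem_H10_iff p F _ _).1 (alH p F).2))
    have e3 : ∀ m, mkH p F g α hg ∈ A (Sum.inr (Sum.inl m)) ↔
        iwaCell p F (m + 1) (alMatrix F (primeF p F) * g) := fun m =>
      mkH_mem_cell p F (iwaCell_scalar p F) _ _
        (norm_det_mul p F ((mk_mem_H10_iff p F _ _).1 (alH p F).2) hg)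
    have e4 : ∀ m, mkH p F g α hg ∈ A (Sum.inr (Sum.inr m)) ↔
        iwaCell p F (m + 1) (alMatrix F (primeF p F) * g * alMatrix F (primeF p F)) := fun m =>
      mkH_mem_cell p F (iwaCell_scalar p F) _ _
        (norm_det_mul p F (norm_det_mul p F ((mk_mem_H10_iff p F _ _).1 (alH p F).2) hg)
          ((mk_mem_H10_iff p F _ _).1 (alH p F).2))
    have d1 := not_iwaCell_and_al_mul_al p F hinert
    have d2 := not_mul_al_and_al_mul p F hinert
    have d3 : ∀ m n, iwaCell p F m g → iwaCell p F n (g * alMatrix F (primeF p F)) → False :=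
      fun m n h h' => absurd h.1 (not_lt.2 ((iwaCell_mul_al_iff p F hinert n g).1 h').1)
    have d4 : ∀ m n, iwaCell p F m g → iwaCell p F n (alMatrix F (primeF p F) * g) → False :=
      fun m n h h' => absurd h.2.1 (not_le.2 ((iwaCell_al_mul_iff p F hinert n g).1 h').2.1)
    have d5 : ∀ m n, iwaCell p F m (g * alMatrix F (primeF p F)) →
        iwaCell p F n (alMatrix F (primeF p F) * g * alMatrix F (primeF p F)) → False :=
      fun m n h h' => absurd ((iwaCell_al_mul_al_iff p F hinert n g).1 h').2.1
        (not_lt.2 ((iwaCell_mul_al_iff p F hinert m g).1 h).2.1)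
    have d6 : ∀ m n, iwaCell p F m (alMatrix F (primeF p F) * g) →
        iwaCell p F n (alMatrix F (primeF p F) * g * alMatrix F (primeF p F)) → False :=
      fun m n h h' => absurd ((iwaCell_al_mul_iff p F hinert m g).1 h).1
        (not_lt.2 ((iwaCell_al_mul_al_iff p F hinert n g).1 h').1)
    rcases i with (m | m) | (m | m) <;> rcases j with (n | n) | (n | n) <;>
      simp only [e1, e2, e3, e4] at hi hj
    · rw [iwaCell_injective p F hi hj]
    · exact (d3 _ _ hi hj).elim
    · exact (d4 _ _ hi hj).elim
    · exact (d1 _ _ _ hi hj).elim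
    · exact (d3 _ _ hj hi).elim
    · rw [iwaCell_injective p F hi hj]
    · exact (d2 _ _ _ hi hj).elim
    · exact (d5 _ _ hi hj).elim
    · exact (d4 _ _ hj hi).elim
    · exact (d2 _ _ _ hj hi).elim
    · rw [Nat.succ_injective (iwaCell_injective p F hi hj)]
    · exact (d6 _ _ hi hj).elim
    · exact (d1 _ _ _ hj hi).elim
    · exact (d5 _ _ hj hi).elim
    · exact (d6 _ _ hj hi).elim
    · rw [Nat.succ_injective (iwaCell_injective p F hi hj)]
  · rw [Set.eq_univ_iff_forall]
    intro h
    obtain ⟨g, α, hg, rfl⟩ := exists_eq_mkH p F h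
    rw [Set.mem_iUnion]
    have hal := (mk_mem_H10_iff p F _ _).1 (alH p F).2
    rcases iwahori_covering p F hinert g with ⟨m, hm⟩ | ⟨m, hm⟩ | ⟨m, hm⟩ | ⟨m, hm⟩
    · exact ⟨Sum.inl (Sum.inl m), (mkH_mem_cell p F (iwaCell_scalar p F) _ _ _).2 hm⟩
    · exact ⟨Sum.inr (Sum.inr m), (mkH_mem_cell p F (iwaCell_scalar p F) _ _
        (norm_det_mul p F (norm_det_mul p F hal hg) hal)).2 hm⟩
    · exact ⟨Sum.inl (Sum.inr m), (mkH_mem_cell p F (iwaCell_scalar p F) _ _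
        (norm_det_mul p F hg hal)).2 hm⟩
    · exact ⟨Sum.inr (Sum.inl m), (mkH_mem_cell p F (iwaCell_scalar p F) _ _
        (norm_det_mul p F hal hg)).2 hm⟩
  · intro i
    rw [hμ]
    exact ENNReal.mul_ne_top (by simp) hfin
  · rintro ((m | m) | (m | m)) h hh
    · exact hJ m h hh
    · have h1 := hJ m _ hh
      have h2 := hright (h * alH p F)
      rw [halinv', h1] at h2
      exact h2
    · have h1 := hJ (m + 1) _ hh
      have h2 := hleft (alH p F * h)
      rw [halinv, h1] at h2
      exact h2
    · have h1 := hJ (m + 1) _ hh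
      rw [hright, hleft, ← mul_assoc, hε, one_mul] at h1
      exact h1
  · refine hsum.summable.norm.congr fun i => ?_
    rw [norm_mul, Complex.norm_real, Real.norm_of_nonneg measureReal_nonneg]

end IwahoriPartition

end AsaiZeta

namespace AsaiZeta

noncomputable section WeilPairing

set_option linter.unusedSectionVars false

variable (p : ℕ) [Fact p.Prime]
variable (F : Type*) [NormedField F] [NormedAlgebra ℚ_[p] F] [Algebra.IsQuadraticExtension ℚ_[p] F]

theorem rho_inv_apply (h : H0 p F) (x : quadSpace p F) : rho p F h⁻¹ (rho p F h x) = x := by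
  rw [← Module.End.mul_apply, ← map_mul, inv_mul_cancel, map_one, Module.End.one_apply]

theorem rho_apply_inv (h : H0 p F) (x : quadSpace p F) : rho p F h (rho p F h⁻¹ x) = x := by
  rw [← Module.End.mul_apply, ← map_mul, mul_inv_cancel, map_one, Module.End.one_apply]

theorem continuous_rho (h : H0 p F) : Continuous (rho p F h) := by
  have : FiniteDimensional ℚ_[p] (Matrix (Fin 2) (Fin 2) F) := inferInstance
  exact LinearMap.continuous_of_finiteDimensional (rho p F h)

/-- The action of `H⁰` on `X = V ⊕ V`. -/
def rhoX (h : H0 p F) : X p F ≃ₜ+ X p F where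
  toFun x := (rho p F h x.1, rho p F h x.2)
  invFun x := (rho p F h⁻¹ x.1, rho p F h⁻¹ x.2)
  left_inv x := by simp only [rho_inv_apply]
  right_inv x := by simp only [rho_apply_inv]
  map_add' x y := by simp only [Prod.fst_add, Prod.snd_add, map_add, Prod.mk_add_mk]
  continuous_toFun := ((continuous_rho p F h).comp continuous_fst).prodMk
    ((continuous_rho p F h).comp continuous_snd)
  continuous_invFun := ((continuous_rho p F h⁻¹).comp continuous_fst).prodMk
    ((continuous_rho p F h⁻¹).comp continuous_snd)

theorem rhoX_apply (h : H0 p F) (x : X p F) : rhoX p F h x = (rho p F h x.1, rho p F h x.2) := rfl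

theorem rhoX_mul (h h' : H0 p F) (x : X p F) : rhoX p F (h * h') x = rhoX p F h (rhoX p F h' x) := by
  rw [rhoX_apply, rhoX_apply, rhoX_apply, map_mul]
  rfl

theorem rho_mk_val (g : GL (Fin 2) F) (α : ℚ_[p]ˣ) (x : quadSpace p F) :
    (rho p F (QuotientGroup.mk (g, α)) x).1 = (α⁻¹ : ℚ_[p]ˣ).val •
      (g.1 * x.1 * (g.1.map (galConj p F)).adjugate) := rfl

variable [IsUltrametricDist F]

/-- The elements of `H⁰` that stabilize the lattice of level `p ^ n`. -/
def latticeStabilizer (n : ℕ) : Subgroup (H0 p F) where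
  carrier := {u | ∀ x, rho p F u x ∈ boxLattice p F 0 n ↔ x ∈ boxLattice p F 0 n}
  one_mem' := fun x => by simp
  mul_mem' := by
    intro u v hu hv x
    rw [map_mul, Module.End.mul_apply, hu, hv]
  inv_mem' := by
    intro u hu x
    rw [← hu, rho_apply_inv]

theorem mem_latticeStabilizer_of_le (n : ℕ) (u : H0 p F)
    (h : ∀ x ∈ boxLattice p F 0 n, rho p F u x ∈ boxLattice p F 0 n)
    (h' : ∀ x ∈ boxLattice p F 0 n, rho p F u⁻¹ x ∈ boxLattice p F 0 n) :
    u ∈ latticeStabilizer p F n := by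
  refine fun x => ⟨fun hx => ?_, h x⟩
  have := h' _ hx
  rwa [rho_inv_apply] at this

theorem openCompact_mem_latticeStabilizer {n : ℕ} (u : H10 p F) (hu : u ∈ openCompact p F n) :
    u.1 ∈ latticeStabilizer p F n := by
  have key : ∀ u ∈ openCompact p F n, ∀ x ∈ boxLattice p F 0 n,
      rho p F u.1 x ∈ boxLattice p F 0 n := by
    intro u hu x hx
    obtain ⟨g, α, hg, rfl, hk⟩ := exists_of_mem_openCompact p F hu
    rw [← mem_lattice_iff] at hx ⊢
    have hα := norm_eq_one_of_mem_K0 p F hk hg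
    have h1 : g.1 ∈ eichlerOrder p F n := (Submonoid.mem_units_iff _ _ |>.1 hk).1
    have h2 : (g.1.map (galConj p F)).adjugate ∈ eichlerOrder p F n := by
      rw [norm_le_one_mem_eichler] at h1 ⊢
      rw [Matrix.adjugate_fin_two]
      exact ⟨by simp [Fin.forall_fin_two, norm_galConj, h1.1], by simpa [norm_galConj] using h1.2⟩
    have h3 := mul_mem (mul_mem h1 hx) h2
    change (rho p F (QuotientGroup.mk (g, α)) x).1 ∈ eichlerOrder p F n
    rw [rho_mk_val]
    rw [norm_le_one_mem_eichler] at h3 ⊢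
    simpa only [Matrix.smul_apply, norm_smul, Units.val_inv_eq_inv_val, norm_inv, hα, inv_one,
      one_mul] using h3
  exact mem_latticeStabilizer_of_le p F n _ (key u hu) (key u⁻¹ (inv_mem hu))

theorem alH_mem_latticeStabilizer : (alH p F).1 ∈ latticeStabilizer p F 1 := by
  have hp0 := prime_ne_zero p F
  have hinv : (alH p F).1⁻¹ = (alH p F).1 :=
    inv_eq_of_mul_eq_one_right (congrArg Subtype.val (alH_mul_alH p F))
  have key : ∀ x ∈ boxLattice p F 0 1, rho p F (alH p F).1 x ∈ boxLattice p F 0 1 := by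
    intro x hx
    have hval : (rho p F (alH p F).1 x).1
        = !![x.1 1 1, -(x.1 1 0 / p); -(p * x.1 0 1), x.1 0 0] := by
      have e := rho_mk_val p F (alMatrix F (primeF p F)) (primeUnit p) x
      refine e.trans ?_
      rw [alMatrix_val, ← algebraMap_smul F, Units.val_inv_eq_inv_val, primeUnit_val, map_inv₀,
        map_natCast]
      ext i j
      simp only [Matrix.smul_apply, Matrix.mul_apply, Fin.sum_univ_two]
      fin_cases i <;> fin_cases j <;>
        simp [Matrix.adjugate_fin_two, primeF_val] <;> field_simp
    rw [mem_boxLattice] at hx ⊢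
    rw [hval]
    simp only [Matrix.of_apply, Matrix.cons_val', Matrix.cons_val_zero, Matrix.cons_val_one,
      Matrix.cons_val_fin_one, norm_neg, norm_div, norm_mul, norm_prime, pow_zero, pow_one] at hx ⊢
    have hp := one_lt_prime p
    refine ⟨?_, ?_, ?_⟩
    · rw [((mem_quadSpace_iff p F x.1).1 x.2).1, norm_galConj]
      exact hx.1
    · exact div_le_one_of_le₀ hx.2.2 (by positivity)
    · exact mul_le_of_le_one_right (by positivity) hx.2.1
  exact mem_latticeStabilizer_of_le p F 1 _ key (by rw [hinv]; exact key)

theorem rhoX_mem_boxSq_iff {n : ℕ} {u : H0 p F} (hu : u ∈ latticeStabilizer p F n) (x : X p F) :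
    rhoX p F u x ∈ boxSq p F 0 n ↔ x ∈ boxSq p F 0 n :=
  and_congr (hu x.1) (hu x.2)

theorem measure_preimage_rhoX {n : ℕ} {u : H0 p F} (hu : u ∈ latticeStabilizer p F n)
    (dx : Measure (X p F)) [dx.IsAddHaarMeasure] (S : Set (X p F)) :
    dx (rhoX p F u ⁻¹' S) = dx S := by
  have h1 := addEquivAddHaarChar_smul_preimage dx (X := (boxSq p F 0 n : Set (X p F))) (rhoX p F u)
  have h2 : rhoX p F u ⁻¹' (boxSq p F 0 n : Set (X p F)) = (boxSq p F 0 n : Set (X p F)) :=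
    Set.ext (rhoX_mem_boxSq_iff p F hu)
  have h3 : dx (boxSq p F 0 n) ≠ ⊤ := (isCompact_boxSq p F 0 n).measure_lt_top.ne
  have h4 : dx (boxSq p F 0 n) ≠ 0 :=
    ((isOpen_boxSq p F 0 n).measure_pos dx ⟨0, zero_mem _⟩).ne'
  rw [h2, ENNReal.smul_def, smul_eq_mul] at h1
  have h5 : ((addEquivAddHaarChar (rhoX p F u) : NNReal) : ENNReal) = 1 :=
    (ENNReal.mul_eq_right h4 h3).1 h1
  have h6 := addEquivAddHaarChar_smul_preimage dx (X := S) (rhoX p F u)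
  rwa [ENNReal.smul_def, smul_eq_mul, h5, one_mul] at h6

/-- The measure of `(L ⊕ L) ∩ h (L ⊕ L)`. -/
def overlap (dx : Measure (X p F)) (n : ℕ) (h : H0 p F) : ℝ :=
  dx.real {x | x ∈ boxSq p F 0 n ∧ rhoX p F h⁻¹ x ∈ boxSq p F 0 n}

theorem weilPairing_eq_overlap (dx : Measure (X p F)) (n : ℕ) (h : H10 p F) :
    weilPairing p F dx (weil p F h (phiStar p F n)) (phiStar p F n) = overlap p F dx n h.1 := by
  have h1 : lattice p F n ×ˢ lattice p F n = (boxSq p F 0 n : Set (X p F)) := by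
    ext x
    rw [Set.mem_prod, mem_lattice_iff, mem_lattice_iff]
    rfl
  set S : Set (X p F) := {x | x ∈ boxSq p F 0 n ∧ rhoX p F h.1⁻¹ x ∈ boxSq p F 0 n} with hS
  have hSm : MeasurableSet S :=
    ((isOpen_boxSq p F 0 n).inter
      ((isOpen_boxSq p F 0 n).preimage (rhoX p F h.1⁻¹).continuous_toFun)).measurableSet
  have h2 : ∀ x, weil p F h (phiStar p F n) x * (starRingEnd ℂ) (phiStar p F n x)
      = S.indicator (fun _ => (1 : ℂ)) x := by
    intro x
    change phiStar p F n (rhoX p F h.1⁻¹ x) * _ = _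
    simp only [phiStar, h1]
    by_cases hx : x ∈ (boxSq p F 0 n : Set (X p F))
    · rw [Set.indicator_of_mem hx, map_one, mul_one]
      by_cases hx' : rhoX p F h.1⁻¹ x ∈ (boxSq p F 0 n : Set (X p F))
      · rw [Set.indicator_of_mem hx', Set.indicator_of_mem (show x ∈ S from ⟨hx, hx'⟩)]
      · rw [Set.indicator_of_notMem hx', Set.indicator_of_notMem fun h => hx' h.2]
    · rw [Set.indicator_of_notMem hx, map_zero, mul_zero, Set.indicator_of_notMem fun h => hx h.1]
  rw [weilPairing]
  simp only [h2]
  rw [integral_indicator hSm, setIntegral_const, overlap]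
  simp [hS]

theorem overlap_mul_left {n : ℕ} {u : H0 p F} (hu : u ∈ latticeStabilizer p F n)
    (dx : Measure (X p F)) [dx.IsAddHaarMeasure] (h : H0 p F) :
    overlap p F dx n (u * h) = overlap p F dx n h := by
  have hu' : u⁻¹ ∈ latticeStabilizer p F n := inv_mem hu
  rw [overlap, overlap, Measure.real, Measure.real,
    ← measure_preimage_rhoX p F hu' dx {x | x ∈ boxSq p F 0 n ∧ rhoX p F h⁻¹ x ∈ boxSq p F 0 n}]
  congr 2
  ext x
  simp only [Set.mem_preimage, Set.mem_ofPred_eq]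
  rw [rhoX_mem_boxSq_iff p F hu', mul_inv_rev, rhoX_mul]

theorem overlap_mul_right {n : ℕ} {u : H0 p F} (hu : u ∈ latticeStabilizer p F n)
    (dx : Measure (X p F)) (h : H0 p F) : overlap p F dx n (h * u) = overlap p F dx n h := by
  rw [overlap, overlap]
  congr 1
  ext x
  simp only [Set.mem_ofPred_eq]
  rw [mul_inv_rev, rhoX_mul, rhoX_mem_boxSq_iff p F (inv_mem hu)]

theorem overlap_torusH (dx : Measure (X p F)) (n m : ℕ) :
    overlap p F dx n (torusH p F m).1 = dx.real (boxSq p F m n) := by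
  have hp0 := prime_ne_zero p F
  have hp := one_lt_prime p
  rw [overlap]
  congr 1
  have key : ∀ x : quadSpace p F, x ∈ boxLattice p F 0 n ∧
      rho p F (torusH p F m).1⁻¹ x ∈ boxLattice p F 0 n ↔ x ∈ boxLattice p F m n := by
    intro x
    obtain ⟨y, rfl⟩ : ∃ y, x = rho p F (torusH p F m).1 y := ⟨_, (rho_apply_inv p F _ x).symm⟩
    rw [rho_inv_apply]
    have hval : (rho p F (torusH p F m).1 y).1
        = !![y.1 0 0, (p : F) ^ m * y.1 0 1; ((p : F) ^ m)⁻¹ * y.1 1 0, y.1 1 1] := by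
      have e := rho_mk_val p F (dia F (primeF p F ^ m) 1) (primeUnit p ^ m) y
      refine e.trans ?_
      rw [dia_val, ← algebraMap_smul F, Units.val_inv_eq_inv_val, Units.val_pow_eq_pow_val,
        primeUnit_val, map_inv₀, map_pow, map_natCast]
      ext i j
      simp only [Matrix.smul_apply, Matrix.mul_apply, Fin.sum_univ_two]
      fin_cases i <;> fin_cases j <;>
        simp [Matrix.adjugate_fin_two, primeF_val] <;> field_simp
    simp only [mem_boxLattice]
    rw [hval]
    simp only [Matrix.of_apply, Matrix.cons_val', Matrix.cons_val_zero, Matrix.cons_val_one,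
      Matrix.cons_val_fin_one, norm_mul, norm_inv, norm_prime_pow, pow_zero]
    have h1 : (0 : ℝ) < (p : ℝ)⁻¹ ^ m := by positivity
    have h2 := inv_prime_pow_le_one p m
    have h3 : (p : ℝ)⁻¹ ^ m * ‖y.1 0 1‖ ≤ (p : ℝ)⁻¹ ^ m ↔ ‖y.1 0 1‖ ≤ 1 :=
      mul_le_iff_le_one_right h1
    rw [h3]
    constructor
    · rintro ⟨⟨k1, k2, k3⟩, k4, k5, k6⟩
      exact ⟨k1, k5, k3⟩
    · rintro ⟨k1, k2, k3⟩
      refine ⟨⟨k1, mul_le_one₀ h2 (norm_nonneg _) k2, k3⟩, k1, k2, ?_⟩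
      exact (le_mul_of_one_le_left (norm_nonneg _) (one_le_inv₀ h1 |>.2 h2)).trans k3
  ext x
  have e1 := key x.1
  have e2 := key x.2
  simp only [Set.mem_ofPred_eq, SetLike.mem_coe, mem_boxSq, rhoX_apply, ← e1, ← e2]
  tauto

theorem swapH_mem_openCompact : swapH p F ∈ openCompact p F 0 := by
  refine mkH_mem_openCompact p F ?_ _ _
  rw [mem_K0_iff, swap_val]
  simp [Fin.forall_fin_two]

theorem measureReal_boxSq_zero_one (hinert : ∀ x : F, x ≠ 0 → ∃ k : ℤ, ‖x‖ = (p : ℝ) ^ k)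
    (dx : Measure (X p F)) [dx.IsAddHaarMeasure] :
    dx.real (boxSq p F 0 1) = (p : ℝ)⁻¹ ^ 2 * dx.real (boxSq p F 0 0) := by
  have h1 := measureReal_boxSq p F hinert dx 1 0
  rw [mul_one] at h1
  rw [← h1, Measure.real, Measure.real, ← measure_preimage_rhoX p F
    (openCompact_mem_latticeStabilizer p F _ (swapH_mem_openCompact p F)) dx (boxSq p F 0 1)]
  congr 2
  have key : ∀ x : quadSpace p F, rho p F (swapH p F).1 x ∈ boxLattice p F 0 1 ↔
      x ∈ boxLattice p F 1 0 := by
    intro x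
    have hval : (rho p F (swapH p F).1 x).1 = !![x.1 1 1, -x.1 1 0; -x.1 0 1, x.1 0 0] := by
      refine (rho_mk_val p F (swap F) 1 x).trans ?_
      rw [swap_val]
      ext i j
      simp only [Matrix.smul_apply, Matrix.mul_apply, Fin.sum_univ_two]
      fin_cases i <;> fin_cases j <;> simp [Matrix.adjugate_fin_two]
    rw [mem_boxLattice, mem_boxLattice, hval]
    simp only [Matrix.of_apply, Matrix.cons_val', Matrix.cons_val_zero, Matrix.cons_val_one,
      Matrix.cons_val_fin_one, norm_neg]
    rw [((mem_quadSpace_iff p F x.1).1 x.2).1, norm_galConj]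
    tauto
  ext x
  exact and_congr (key x.1) (key x.2)

theorem overlap_torusH_eq (hinert : ∀ x : F, x ≠ 0 → ∃ k : ℤ, ‖x‖ = (p : ℝ) ^ k)
    (dx : Measure (X p F)) [dx.IsAddHaarMeasure] (hdx : IsSelfDual p F dx) {n : ℕ} (hn : n ≤ 1)
    (m : ℕ) : overlap p F dx n (torusH p F m).1 = (p : ℝ)⁻¹ ^ (2 * m) * (p : ℝ)⁻¹ ^ (2 * n) := by
  rw [overlap_torusH, measureReal_boxSq p F hinert]
  congr 1
  rcases (show n = 0 ∨ n = 1 by omega) with rfl | rfl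
  · rw [measure_boxSq_zero p F hinert dx hdx]
    simp
  · rw [measureReal_boxSq_zero_one p F hinert, measure_boxSq_zero p F hinert dx hdx, mul_one,
      mul_one]

end WeilPairing

end AsaiZeta

namespace AsaiZeta

noncomputable section InvariantForm

variable {G W : Type*} [Group G] [AddCommGroup W] [Module ℂ W] {π : Representation ℂ G W}
  {B : W →ₗ[ℂ] W →ₗ⋆[ℂ] ℂ}

theorem IsInvariantForm.apply_left (hB : IsInvariantForm π B) (g : G) (v w : W) :
    B (π g v) w = B v (π g⁻¹ w) := by
  rw [← hB.invariant g v (π g⁻¹ w), ← Module.End.mul_apply, ← map_mul, mul_inv_cancel, map_one,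
    Module.End.one_apply]

theorem apply_inv_of_fixed {g : G} {f : W} (h : π g f = f) : π g⁻¹ f = f := by
  nth_rewrite 1 [← h]
  rw [← Module.End.mul_apply, ← map_mul, inv_mul_cancel, map_one, Module.End.one_apply]

theorem IsInvariantForm.apply_left_of_fixed (hB : IsInvariantForm π B) {g : G} {f : W}
    (h : π g f = f) (v : W) : B (π g v) f = B v f := by
  rw [hB.apply_left, apply_inv_of_fixed h]

theorem IsInvariantForm.norm_le_one (hB : IsInvariantForm π B) {f : W} (hf : B f f = 1) (g : G) :
    ‖B (π g f) f‖ ≤ 1 := by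
  set w := π g f with hw'
  have hw : B w w = 1 := (hB.invariant g f f).trans hf
  set z := B w f with hz
  have hzc : B f w = (starRingEnd ℂ) z := hB.symm w f
  have h1 : B (w - z • f) (w - z • f) = 1 - z * (starRingEnd ℂ) z := by
    simp only [map_sub, LinearMap.sub_apply, LinearMap.smul_apply, map_smul, map_smulₛₗ, hw, hf,
      hzc, ← hz, smul_eq_mul]
    ring
  have h2 : 0 ≤ (B (w - z • f) (w - z • f)).re := by
    by_cases h : w - z • f = 0
    · rw [h]; simp
    · exact (hB.pos _ h).le
  rw [h1, Complex.mul_conj, Complex.sub_re, Complex.one_re, Complex.ofReal_re,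
    Complex.normSq_eq_norm_sq] at h2
  nlinarith [norm_nonneg z]

end InvariantForm

noncomputable section Recursion

theorem summable_of_recursion {u : ℕ → ℂ} {r s : ℂ} (hr : ‖r‖ < 1) (hs : ‖s‖ < 1)
    (hu : ∀ m, u (m + 2) = (r + s) * u (m + 1) - r * s * u m) : Summable u := by
  have hw : ∀ m, u (m + 1) - r * u m = s ^ m * (u 1 - r * u 0) := by
    intro m
    induction m with
    | zero => simp
    | succ m ih =>
      rw [hu]
      linear_combination s * ih
  set c := ‖u 1 - r * u 0‖
  have hs1 : ∀ n, ∑ m ∈ Finset.range n, ‖s‖ ^ m ≤ (1 - ‖s‖)⁻¹ := by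
    intro n
    rw [← tsum_geometric_of_lt_one (norm_nonneg _) hs]
    exact (summable_geometric_of_lt_one (norm_nonneg _) hs).sum_le_tsum _ fun _ _ => by positivity
  have h1 : ∀ m, ‖u (m + 1)‖ ≤ ‖r‖ * ‖u m‖ + ‖s‖ ^ m * c := by
    intro m
    have : u (m + 1) = r * u m + s ^ m * (u 1 - r * u 0) := by rw [← hw]; ring
    rw [this]
    refine (norm_add_le _ _).trans ?_
    rw [norm_mul, norm_mul, norm_pow]
  have h2 : ∀ n, ∑ m ∈ Finset.range n, ‖u m‖
      ≤ (‖u 0‖ + (1 - ‖s‖)⁻¹ * c) * (1 - ‖r‖)⁻¹ := by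
    intro n
    rw [← div_eq_mul_inv, le_div_iff₀ (by linarith)]
    have h3 : ∑ m ∈ Finset.range n, ‖u m‖ ≤ ∑ m ∈ Finset.range (n + 1), ‖u m‖ := by
      rw [Finset.sum_range_succ]
      exact le_add_of_nonneg_right (norm_nonneg _)
    rw [Finset.sum_range_succ'] at h3
    have h4 := Finset.sum_le_sum fun m (_ : m ∈ Finset.range n) => h1 m
    rw [Finset.sum_add_distrib, ← Finset.mul_sum, ← Finset.sum_mul] at h4
    have h5 := mul_le_mul_of_nonneg_right (hs1 n) (norm_nonneg (u 1 - r * u 0))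
    change _ ≤ (1 - ‖s‖)⁻¹ * c at h5
    linarith
  exact (summable_of_sum_range_le (fun _ => norm_nonneg _) h2).of_norm

theorem tsum_of_recursion {u : ℕ → ℂ} {r s : ℂ} (hr : ‖r‖ < 1) (hs : ‖s‖ < 1)
    (hu : ∀ m, u (m + 2) = (r + s) * u (m + 1) - r * s * u m) :
    (∑' m, u m) * ((1 - r) * (1 - s)) = u 0 + u 1 - (r + s) * u 0 := by
  have hS := summable_of_recursion hr hs hu
  have hS1 : Summable fun m => u (m + 1) := (summable_nat_add_iff 1).2 hS
  have h1 := hS.tsum_eq_zero_add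
  have h2 := hS1.tsum_eq_zero_add
  have h3 : ∑' m, u (m + 1 + 1) = (r + s) * ∑' m, u (m + 1) - r * s * ∑' m, u m := by
    rw [← tsum_mul_left, ← tsum_mul_left, ← (hS1.mul_left _).tsum_sub (hS.mul_left _)]
    exact tsum_congr hu
  rw [h3] at h2
  simp only [zero_add] at h2
  linear_combination (1 - r - s) * h1 + h2

theorem norm_le_of_add_inv {a : ℂ} {r : ℝ} (hr : 1 ≤ r) (ha : a ≠ 0) (him : (a + a⁻¹).im = 0)
    (h : ‖a + a⁻¹‖ ≤ r + r⁻¹) : ‖a‖ = 1 ∨ ‖a‖ ≤ r ∧ a.im = 0 := by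
  have hn : Complex.normSq a ≠ 0 := by simpa using ha
  rw [Complex.add_im, Complex.inv_im] at him
  have h1 : a.im * (Complex.normSq a - 1) = 0 := by
    field_simp at him
    linarith
  rcases mul_eq_zero.1 h1 with h2 | h2
  · right
    refine ⟨?_, h2⟩
    by_contra! h3
    have h4 : a = (a.re : ℂ) := by
      apply Complex.ext <;> simp [h2]
    have h5 : ‖a‖ = |a.re| := by rw [h4]; simp
    have h6 : ‖a + a⁻¹‖ = ‖a‖ + ‖a‖⁻¹ := by
      rw [h5]
      rw [h4, ← Complex.ofReal_inv, ← Complex.ofReal_add, Complex.norm_real, Real.norm_eq_abs,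
        ← abs_inv]
      simp only [Complex.ofReal_re]
      rw [abs_add_eq_add_abs_iff]
      rcases le_total 0 a.re with h | h
      · exact Or.inl ⟨h, inv_nonneg.2 h⟩
      · exact Or.inr ⟨h, inv_nonpos.2 h⟩
    rw [h6] at h
    have hp : 0 < ‖a‖ := by linarith
    have h7 : (‖a‖ - r) * (‖a‖ * r - 1) ≤ 0 := by
      have : (‖a‖ - r) * (‖a‖ * r - 1) = (‖a‖ + ‖a‖⁻¹ - (r + r⁻¹)) * (‖a‖ * r) := by
        field_simp
        ring
      rw [this]
      exact mul_nonpos_of_nonpos_of_nonneg (by linarith) (by positivity)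
    have h8 : 1 < ‖a‖ * r := by nlinarith
    linarith [mul_pos (sub_pos.2 h3) (sub_pos.2 h8)]
  · left
    rw [Complex.normSq_eq_norm_sq] at h2
    nlinarith [norm_nonneg a]

end Recursion

noncomputable section Iwasawa

set_option linter.unusedSectionVars false

variable (p : ℕ) [Fact p.Prime]
variable (F : Type*) [NormedField F] [NormedAlgebra ℚ_[p] F] [Algebra.IsQuadraticExtension ℚ_[p] F]
  [IsUltrametricDist F]

theorem exists_norm_eq_max (g : GL (Fin 2) F) : ∃ y : Fˣ, ‖(y : F)‖ = max ‖g.1 1 0‖ ‖g.1 1 1‖ := by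
  have hr := max_pos F g
  rcases max_choice ‖g.1 1 0‖ ‖g.1 1 1‖ with h | h
  · exact ⟨Units.mk0 (g.1 1 0) (norm_pos_iff.1 (h ▸ hr)), h.symm⟩
  · exact ⟨Units.mk0 (g.1 1 1) (norm_pos_iff.1 (h ▸ hr)), h.symm⟩

/-- The Iwasawa decomposition. -/
theorem exists_iwasawa (g k : GL (Fin 2) F) (y : Fˣ) (hk : k.1.det = 1)
    (h0 : k.1 1 0 * y = g.1 1 0) (h1 : k.1 1 1 * y = g.1 1 1) :
    ∃ t : GL (Fin 2) F, g = t * k ∧ t.1 1 0 = 0 ∧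
      t.1 0 0 = ((Matrix.GeneralLinearGroup.det g / y : Fˣ) : F) ∧ t.1 1 1 = y := by
  have hinv : (k⁻¹).1 = k.1.adjugate := by
    rw [Matrix.coe_units_inv, Matrix.inv_def, hk]
    simp
  have hk' := hk
  rw [Matrix.det_fin_two] at hk'
  have e1 : (g * k⁻¹).1 1 0 = 0 := by
    rw [Units.val_mul, hinv, Matrix.mul_apply, Fin.sum_univ_two, Matrix.adjugate_fin_two, ← h0, ← h1]
    simp
    ring
  have e2 : (g * k⁻¹).1 1 1 = y := by
    rw [Units.val_mul, hinv, Matrix.mul_apply, Fin.sum_univ_two, Matrix.adjugate_fin_two, ← h0, ← h1]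
    simp
    linear_combination (y : F) * hk'
  refine ⟨g * k⁻¹, by group, e1, ?_, e2⟩
  have e3 : (g * k⁻¹).1.det = g.1.det := by
    rw [Units.val_mul, Matrix.det_mul, hinv, Matrix.det_adjugate, hk]
    simp
  rw [Matrix.det_fin_two, e1, e2, mul_zero, sub_zero] at e3
  rw [Units.val_div_eq_div_val, eq_div_iff y.ne_zero, e3]
  rfl

theorem exists_lower_of_ne (g : GL (Fin 2) F) (h : g.1 1 1 ≠ 0) :
    ∃ t : GL (Fin 2) F, g = t * lower F (g.1 1 0 / g.1 1 1) ∧ t.1 1 0 = 0 ∧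
      t.1 0 0 = ((Matrix.GeneralLinearGroup.det g / Units.mk0 _ h : Fˣ) : F) ∧
      t.1 1 1 = (Units.mk0 _ h : Fˣ) := by
  apply exists_iwasawa <;> simp [lower_val, h]

theorem exists_swap_of_ne (g : GL (Fin 2) F) (h : g.1 1 0 ≠ 0) :
    ∃ t : GL (Fin 2) F, g = t * (swap F * upper F (g.1 1 1 / g.1 1 0)) ∧ t.1 1 0 = 0 ∧
      t.1 0 0 = ((Matrix.GeneralLinearGroup.det g / Units.mk0 _ h : Fˣ) : F) ∧
      t.1 1 1 = (Units.mk0 _ h : Fˣ) := by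
  apply exists_iwasawa <;> simp [swap_val, upper_val, h]

theorem lower_mem_K0 {n : ℕ} {c : F} (h : ‖c‖ ≤ (p : ℝ)⁻¹ ^ n) : lower F c ∈ K0 p F n := by
  rw [mem_K0_iff, lower_val]
  have h1 : ‖c‖ ≤ 1 := h.trans (inv_prime_pow_le_one p n)
  exact ⟨by simp [Fin.forall_fin_two, h1], h, by simp⟩

theorem upper_mem_K0 (n : ℕ) {b : F} (h : ‖b‖ ≤ 1) : upper F b ∈ K0 p F n := by
  rw [mem_K0_iff, upper_val]
  exact ⟨by simp [Fin.forall_fin_two, h], by simp, by simp⟩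

theorem swap_mem_K0 : swap F ∈ K0 p F 0 := by
  rw [mem_K0_iff, swap_val]
  simp [Fin.forall_fin_two]

theorem dia_mem_K0 (n : ℕ) {a d : Fˣ} (ha : ‖(a : F)‖ = 1) (hd : ‖(d : F)‖ = 1) :
    dia F a d ∈ K0 p F n := by
  rw [mem_K0_iff, dia_val]
  exact ⟨by simp [Fin.forall_fin_two, ha.le, hd.le], by simp, by simp [ha, hd]⟩

theorem max_mul_K0_le (g k : GL (Fin 2) F) (hk : k ∈ K0 p F 0) :
    max ‖(g * k).1 1 0‖ ‖(g * k).1 1 1‖ ≤ max ‖g.1 1 0‖ ‖g.1 1 1‖ := by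
  have h1 := (mem_K0_iff p F |>.1 hk).1
  have key : ∀ j, ‖(g * k).1 1 j‖ ≤ max ‖g.1 1 0‖ ‖g.1 1 1‖ := by
    intro j
    rw [Units.val_mul, Matrix.mul_apply, Fin.sum_univ_two]
    refine (IsUltrametricDist.norm_add_le_max _ _).trans (max_le_max ?_ ?_) <;> rw [norm_mul]
    · exact mul_le_of_le_one_right (norm_nonneg _) (h1 _ _)
    · exact mul_le_of_le_one_right (norm_nonneg _) (h1 _ _)
  exact max_le (key 0) (key 1)

theorem max_mul_K0 (g k : GL (Fin 2) F) (hk : k ∈ K0 p F 0) :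
    max ‖(g * k).1 1 0‖ ‖(g * k).1 1 1‖ = max ‖g.1 1 0‖ ‖g.1 1 1‖ := by
  refine le_antisymm (max_mul_K0_le p F g k hk) ?_
  have := max_mul_K0_le p F (g * k) k⁻¹ (inv_mem hk)
  rwa [mul_inv_cancel_right] at this

/-- The bottom row of `g` times a step of the Hecke operator. -/
theorem mul_hecke_val (g : GL (Fin 2) F) (b : F) (a d : Fˣ) :
    (g * (upper F b * dia F a d)).1 1 0 = a * g.1 1 0 ∧
      (g * (upper F b * dia F a d)).1 1 1 = d * (g.1 1 0 * b + g.1 1 1) := by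
  simp only [Units.val_mul, Matrix.mul_apply, Fin.sum_univ_two, upper_val, dia_val]
  simp
  constructor <;> ring

/-- An open subgroup contains a power of every element of `K0`. -/
theorem exists_pow_mem_of_isOpen (U : Subgroup (GL (Fin 2) F))
    (hU : IsOpen (U : Set (GL (Fin 2) F))) {n : ℕ} {k : GL (Fin 2) F} (hk : k ∈ K0 p F n) :
    ∃ j, 0 < j ∧ k ^ j ∈ U := by
  have : CompactSpace (K0 p F n) := isCompact_iff_compactSpace.1 (isCompact_K0 p F n)
  have hU' : IsOpen (U.subgroupOf (K0 p F n) : Set (K0 p F n)) := hU.preimage continuous_subtype_val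
  have : Finite (K0 p F n ⧸ U.subgroupOf (K0 p F n)) := Subgroup.quotient_finite_of_isOpen _ hU'
  have h0 : (U.subgroupOf (K0 p F n)).index ≠ 0 := Subgroup.index_ne_zero_of_finite
  obtain ⟨j, hj, -, h⟩ := Subgroup.exists_pow_mem_of_index_ne_zero h0 ⟨k, hk⟩
  exact ⟨j, hj, h⟩

end Iwasawa

end AsaiZeta

namespace AsaiZeta

noncomputable section Principal

set_option linter.unusedSectionVars false

variable (p : ℕ) [Fact p.Prime]
variable (F : Type*) [NormedField F] [NormedAlgebra ℚ_[p] F] [Algebra.IsQuadraticExtension ℚ_[p] F]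

theorem equiv_apply_apply {G V W : Type*} [Group G] [AddCommGroup V] [Module ℂ V] [AddCommGroup W]
    [Module ℂ W] {ρ : Representation ℂ G V} {σ : Representation ℂ G W} (e : ρ.Equiv σ) (g : G)
    (v : V) : e (ρ g v) = σ g (e v) :=
  LinearMap.congr_fun (e.1.2 g) v

/-- The character of the Borel subgroup that the principal series is induced from. -/
def borelChar (μ ν : Fˣ →* ℂˣ) (a d : Fˣ) : ℂ :=
  (μ a : ℂ) * ν d * ((absF p F (a / d) ^ (1 / 2 : ℝ) : ℝ) : ℂ)

theorem absF_eq (x : F) : absF p F x = ‖x‖ ^ 2 := by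
  rw [absF, Algebra.IsQuadraticExtension.finrank_eq_two]

theorem borelChar_eq (μ ν : Fˣ →* ℂˣ) (a d : Fˣ) :
    borelChar p F μ ν a d = (μ a : ℂ) * ν d * ((‖(a : F)‖ / ‖(d : F)‖ : ℝ) : ℂ) := by
  rw [borelChar, absF_eq, ← Real.sqrt_eq_rpow, Real.sqrt_sq (norm_nonneg _), norm_div]

theorem borelChar_mul (μ ν : Fˣ →* ℂˣ) (a a' d d' : Fˣ) :
    borelChar p F μ ν (a * a') (d * d') = borelChar p F μ ν a d * borelChar p F μ ν a' d' := by
  simp only [borelChar_eq, map_mul, Units.val_mul, norm_mul, Complex.ofReal_div, Complex.ofReal_mul,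
    mul_div_mul_comm]
  ring

variable {F} in
theorem eq_of_norm_eq {μ : Fˣ →* ℂˣ} (hμ : ∀ u : Fˣ, ‖(u : F)‖ = 1 → μ u = 1) {a a' : Fˣ}
    (h : ‖(a : F)‖ = ‖(a' : F)‖) : μ a = μ a' := by
  have h1 : ‖((a / a' : Fˣ) : F)‖ = 1 := by
    rw [Units.val_div_eq_div_val, norm_div, h, div_self (by simp)]
  have h2 := hμ _ h1
  rwa [map_div, div_eq_one] at h2

theorem borelChar_congr {μ ν : Fˣ →* ℂˣ} (hμ : ∀ u : Fˣ, ‖(u : F)‖ = 1 → μ u = 1)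
    (hν : ∀ u : Fˣ, ‖(u : F)‖ = 1 → ν u = 1) {a a' d d' : Fˣ} (h : ‖(a : F)‖ = ‖(a' : F)‖)
    (h' : ‖(d : F)‖ = ‖(d' : F)‖) : borelChar p F μ ν a d = borelChar p F μ ν a' d' := by
  rw [borelChar_eq, borelChar_eq, eq_of_norm_eq hμ h, eq_of_norm_eq hν h', h, h']

variable [IsUltrametricDist F]

theorem principal_apply {μ ν : Fˣ →* ℂˣ} (hμ : ∀ u : Fˣ, ‖(u : F)‖ = 1 → μ u = 1)
    (hν : ∀ u : Fˣ, ‖(u : F)‖ = 1 → ν u = 1) {φ : GL (Fin 2) F → ℂ}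
    (hφ : φ ∈ induced F (borelChar p F μ ν)) (hK : ∀ x, ∀ k ∈ K0 p F 0, φ (x * k) = φ x)
    (g : GL (Fin 2) F) (y : Fˣ) (hy : ‖(y : F)‖ = max ‖g.1 1 0‖ ‖g.1 1 1‖) :
    φ g = borelChar p F μ ν (Matrix.GeneralLinearGroup.det g / y) y * φ 1 := by
  have hr := max_pos F g
  have key : ∀ (k t : GL (Fin 2) F) (y' : Fˣ), ‖(y' : F)‖ = ‖(y : F)‖ → k ∈ K0 p F 0 →
      g = t * k → t.1 1 0 = 0 →
      t.1 0 0 = ((Matrix.GeneralLinearGroup.det g / y' : Fˣ) : F) → t.1 1 1 = y' →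
      φ g = borelChar p F μ ν (Matrix.GeneralLinearGroup.det g / y) y * φ 1 := by
    intro k t y' hy' hk e h0 h1 h2
    rw [borelChar_congr p F hμ hν (a' := Matrix.GeneralLinearGroup.det g / y') _ hy'.symm,
      ← hφ.1 t 1 _ _ h0 h1 h2, mul_one, ← hK t k hk, ← e]
    rw [Units.val_div_eq_div_val, Units.val_div_eq_div_val, norm_div, norm_div, hy']
  rcases le_total ‖g.1 1 0‖ ‖g.1 1 1‖ with h | h
  · rw [max_eq_right h] at hr hy
    obtain ⟨t, e, h0, h1, h2⟩ := exists_lower_of_ne F g (norm_pos_iff.1 hr)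
    refine key _ t _ hy.symm ?_ e h0 h1 h2
    exact lower_mem_K0 p F (by rw [norm_div, pow_zero]; exact div_le_one_of_le₀ h (norm_nonneg _))
  · rw [max_eq_left h] at hr hy
    obtain ⟨t, e, h0, h1, h2⟩ := exists_swap_of_ne F g (norm_pos_iff.1 hr)
    refine key _ t _ hy.symm (mul_mem (swap_mem_K0 p F) ?_) e h0 h1 h2
    exact upper_mem_K0 p F _ (by rw [norm_div]; exact div_le_one_of_le₀ h (norm_nonneg _))

theorem det_hecke (b : F) (a d : Fˣ) :
    Matrix.GeneralLinearGroup.det (upper F b * dia F a d) = a * d := by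
  ext1
  change (upper F b * dia F a d).1.det = _
  rw [Units.val_mul, Matrix.det_mul, upper_val, dia_val, Matrix.det_fin_two_of,
    Matrix.det_fin_two_of]
  simp

theorem principal_hecke_step {μ ν : Fˣ →* ℂˣ} (hμ : ∀ u : Fˣ, ‖(u : F)‖ = 1 → μ u = 1)
    (hν : ∀ u : Fˣ, ‖(u : F)‖ = 1 → ν u = 1) {φ : GL (Fin 2) F → ℂ}
    (hφ : φ ∈ induced F (borelChar p F μ ν)) (hK : ∀ x, ∀ k ∈ K0 p F 0, φ (x * k) = φ x)
    (x : GL (Fin 2) F) (b : F) (a d : Fˣ) (a' d' : Fˣ) (had : a * d = a' * d')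
    (h : max ‖(a : F) * x.1 1 0‖ ‖(d : F) * (x.1 1 0 * b + x.1 1 1)‖
      = ‖(d' : F)‖ * max ‖x.1 1 0‖ ‖x.1 1 1‖) :
    φ (x * (upper F b * dia F a d)) = borelChar p F μ ν a' d' * φ x := by
  obtain ⟨y, hy⟩ := exists_norm_eq_max F x
  rw [principal_apply p F hμ hν hφ hK x y hy, principal_apply p F hμ hν hφ hK _ (d' * y),
    map_mul, det_hecke, had, ← mul_assoc (borelChar p F μ ν a' d') _ (φ 1), ← borelChar_mul]
  · congr 2
    ext1
    simp only [Units.val_mul, Units.val_div_eq_div_val]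
    field_simp
  · rw [(mul_hecke_val F x b a d).1, (mul_hecke_val F x b a d).2, h, Units.val_mul, norm_mul, hy]

theorem norm_add_eq_of_lt {x y : F} (h : ‖x‖ < ‖y‖) : ‖x + y‖ = ‖y‖ := by
  rw [IsUltrametricDist.norm_add_eq_max_of_norm_ne_norm h.ne, max_eq_right h.le]

/-- If `‖d‖ ≤ ‖c‖`, then `‖c b + d‖` drops below `‖c‖` for exactly one digit `b`. -/
theorem IsDigits.existsUnique_add {D : Finset F} (hD : IsDigits p F D) (c d : F) (hc : c ≠ 0)
    (h : ‖d‖ ≤ ‖c‖) : ∃ b₀ ∈ D, ‖c * b₀ + d‖ < ‖c‖ ∧ ∀ b ∈ D, b ≠ b₀ → ‖c * b + d‖ = ‖c‖ := by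
  have hc' := norm_pos_iff.2 hc
  have key : ∀ b, ‖c * b + d‖ = ‖c‖ * ‖-d / c - b‖ := by
    intro b
    rw [← norm_mul, ← norm_neg]
    congr 1
    field_simp
    ring
  obtain ⟨b₀, ⟨h1, h2⟩, h3⟩ := hD.existsUnique (-d / c) (by
    rw [norm_div, norm_neg]; exact div_le_one_of_le₀ h (norm_nonneg _))
  refine ⟨b₀, h1, ?_, fun b hb hne => ?_⟩
  · rw [key]
    exact mul_lt_of_lt_one_right hc' h2
  · refine le_antisymm ?_ ?_
    · refine (IsUltrametricDist.norm_add_le_max _ _).trans (max_le ?_ h)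
      rw [norm_mul]
      exact mul_le_of_le_one_right (norm_nonneg _) (hD.norm_le b hb)
    · by_contra! hlt
      rw [key] at hlt
      exact hne (h3 b ⟨hb, (mul_lt_iff_lt_one_right hc').1 hlt⟩)

theorem sum_digits_of_le {D : Finset F} (hD : IsDigits p F D) (c d : F) (hc : c ≠ 0)
    (h : ‖d‖ ≤ ‖c‖) (u : F → ℂ) (A A' : ℂ) (hA : ∀ b ∈ D, ‖c * b + d‖ = ‖c‖ → u b = A)
    (hA' : ∀ b ∈ D, ‖c * b + d‖ < ‖c‖ → u b = A') :
    ∑ b ∈ D, u b = ((p : ℂ) ^ 2 - 1) * A + A' := by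
  classical
  obtain ⟨b₀, h1, h2, h3⟩ := hD.existsUnique_add p F c d hc h
  rw [← Finset.add_sum_erase D u h1, hA' b₀ h1 h2, Finset.sum_congr rfl (g := fun _ => A),
    Finset.sum_const, Finset.card_erase_of_mem h1, hD.card, nsmul_eq_mul, Nat.cast_sub, add_comm]
  · push_cast
    rfl
  · exact Nat.one_le_pow _ _ (Fact.out : p.Prime).pos
  · intro b hb
    rw [Finset.mem_erase] at hb
    exact hA b hb.2 (h3 b hb.2 hb.1)

theorem upper_zero : upper F 0 = 1 := by
  ext1
  rw [upper_val, Units.val_one, Matrix.one_fin_two]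

theorem principal_hecke (hinert : ∀ x : F, x ≠ 0 → ∃ k : ℤ, ‖x‖ = (p : ℝ) ^ k)
    {D : Finset F} (hD : IsDigits p F D) {μ ν : Fˣ →* ℂˣ}
    (hμ : ∀ u : Fˣ, ‖(u : F)‖ = 1 → μ u = 1)
    (hν : ∀ u : Fˣ, ‖(u : F)‖ = 1 → ν u = 1) {φ : GL (Fin 2) F → ℂ}
    (hφ : φ ∈ induced F (borelChar p F μ ν)) (hK : ∀ x, ∀ k ∈ K0 p F 0, φ (x * k) = φ x)
    (x : GL (Fin 2) F) :
    ∑ b ∈ D, φ (x * (upper F b * dia F (primeF p F) 1)) + φ (x * dia F 1 (primeF p F))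
      = (p * ((μ (primeF p F) : ℂ) + ν (primeF p F))) * φ x := by
  have hp := one_lt_prime p
  have hp0 : (p : ℂ) ≠ 0 := by exact_mod_cast (Fact.out : p.Prime).ne_zero
  have hpi : (p : ℝ)⁻¹ ≤ 1 := inv_le_one_of_one_le₀ hp.le
  have e1 : borelChar p F μ ν (primeF p F) 1 = μ (primeF p F) / p := by
    rw [borelChar_eq, primeF_val, norm_prime]
    simp
    rfl
  have e2 : borelChar p F μ ν 1 (primeF p F) = ν (primeF p F) * p := by
    rw [borelChar_eq, primeF_val, norm_prime]
    simp
  have hdia : φ (x * dia F 1 (primeF p F)) = φ (x * (upper F 0 * dia F 1 (primeF p F))) := by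
    rw [upper_zero, one_mul]
  have step := principal_hecke_step p F hμ hν hφ hK x
  have hr := max_pos F x
  set c := x.1 1 0
  set d := x.1 1 1
  rcases lt_or_ge ‖c‖ ‖d‖ with h | h
  · rw [max_eq_right h.le] at step hr
    rw [hdia, step 0 1 (primeF p F) 1 (primeF p F) rfl, e2,
      Finset.sum_congr rfl (g := fun _ => borelChar p F μ ν (primeF p F) 1 * φ x),
      Finset.sum_const, hD.card, e1, nsmul_eq_mul]
    · push_cast
      field_simp
    · intro b hb
      apply step _ _ _ _ _ rfl
      have h1 : ‖c * b‖ < ‖d‖ := by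
        rw [norm_mul]
        exact (mul_le_of_le_one_right (norm_nonneg _) (hD.norm_le b hb)).trans_lt h
      rw [Units.val_one, one_mul, norm_add_eq_of_lt F h1, norm_one, one_mul, max_eq_right]
      rw [norm_mul, primeF_val, norm_prime]
      exact (mul_le_of_le_one_left (norm_nonneg _) hpi).trans h.le
    · rw [Units.val_one, one_mul, mul_zero, zero_add, primeF_val, norm_mul, norm_prime,
        max_eq_right]
      rw [norm_lt_iff p F hinert _ _ (norm_pos_iff.1 hr)] at h
      rwa [inv_mul_eq_div, le_div_iff₀ (by positivity)]
  · rw [max_eq_left h] at step hr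
    rw [hdia, step 0 1 (primeF p F) (primeF p F) 1 (mul_comm _ _),
      sum_digits_of_le p F hD c d (norm_pos_iff.1 hr) h _
        (borelChar p F μ ν (primeF p F) 1 * φ x) (borelChar p F μ ν 1 (primeF p F) * φ x), e1, e2]
    · field_simp
      ring
    · intro b _ hb'
      apply step _ _ _ _ _ rfl
      rw [Units.val_one, one_mul, hb', norm_one, one_mul, max_eq_right]
      rw [norm_mul, primeF_val, norm_prime]
      exact mul_le_of_le_one_left (norm_nonneg _) hpi
    · intro b _ hb'
      apply step _ _ _ _ _ (mul_comm _ _)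
      rw [Units.val_one, one_mul, norm_mul, primeF_val, norm_prime, max_eq_left]
      rw [norm_lt_iff p F hinert _ _ (norm_pos_iff.1 hr)] at hb'
      rwa [inv_mul_eq_div, le_div_iff₀ (by positivity)]
    · rw [Units.val_one, one_mul, mul_zero, zero_add, primeF_val, norm_mul, norm_prime,
        norm_one, one_mul, max_eq_left]
      exact (mul_le_of_le_one_left (norm_nonneg _) hpi).trans h

theorem principal_scalar {μ ν : Fˣ →* ℂˣ} {φ : GL (Fin 2) F → ℂ}
    (hφ : φ ∈ induced F (borelChar p F μ ν)) (z : Fˣ) (x : GL (Fin 2) F) :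
    φ (x * Matrix.GeneralLinearGroup.scalar (Fin 2) z) = (μ z : ℂ) * ν z * φ x := by
  rw [← Matrix.GeneralLinearGroup.scalar_commute z x, hφ.1 _ x z z, borelChar_eq]
  · rw [div_self (by simp)]
    simp
  · rw [scalar_apply_eq]; rfl
  · rw [scalar_apply_eq]; rfl
  · rw [scalar_apply_eq]; rfl

/-- The spherical function in a principal series. -/
def sphericalFun (μ ν : Fˣ →* ℂˣ) (g : GL (Fin 2) F) : ℂ :=
  borelChar p F μ ν (Matrix.GeneralLinearGroup.det g / (exists_norm_eq_max F g).choose)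
    (exists_norm_eq_max F g).choose

theorem sphericalFun_eq {μ ν : Fˣ →* ℂˣ} (hμ : ∀ u : Fˣ, ‖(u : F)‖ = 1 → μ u = 1)
    (hν : ∀ u : Fˣ, ‖(u : F)‖ = 1 → ν u = 1) (g : GL (Fin 2) F) (y z : Fˣ)
    (hy : ‖(y : F)‖ = max ‖g.1 1 0‖ ‖g.1 1 1‖) (hz : ‖(z : F)‖ = ‖g.1.det‖) :
    sphericalFun p F μ ν g = borelChar p F μ ν (z / y) y := by
  have h := (exists_norm_eq_max F g).choose_spec.trans hy.symm
  refine borelChar_congr p F hμ hν ?_ h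
  rw [Units.val_div_eq_div_val, Units.val_div_eq_div_val, norm_div, norm_div, h, hz]
  rfl

theorem sphericalFun_mul_K0 {μ ν : Fˣ →* ℂˣ} (hμ : ∀ u : Fˣ, ‖(u : F)‖ = 1 → μ u = 1)
    (hν : ∀ u : Fˣ, ‖(u : F)‖ = 1 → ν u = 1) (g : GL (Fin 2) F) {k : GL (Fin 2) F}
    (hk : k ∈ K0 p F 0) : sphericalFun p F μ ν (g * k) = sphericalFun p F μ ν g := by
  obtain ⟨y, hy⟩ := exists_norm_eq_max F g
  rw [sphericalFun_eq p F hμ hν g y (Matrix.GeneralLinearGroup.det g) hy rfl]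
  refine sphericalFun_eq p F hμ hν _ _ _ ?_ ?_
  · rw [max_mul_K0 p F g k hk, hy]
  · rw [Units.val_mul, Matrix.det_mul, norm_mul, (mem_K0_iff p F |>.1 hk).2.2, mul_one]
    rfl

theorem sphericalFun_mem_induced {μ ν : Fˣ →* ℂˣ} (hμ : ∀ u : Fˣ, ‖(u : F)‖ = 1 → μ u = 1)
    (hν : ∀ u : Fˣ, ‖(u : F)‖ = 1 → ν u = 1) :
    sphericalFun p F μ ν ∈ induced F (borelChar p F μ ν) := by
  refine ⟨fun t g a d h0 h1 h2 => ?_, K0 p F 0, isOpen_K0 p F 0, fun g u hu =>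
    sphericalFun_mul_K0 p F hμ hν g hu⟩
  obtain ⟨y, hy⟩ := exists_norm_eq_max F g
  have h0' : t.1 1 0 = 0 := h0
  have h1' : t.1 0 0 = a := h1
  have h2' : t.1 1 1 = d := h2
  rw [sphericalFun_eq p F hμ hν g y (Matrix.GeneralLinearGroup.det g) hy rfl,
    sphericalFun_eq p F hμ hν (t * g) (d * y) (a * d * Matrix.GeneralLinearGroup.det g),
    ← borelChar_mul]
  · congr 1
    ext1
    simp only [Units.val_mul, Units.val_div_eq_div_val]
    field_simp
  · simp only [Units.val_mul, Matrix.mul_apply, Fin.sum_univ_two, h0', h2', zero_mul, zero_add,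
      norm_mul, hy]
    rw [mul_max_of_nonneg _ _ (norm_nonneg _)]
  · rw [Units.val_mul t, Matrix.det_mul, Matrix.det_fin_two t.1, h0', h1', h2', mul_zero, sub_zero]
    rfl

theorem sphericalFun_one {μ ν : Fˣ →* ℂˣ} (hμ : ∀ u : Fˣ, ‖(u : F)‖ = 1 → μ u = 1)
    (hν : ∀ u : Fˣ, ‖(u : F)‖ = 1 → ν u = 1) : sphericalFun p F μ ν 1 = 1 := by
  rw [sphericalFun_eq p F hμ hν 1 1 1 (by simp) (by simp), borelChar_eq]
  simp

variable {W : Type*} [AddCommGroup W] [Module ℂ W] {ρ : Representation ℂ (GL (Fin 2) F) W}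

theorem exists_spherical {μ ν : Fˣ →* ℂˣ} (hμ : ∀ u : Fˣ, ‖(u : F)‖ = 1 → μ u = 1)
    (hν : ∀ u : Fˣ, ‖(u : F)‖ = 1 → ν u = 1) (e : ρ.Equiv (principalSeries p F μ ν)) :
    ∃ v ≠ 0, ∀ k ∈ K0 p F 0, ρ k v = v := by
  let φ : induced F (borelChar p F μ ν) :=
    ⟨sphericalFun p F μ ν, sphericalFun_mem_induced p F hμ hν⟩
  have hφ : φ ≠ 0 := by
    intro h
    have h1 := congrFun (congrArg Subtype.val h) 1
    exact one_ne_zero ((sphericalFun_one p F hμ hν).symm.trans h1)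
  obtain ⟨v, hv⟩ := EquivLike.surjective e φ
  refine ⟨v, ?_, fun k hk => ?_⟩
  · rintro rfl
    exact hφ (hv.symm.trans (map_zero e))
  · apply EquivLike.injective e
    refine (equiv_apply_apply e k v).trans (Subtype.ext (funext fun x => ?_))
    have hv' : (e v).1 = sphericalFun p F μ ν := congrArg Subtype.val hv
    change (e v).1 (x * k) = (e v).1 x
    rw [hv', sphericalFun_mul_K0 p F hμ hν x hk]

theorem hecke_of_principal (hinert : ∀ x : F, x ≠ 0 → ∃ k : ℤ, ‖x‖ = (p : ℝ) ^ k)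
    {D : Finset F} (hD : IsDigits p F D) {μ ν : Fˣ →* ℂˣ}
    (hμ : ∀ u : Fˣ, ‖(u : F)‖ = 1 → μ u = 1) (hν : ∀ u : Fˣ, ‖(u : F)‖ = 1 → ν u = 1)
    (e : ρ.Equiv (principalSeries p F μ ν)) {f : W} (hf : ∀ k ∈ K0 p F 0, ρ k f = f) :
    ∑ b ∈ D, ρ (upper F b * dia F (primeF p F) 1) f + ρ (dia F 1 (primeF p F)) f
      = ((p : ℂ) * ((μ (primeF p F) : ℂ) + ν (primeF p F))) • f := by
  apply EquivLike.injective e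
  rw [map_add, map_sum, map_smul]
  simp only [equiv_apply_apply]
  ext x
  have hK : ∀ x, ∀ k ∈ K0 p F 0, (e f).1 (x * k) = (e f).1 x := by
    intro x k hk
    have := equiv_apply_apply e k f
    rw [hf k hk] at this
    exact (congrFun (congrArg Subtype.val this) x).symm
  simp only [Submodule.coe_add, Submodule.coe_smul, AddSubmonoidClass.coe_finsetSum, Pi.add_apply,
    Finset.sum_apply, Pi.smul_apply, smul_eq_mul]
  exact principal_hecke p F hinert hD hμ hν (e f).2 hK x

theorem mul_eq_one_of_principal {μ ν : Fˣ →* ℂˣ}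
    (e : ρ.Equiv (principalSeries p F μ ν)) {f : W} (hf : f ≠ 0) (z : Fˣ)
    (hz : ρ (Matrix.GeneralLinearGroup.scalar (Fin 2) z) f = f) : (μ z : ℂ) * ν z = 1 := by
  have h0 : (e f).1 ≠ 0 := by
    intro h
    apply hf
    apply EquivLike.injective e
    exact (Subtype.ext h).trans (map_zero e).symm
  obtain ⟨x, hx⟩ := Function.ne_iff.1 h0
  have h1 := equiv_apply_apply e (Matrix.GeneralLinearGroup.scalar (Fin 2) z) f
  rw [hz] at h1
  have h2 : (e f).1 x = _ := congrFun (congrArg Subtype.val h1) x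
  have h3 := principal_scalar p F (e f).2 z x
  have h4 : (e f).1 x = (μ z : ℂ) * ν z * (e f).1 x := h2.trans h3
  exact (mul_eq_right₀ hx).1 h4.symm

end Principal

end AsaiZeta

namespace AsaiZeta

noncomputable section Special

set_option linter.unusedSectionVars false

variable (p : ℕ) [Fact p.Prime]
variable (F : Type*) [NormedField F] [NormedAlgebra ℚ_[p] F] [Algebra.IsQuadraticExtension ℚ_[p] F]

/-- A twist of the Steinberg representation as a quotient of a space of functions. -/
theorem exists_model {W : Type*} [AddCommGroup W] [Module ℂ W]
    {ρ : Representation ℂ (GL (Fin 2) F) W} {χ : Fˣ →* ℂˣ}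
    (e : ρ.Equiv (twist F (steinberg F) χ)) :
    ∃ S : induced F (fun _ _ => 1) →ₗ[ℂ] W, Function.Surjective S ∧
      (∀ ψ, S ψ = 0 ↔ ∃ c, ∀ x, ψ.1 x = c) ∧
      ∀ g ψ, ρ g (S ψ) = (χ (Matrix.GeneralLinearGroup.det g) : ℂ) • S (inducedRep F _ g ψ) := by
  refine ⟨e.toLinearEquiv.symm.toLinearMap ∘ₗ (constants F).mkQ, ?_, ?_, ?_⟩
  · exact e.toLinearEquiv.symm.surjective.comp (Submodule.mkQ_surjective _)
  · intro ψ
    rw [LinearMap.comp_apply, LinearEquiv.coe_coe, LinearEquiv.map_eq_zero_iff,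
      Submodule.mkQ_apply, Submodule.Quotient.mk_eq_zero]
    rfl
  · intro g ψ
    apply e.toLinearEquiv.injective
    refine (equiv_apply_apply e g _).trans ?_
    rw [map_smul]
    simp only [LinearMap.comp_apply, LinearEquiv.coe_coe, LinearEquiv.apply_symm_apply]
    change twist F (steinberg F) χ g (e.toLinearEquiv (e.toLinearEquiv.symm _)) = _
    rw [LinearEquiv.apply_symm_apply]
    rfl

variable [IsUltrametricDist F]

variable {W : Type*} [AddCommGroup W] [Module ℂ W] {ρ : Representation ℂ (GL (Fin 2) F) W}

theorem apply_mul_of_fixed {χ : Fˣ →* ℂˣ} {S : induced F (fun _ _ => 1) →ₗ[ℂ] W}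
    (hS0 : ∀ ψ, S ψ = 0 ↔ ∃ c, ∀ x, ψ.1 x = c)
    (hS : ∀ g ψ, ρ g (S ψ) = (χ (Matrix.GeneralLinearGroup.det g) : ℂ) • S (inducedRep F _ g ψ))
    {φ : induced F (fun _ _ => 1)} {k : GL (Fin 2) F} (hk : ρ k (S φ) = S φ) :
    ∃ c, ∀ x, (χ (Matrix.GeneralLinearGroup.det k) : ℂ) * φ.1 (x * k) - φ.1 x = c := by
  rw [hS, ← map_smul, ← sub_eq_zero, ← map_sub, hS0] at hk
  exact hk

theorem apply_mul_of_det_eq_one {χ : Fˣ →* ℂˣ} {S : induced F (fun _ _ => 1) →ₗ[ℂ] W}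
    (hS0 : ∀ ψ, S ψ = 0 ↔ ∃ c, ∀ x, ψ.1 x = c)
    (hS : ∀ g ψ, ρ g (S ψ) = (χ (Matrix.GeneralLinearGroup.det g) : ℂ) • S (inducedRep F _ g ψ))
    {φ : induced F (fun _ _ => 1)} {n : ℕ} {k : GL (Fin 2) F} (hk0 : k ∈ K0 p F n)
    (hdet : k.1.det = 1) (hk : ρ k (S φ) = S φ) (x : GL (Fin 2) F) : φ.1 (x * k) = φ.1 x := by
  obtain ⟨c, hc⟩ := apply_mul_of_fixed F hS0 hS hk
  have h1 : Matrix.GeneralLinearGroup.det k = 1 := Units.ext hdet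
  simp only [h1, map_one, Units.val_one, one_mul] at hc
  have hpow : ∀ j : ℕ, φ.1 (x * k ^ j) = φ.1 x + j * c := by
    intro j
    induction j with
    | zero => simp
    | succ j ih =>
      have := hc (x * k ^ j)
      rw [mul_assoc, ← pow_succ, ih] at this
      push_cast
      linear_combination this
  obtain ⟨U, hU, hφU⟩ := φ.2.2
  obtain ⟨j, hj, hjU⟩ := exists_pow_mem_of_isOpen p F U hU hk0
  have h2 := hpow j
  rw [hφU x _ hjU] at h2
  have hj' : (j : ℂ) ≠ 0 := by exact_mod_cast hj.ne'
  have hc0 : c = 0 := by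
    have : (j : ℂ) * c = 0 := by linear_combination -h2
    exact (mul_eq_zero.1 this).resolve_left hj'
  linear_combination hc x + hc0

theorem special_not_spherical {χ : Fˣ →* ℂˣ} (e : ρ.Equiv (twist F (steinberg F) χ)) {f : W}
    (hf : ∀ k ∈ K0 p F 0, ρ k f = f) : f = 0 := by
  obtain ⟨S, hSs, hS0, hS⟩ := exists_model F e
  obtain ⟨φ, rfl⟩ := hSs f
  rw [hS0]
  refine ⟨φ.1 1, fun g => ?_⟩
  have key : ∀ k t : GL (Fin 2) F, ∀ a d : Fˣ, g = t * k → t.1 1 0 = 0 → t.1 0 0 = a →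
      t.1 1 1 = d → k.1.det = 1 → k ∈ K0 p F 0 → φ.1 g = φ.1 1 := by
    intro k t a d h h0 h1 h2 hk hk0
    have h3 := apply_mul_of_det_eq_one p F hS0 hS hk0 hk (hf k hk0) t
    rw [h, h3, ← mul_one t, φ.2.1 t 1 a d h0 h1 h2, one_mul]
  have hr := max_pos F g
  rcases le_total ‖g.1 1 0‖ ‖g.1 1 1‖ with h | h
  · rw [max_eq_right h] at hr
    obtain ⟨t, e, h0, h1, h2⟩ := exists_lower_of_ne F g (norm_pos_iff.1 hr)
    refine key _ t _ _ e h0 h1 h2 (by simp [lower_val]) ?_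
    exact lower_mem_K0 p F (by rw [norm_div, pow_zero]; exact div_le_one_of_le₀ h (norm_nonneg _))
  · rw [max_eq_left h] at hr
    obtain ⟨t, e, h0, h1, h2⟩ := exists_swap_of_ne F g (norm_pos_iff.1 hr)
    refine key _ t _ _ e h0 h1 h2 (by simp [swap_val, upper_val])
      (mul_mem (swap_mem_K0 p F) ?_)
    exact upper_mem_K0 p F _ (by rw [norm_div]; exact div_le_one_of_le₀ h (norm_nonneg _))

/-- The new vector of a special representation, as a function. -/
theorem special_apply (hinert : ∀ x : F, x ≠ 0 → ∃ k : ℤ, ‖x‖ = (p : ℝ) ^ k) {χ : Fˣ →* ℂˣ}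
    {S : induced F (fun _ _ => 1) →ₗ[ℂ] W}
    (hS0 : ∀ ψ, S ψ = 0 ↔ ∃ c, ∀ x, ψ.1 x = c)
    (hS : ∀ g ψ, ρ g (S ψ) = (χ (Matrix.GeneralLinearGroup.det g) : ℂ) • S (inducedRep F _ g ψ))
    {φ : induced F (fun _ _ => 1)} (hf : ∀ k ∈ K0 p F 1, ρ k (S φ) = S φ) (g : GL (Fin 2) F) :
    φ.1 g = if ‖g.1 1 0‖ < ‖g.1 1 1‖ then φ.1 1 else φ.1 (swap F) := by
  have hp := one_lt_prime p
  have hr := max_pos F g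
  split_ifs with h
  · rw [max_eq_right h.le] at hr
    obtain ⟨t, e, h0, h1, h2⟩ := exists_lower_of_ne F g (norm_pos_iff.1 hr)
    have hk : lower F (g.1 1 0 / g.1 1 1) ∈ K0 p F 1 := by
      apply lower_mem_K0
      rw [norm_lt_iff p F hinert _ _ (norm_pos_iff.1 hr)] at h
      rwa [norm_div, pow_one, div_le_iff₀ hr, inv_mul_eq_div, le_div_iff₀ (by positivity)]
    have h3 := apply_mul_of_det_eq_one p F hS0 hS hk (by simp [lower_val]) (hf _ hk) t
    rw [← e] at h3
    rw [h3, ← mul_one t, φ.2.1 t 1 _ _ h0 h1 h2, one_mul]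
  · rw [max_eq_left (not_lt.1 h)] at hr
    obtain ⟨t, e, h0, h1, h2⟩ := exists_swap_of_ne F g (norm_pos_iff.1 hr)
    have hk : upper F (g.1 1 1 / g.1 1 0) ∈ K0 p F 1 := by
      apply upper_mem_K0
      rw [norm_div]
      exact div_le_one_of_le₀ (not_lt.1 h) (norm_nonneg _)
    have h3 := apply_mul_of_det_eq_one p F hS0 hS hk (by simp [upper_val]) (hf _ hk) (t * swap F)
    rw [mul_assoc, ← e] at h3
    rw [h3, φ.2.1 t _ _ _ h0 h1 h2, one_mul]

theorem swap_mul_dia (a d : Fˣ) : swap F * dia F a d = dia F d a * swap F := by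
  ext1
  rw [Units.val_mul, Units.val_mul, swap_val, dia_val, dia_val]
  simp

theorem det_dia (a d : Fˣ) : Matrix.GeneralLinearGroup.det (dia F a d) = a * d := by
  have := det_hecke F 0 a d
  rwa [upper_zero, one_mul] at this

theorem scalar_eq_dia (z : Fˣ) : Matrix.GeneralLinearGroup.scalar (Fin 2) z = dia F z z :=
  Units.ext (scalar_apply_eq F z)

theorem special_iwahori (hinert : ∀ x : F, x ≠ 0 → ∃ k : ℤ, ‖x‖ = (p : ℝ) ^ k)
    {D : Finset F} (hD : IsDigits p F D) {χ : Fˣ →* ℂˣ}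
    (e : ρ.Equiv (twist F (steinberg F) χ)) {f : W} (hf0 : f ≠ 0)
    (hz : ∀ z, ρ (Matrix.GeneralLinearGroup.scalar (Fin 2) z) f = f)
    (hf : ∀ k ∈ K0 p F 1, ρ k f = f) :
    (∀ u : Fˣ, ‖(u : F)‖ = 1 → χ u = 1) ∧ (∀ z, (χ z : ℂ) * χ z = 1) ∧
    ∑ b ∈ D, ρ (upper F b * dia F (primeF p F) 1) f = (χ (primeF p F) : ℂ) • f ∧
    ∀ ϖ : Fˣ, ‖(ϖ : F)‖ = (p : ℝ)⁻¹ → ρ (alMatrix F ϖ) f = -(χ ϖ : ℂ) • f := by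
  have hp := one_lt_prime p
  obtain ⟨S, hSs, hS0, hS⟩ := exists_model F e
  obtain ⟨φ, rfl⟩ := hSs f
  have hval := special_apply p F hinert hS0 hS hf
  set A := φ.1 1 with hA
  set A' := φ.1 (swap F) with hA'
  have hne : A ≠ A' := by
    intro h
    apply hf0
    rw [hS0]
    refine ⟨A, fun x => ?_⟩
    rw [hval, ← h, ite_self]
  have hdia : ∀ a d : Fˣ, φ.1 (dia F a d) = A := by
    intro a d
    rw [hval, if_pos]
    simp [dia_val]
  have hdia' : ∀ a d : Fˣ, φ.1 (swap F * dia F a d) = A' := by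
    intro a d
    rw [hval, if_neg]
    simp [swap_mul_dia, dia_val, swap_val]
  have hone : ∀ a d : Fˣ, ρ (dia F a d) (S φ) = S φ → χ (a * d) = 1 := by
    intro a d h
    obtain ⟨c, hc⟩ := apply_mul_of_fixed F hS0 hS h
    have h1 := hc 1
    have h2 := hc (swap F)
    rw [one_mul, hdia, ← hA, det_dia] at h1
    rw [hdia', ← hA', det_dia] at h2
    have h3 : ((χ (a * d) : ℂ) - 1) * (A - A') = 0 := by linear_combination h1 - h2
    have h4 := (mul_eq_zero.1 h3).resolve_right (sub_ne_zero.2 hne)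
    ext1
    exact sub_eq_zero.1 h4
  refine ⟨fun u hu => ?_, fun z => ?_, ?_, fun ϖ hϖ => ?_⟩
  · have := hone u 1 (hf _ (dia_mem_K0 p F 1 hu (by simp)))
    rwa [mul_one] at this
  · have := hone z z (by rw [← scalar_eq_dia]; exact hz z)
    rw [map_mul] at this
    rw [← Units.val_mul, this, Units.val_one]
  · rw [← sub_eq_zero]
    simp only [hS, det_hecke, mul_one, ← map_smul]
    rw [← map_sum, ← map_sub, hS0]
    refine ⟨(χ (primeF p F) : ℂ) * (((p : ℂ) ^ 2 - 1) * A), fun x => ?_⟩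
    simp only [Submodule.coe_sub, Submodule.coe_smul, AddSubmonoidClass.coe_finsetSum, Pi.sub_apply,
      Finset.sum_apply, Pi.smul_apply, smul_eq_mul]
    change ∑ b ∈ D, (χ (primeF p F) : ℂ) * φ.1 (x * (upper F b * dia F (primeF p F) 1)) - _ = _
    rw [← Finset.mul_sum, ← mul_sub]
    congr 1
    have hx : ∀ b, φ.1 (x * (upper F b * dia F (primeF p F) 1))
        = if ‖x.1 1 0‖ * (p : ℝ)⁻¹ < ‖x.1 1 0 * b + x.1 1 1‖ then A else A' := by
      intro b
      rw [hval, (mul_hecke_val F x b _ _).1, (mul_hecke_val F x b _ _).2, norm_mul, primeF_val,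
        norm_prime, Units.val_one, one_mul, mul_comm (p : ℝ)⁻¹]
    simp only [hx]
    have hr := max_pos F x
    set c := x.1 1 0
    set d := x.1 1 1
    rw [hval x]
    rcases lt_or_ge ‖c‖ ‖d‖ with h | h
    · rw [if_pos h, Finset.sum_congr rfl (g := fun _ => A), Finset.sum_const, hD.card, nsmul_eq_mul]
      · push_cast
        ring
      · intro b hb
        have h1 : ‖c * b‖ < ‖d‖ := by
          rw [norm_mul]
          exact (mul_le_of_le_one_right (norm_nonneg _) (hD.norm_le b hb)).trans_lt h
        rw [norm_add_eq_of_lt F h1, if_pos]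
        exact (mul_le_of_le_one_right (norm_nonneg _) (inv_le_one_of_one_le₀ hp.le)).trans_lt h
    · rw [max_eq_left h] at hr
      rw [if_neg (not_lt.2 h), sum_digits_of_le p F hD c d (norm_pos_iff.1 hr) h _ A A']
      · ring
      · intro b _ hb
        rw [hb, if_pos]
        exact mul_lt_of_lt_one_right hr (inv_lt_one_of_one_lt₀ hp)
      · intro b _ hb
        rw [if_neg]
        rw [norm_lt_iff p F hinert _ _ (norm_pos_iff.1 hr)] at hb
        rwa [not_lt, ← div_eq_mul_inv, le_div_iff₀ (by positivity)]
  · have hdet : Matrix.GeneralLinearGroup.det (alMatrix F ϖ) = ϖ := by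
      ext1
      change (alMatrix F ϖ).1.det = _
      rw [alMatrix_val, Matrix.det_fin_two_of]
      ring
    rw [← sub_eq_zero, hS, hdet, ← map_smul S, ← map_smul S, ← map_sub S, hS0]
    refine ⟨(χ ϖ : ℂ) * (A + A'), fun x => ?_⟩
    change (χ ϖ : ℂ) * φ.1 (x * alMatrix F ϖ) - -(χ ϖ : ℂ) * φ.1 x = _
    have h0 : (x * alMatrix F ϖ).1 1 0 = -(ϖ * x.1 1 1) := by
      rw [Units.val_mul, alMatrix_val, Matrix.mul_apply, Fin.sum_univ_two]
      simp [mul_comm]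
    have h1 : (x * alMatrix F ϖ).1 1 1 = x.1 1 0 := by
      rw [Units.val_mul, alMatrix_val, Matrix.mul_apply, Fin.sum_univ_two]
      simp
    rw [hval x, hval (x * alMatrix F ϖ), h0, h1, norm_neg, norm_mul, hϖ]
    have hr := max_pos F x
    rcases lt_or_ge ‖x.1 1 0‖ ‖x.1 1 1‖ with h | h
    · rw [if_pos h, if_neg]
      · ring
      · rw [max_eq_right h.le] at hr
        rw [norm_lt_iff p F hinert _ _ (norm_pos_iff.1 hr)] at h
        rwa [not_lt, inv_mul_eq_div, le_div_iff₀ (by positivity)]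
    · rw [if_neg (not_lt.2 h), if_pos]
      · ring
      · rw [max_eq_left h] at hr
        rcases (norm_nonneg (x.1 1 1)).eq_or_lt with h2 | h2
        · rw [← h2, mul_zero]
          exact hr
        · exact (mul_lt_of_lt_one_left h2 (inv_lt_one_of_one_lt₀ hp)).trans_le h

end Special

end AsaiZeta

namespace AsaiZeta

noncomputable section Coefficients

set_option linter.unusedSectionVars false

variable (p : ℕ) [Fact p.Prime]
variable (F : Type*) [NormedField F] [NormedAlgebra ℚ_[p] F] [Algebra.IsQuadraticExtension ℚ_[p] F]
  [IsUltrametricDist F]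

variable {W : Type*} [AddCommGroup W] [Module ℂ W] (ρ : Representation ℂ (GL (Fin 2) F) W)
  (B : W →ₗ[ℂ] W →ₗ⋆[ℂ] ℂ)

/-- The value of a matrix coefficient at `diag(p ^ m, 1)`. -/
def torusCoeff (f : W) (m : ℕ) : ℂ := B (ρ (dia F (primeF p F ^ m) 1) f) f

variable {ρ B}

theorem torusCoeff_zero {f : W} (hBf : B f f = 1) : torusCoeff p F ρ B f 0 = 1 := by
  have h : dia F (primeF p F ^ 0) 1 = 1 := by
    ext1
    rw [dia_val, pow_zero, Units.val_one, Units.val_one, Matrix.one_fin_two]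
  rw [torusCoeff, h, map_one, Module.End.one_apply, hBf]

theorem dia_mul_hecke (m : ℕ) (b : F) : dia F (primeF p F ^ m) 1 *
    (upper F b * dia F (primeF p F) 1) = upper F (p ^ m * b) * dia F (primeF p F ^ (m + 1)) 1 := by
  ext1
  simp only [Units.val_mul, dia_val, upper_val]
  simp [primeF_val, pow_succ]

theorem apply_dia_hecke (hB : IsInvariantForm ρ B) {n : ℕ} {f : W} (hf : ∀ k ∈ K0 p F n, ρ k f = f)
    (m : ℕ) {b : F} (hb : ‖b‖ ≤ 1) :
    B (ρ (dia F (primeF p F ^ m) 1) (ρ (upper F b * dia F (primeF p F) 1) f)) f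
      = torusCoeff p F ρ B f (m + 1) := by
  rw [← Module.End.mul_apply, ← map_mul, dia_mul_hecke, map_mul, Module.End.mul_apply,
    hB.apply_left_of_fixed (hf _ (upper_mem_K0 p F n _)), torusCoeff]
  rw [norm_mul, norm_prime_pow]
  exact mul_le_one₀ (inv_prime_pow_le_one p m) (norm_nonneg _) hb

theorem torusCoeff_of_iwahori_hecke (hB : IsInvariantForm ρ B) {D : Finset F} (hD : IsDigits p F D)
    {f : W} (hBf : B f f = 1) (hf : ∀ k ∈ K0 p F 1, ρ k f = f) {c : ℂ}
    (hc : ∑ b ∈ D, ρ (upper F b * dia F (primeF p F) 1) f = c • f) (m : ℕ) :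
    torusCoeff p F ρ B f m = (c / p ^ 2) ^ m := by
  have hp0 : (p : ℂ) ≠ 0 := by exact_mod_cast (Fact.out : p.Prime).ne_zero
  induction m with
  | zero => rw [torusCoeff_zero p F hBf, pow_zero]
  | succ m ih =>
    have h1 := congrArg (fun v => B (ρ (dia F (primeF p F ^ m) 1) v) f) hc
    simp only [map_sum, map_smul, LinearMap.sum_apply, LinearMap.smul_apply] at h1
    rw [Finset.sum_congr rfl fun b hb => apply_dia_hecke p F hB hf m (hD.norm_le b hb),
      Finset.sum_const, hD.card, nsmul_eq_mul] at h1
    change _ = c • torusCoeff p F ρ B f m at h1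
    rw [ih, smul_eq_mul] at h1
    push_cast at h1
    rw [pow_succ', div_mul_eq_mul_div, ← h1]
    field_simp

theorem dia_mul_dia (a d a' d' : Fˣ) : dia F a d * dia F a' d' = dia F (a * a') (d * d') := by
  ext1
  simp only [Units.val_mul, dia_val]
  simp

section Spherical

variable {f : W} {D : Finset F} {c : ℂ}

theorem apply_spherical_hecke (hB : IsInvariantForm ρ B) (hD : IsDigits p F D)
    (hf : ∀ k ∈ K0 p F 0, ρ k f = f)
    (hc : ∑ b ∈ D, ρ (upper F b * dia F (primeF p F) 1) f + ρ (dia F 1 (primeF p F)) f = c • f)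
    (m : ℕ) : (p : ℂ) ^ 2 * torusCoeff p F ρ B f (m + 1)
      + B (ρ (dia F (primeF p F ^ m) (primeF p F)) f) f = c * torusCoeff p F ρ B f m := by
  have h1 := congrArg (fun v => B (ρ (dia F (primeF p F ^ m) 1) v) f) hc
  simp only [map_add, map_sum, map_smul, LinearMap.add_apply, LinearMap.sum_apply,
    LinearMap.smul_apply] at h1
  rw [Finset.sum_congr rfl fun b hb => apply_dia_hecke p F hB hf m (hD.norm_le b hb),
    Finset.sum_const, hD.card, nsmul_eq_mul, ← Module.End.mul_apply, ← map_mul, dia_mul_dia,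
    one_mul, mul_one] at h1
  exact_mod_cast h1

theorem torusCoeff_add_two (hB : IsInvariantForm ρ B) (hD : IsDigits p F D)
    (hf : ∀ k ∈ K0 p F 0, ρ k f = f)
    (hz : ∀ z v, ρ (Matrix.GeneralLinearGroup.scalar (Fin 2) z) v = v)
    (hc : ∑ b ∈ D, ρ (upper F b * dia F (primeF p F) 1) f + ρ (dia F 1 (primeF p F)) f = c • f)
    (m : ℕ) : (p : ℂ) ^ 2 * torusCoeff p F ρ B f (m + 2) + torusCoeff p F ρ B f m
      = c * torusCoeff p F ρ B f (m + 1) := by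
  have h1 : dia F (primeF p F ^ (m + 1)) (primeF p F)
      = Matrix.GeneralLinearGroup.scalar (Fin 2) (primeF p F) * dia F (primeF p F ^ m) 1 := by
    rw [scalar_eq_dia, dia_mul_dia, pow_succ', mul_one]
  have h2 : B (ρ (dia F (primeF p F ^ (m + 1)) (primeF p F)) f) f = torusCoeff p F ρ B f m := by
    rw [h1, map_mul, Module.End.mul_apply, hz]
    rfl
  rw [← h2, apply_spherical_hecke p F hB hD hf hc (m + 1)]

theorem apply_dia_one (hB : IsInvariantForm ρ B) (hf : ∀ k ∈ K0 p F 0, ρ k f = f) :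
    B (ρ (dia F 1 (primeF p F)) f) f = torusCoeff p F ρ B f 1 := by
  have h1 : dia F 1 (primeF p F) = (swap F)⁻¹ * (dia F (primeF p F ^ 1) 1 * swap F) := by
    rw [pow_one, eq_inv_mul_iff_mul_eq, swap_mul_dia]
  have h2 := hf _ (swap_mem_K0 p F)
  rw [h1, map_mul, map_mul, Module.End.mul_apply, Module.End.mul_apply, h2,
    hB.apply_left_of_fixed (apply_inv_of_fixed h2), torusCoeff]

theorem torusCoeff_one (hB : IsInvariantForm ρ B) (hD : IsDigits p F D)
    (hBf : B f f = 1) (hf : ∀ k ∈ K0 p F 0, ρ k f = f)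
    (hc : ∑ b ∈ D, ρ (upper F b * dia F (primeF p F) 1) f + ρ (dia F 1 (primeF p F)) f = c • f) :
    ((p : ℂ) ^ 2 + 1) * torusCoeff p F ρ B f 1 = c := by
  have h1 := apply_spherical_hecke p F hB hD hf hc 0
  rw [pow_zero, apply_dia_one p F hB hf, torusCoeff_zero p F hBf] at h1
  linear_combination h1

theorem torusCoeff_one_im (hB : IsInvariantForm ρ B) (hf : ∀ k ∈ K0 p F 0, ρ k f = f)
    (hz : ∀ z v, ρ (Matrix.GeneralLinearGroup.scalar (Fin 2) z) v = v) :
    (torusCoeff p F ρ B f 1).im = 0 := by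
  rw [← Complex.conj_eq_iff_im, torusCoeff, ← hB.symm]
  have h1 : dia F 1 (primeF p F)
      = (dia F (primeF p F ^ 1) 1)⁻¹ * Matrix.GeneralLinearGroup.scalar (Fin 2) (primeF p F) := by
    rw [eq_inv_mul_iff_mul_eq, scalar_eq_dia, dia_mul_dia, pow_one, one_mul, mul_one]
  have h2 := apply_dia_one p F hB hf
  rw [h1, map_mul, Module.End.mul_apply, hz, hB.apply_left, inv_inv] at h2
  exact h2

end Spherical

theorem eq_norm_sq_of_prime (hinert : ∀ x : F, x ≠ 0 → ∃ k : ℤ, ‖x‖ = (p : ℝ) ^ k) {ψ : Fˣ →* ℂˣ}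
    (hψ : ∀ u : Fˣ, ‖(u : F)‖ = 1 → ψ u = 1) (h : (ψ (primeF p F) : ℂ) = ((p : ℂ) ^ 2)⁻¹)
    (x : Fˣ) : (ψ x : ℂ) = ((‖(x : F)‖ ^ 2 : ℝ) : ℂ) := by
  obtain ⟨k, hk⟩ := hinert x x.ne_zero
  have h1 : ‖(x : F)‖ = ‖((primeF p F ^ (-k) : Fˣ) : F)‖ := by
    rw [Units.val_zpow_eq_zpow_val, norm_zpow, primeF_val, norm_prime, hk, inv_zpow', neg_neg]
  rw [eq_of_norm_eq hψ h1, map_zpow, Units.val_zpow_eq_zpow_val, h, hk, inv_zpow', neg_neg]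
  push_cast
  rw [← zpow_natCast, ← zpow_natCast, zpow_comm]

theorem principal_parameters (hinert : ∀ x : F, x ≠ 0 → ∃ k : ℤ, ‖x‖ = (p : ℝ) ^ k)
    {D : Finset F} (hD : IsDigits p F D) {μ ν : Fˣ →* ℂˣ}
    (hμ : ∀ u : Fˣ, ‖(u : F)‖ = 1 → μ u = 1) (hν : ∀ u : Fˣ, ‖(u : F)‖ = 1 → ν u = 1)
    (h₁ : ¬ ∀ x : Fˣ, ((μ x / ν x : ℂˣ) : ℂ) = (absF p F x : ℂ))
    (h₂ : ¬ ∀ x : Fˣ, ((μ x / ν x : ℂˣ) : ℂ) = ((absF p F x)⁻¹ : ℂ))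
    (e : ρ.Equiv (principalSeries p F μ ν)) (hB : IsInvariantForm ρ B) {f : W} (hf0 : f ≠ 0)
    (hBf : B f f = 1) (hf : ∀ k ∈ K0 p F 0, ρ k f = f)
    (hz : ∀ z v, ρ (Matrix.GeneralLinearGroup.scalar (Fin 2) z) v = v) :
    ‖(μ (primeF p F) : ℂ) / p‖ < 1 ∧ ‖(ν (primeF p F) : ℂ) / p‖ < 1 := by
  have hp := one_lt_prime p
  have hpp : (0 : ℝ) < p := by linarith
  have hp0 : (p : ℂ) ≠ 0 := by exact_mod_cast (Fact.out : p.Prime).ne_zero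
  have hc := hecke_of_principal p F hinert hD hμ hν e hf
  have h1 := torusCoeff_one p F hB hD hBf hf hc
  have h2 := torusCoeff_one_im p F hB hf hz
  have h3 : ‖torusCoeff p F ρ B f 1‖ ≤ 1 := hB.norm_le_one hBf _
  have h4 := mul_eq_one_of_principal p F e hf0 (primeF p F) (hz _ _)
  have hdiv : ∀ x, ((μ x / ν x : ℂˣ) : ℂ) = ((μ / ν) x : ℂˣ) := fun x => rfl
  simp only [absF_eq, hdiv] at h₁ h₂
  set α : ℂ := ((μ (primeF p F) : ℂˣ) : ℂ)
  set β : ℂ := ((ν (primeF p F) : ℂˣ) : ℂ)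
  have hα0 : α ≠ 0 := left_ne_zero_of_mul_eq_one h4
  have hβ0 : β ≠ 0 := right_ne_zero_of_mul_eq_one h4
  have hsum : α + β = (((p : ℝ) ^ 2 + 1) / p : ℝ) * torusCoeff p F ρ B f 1 := by
    push_cast
    field_simp
    linear_combination -h1
  have him : (α + β).im = 0 := by
    rw [hsum, Complex.im_ofReal_mul, h2, mul_zero]
  have hnorm : ‖α + β‖ ≤ p + (p : ℝ)⁻¹ := by
    rw [hsum, norm_mul, Complex.norm_real, Real.norm_of_nonneg (by positivity)]
    refine (mul_le_of_le_one_right (by positivity) h3).trans (le_of_eq ?_)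
    field_simp
  have key : ∀ a : ℂ, a ≠ 0 → (a + a⁻¹).im = 0 → ‖a + a⁻¹‖ ≤ p + (p : ℝ)⁻¹ → a ^ 2 ≠ p ^ 2 →
      ‖a / p‖ < 1 := by
    intro a ha0 ha hn hne
    rw [norm_div, Complex.norm_natCast, div_lt_one hpp]
    rcases norm_le_of_add_inv hp.le ha0 ha hn with h | ⟨h, h'⟩
    · rw [h]
      exact hp
    · refine lt_of_le_of_ne h fun h5 => hne ?_
      have h6 : a = (a.re : ℂ) := by
        apply Complex.ext <;> simp [h']
      have h7 : a.re ^ 2 = (p : ℝ) ^ 2 := by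
        rw [← h5, h6, Complex.norm_real, Real.norm_eq_abs, sq_abs, Complex.ofReal_re]
      rw [h6]
      exact_mod_cast congrArg (fun r : ℝ => (r : ℂ)) h7
  have hu : ∀ u : Fˣ, ‖(u : F)‖ = 1 → (μ / ν) u = 1 := by
    intro u hu
    rw [MonoidHom.div_apply, hμ u hu, hν u hu, div_one]
  have hval : (((μ / ν) (primeF p F) : ℂˣ) : ℂ) = α / β := by
    rw [MonoidHom.div_apply, Units.val_div_eq_div_val]
  have hβα : β = α⁻¹ := eq_inv_of_mul_eq_one_right h4
  have hαβ : α = β⁻¹ := eq_inv_of_mul_eq_one_left h4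
  constructor
  · refine key α hα0 (hβα ▸ him) (hβα ▸ hnorm) fun hsq => h₂ fun x => ?_
    have h5 := eq_norm_sq_of_prime p F hinert (ψ := (μ / ν)⁻¹) (fun u h => by
      rw [MonoidHom.inv_apply, hu u h, inv_one]) (by
      rw [MonoidHom.inv_apply, Units.val_inv_eq_inv_val, hval, hβα, div_inv_eq_mul, ← sq, hsq]) x
    rw [← h5, MonoidHom.inv_apply, Units.val_inv_eq_inv_val, inv_inv]
  · refine key β hβ0 ?_ ?_ fun hsq => h₁ fun x => ?_
    · rw [← hαβ, add_comm]; exact him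
    · rw [← hαβ, add_comm]; exact hnorm
    · refine eq_norm_sq_of_prime p F hinert hu ?_ x
      rw [hval, hαβ, div_eq_mul_inv, ← sq, inv_pow, hsq]

end Coefficients

noncomputable section Integrand

set_option linter.unusedSectionVars false

variable (p : ℕ) [Fact p.Prime]
variable (F : Type*) [NormedField F] [NormedAlgebra ℚ_[p] F] [Algebra.IsQuadraticExtension ℚ_[p] F]
  [IsUltrametricDist F]

variable {W : Type*} [AddCommGroup W] [Module ℂ W] {π : Representation ℂ (PGL(2, F)) W}
  {B : W →ₗ[ℂ] W →ₗ⋆[ℂ] ℂ}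

theorem IsInvariantForm.sigma (hB : IsInvariantForm π B) : IsInvariantForm (sigma p F π) B :=
  ⟨fun _ => hB.invariant _, hB.symm, hB.pos⟩

theorem IsInvariantForm.toGL (hB : IsInvariantForm π B) : IsInvariantForm (toGL F π) B :=
  ⟨fun _ => hB.invariant _, hB.symm, hB.pos⟩

theorem toGL_scalar (z : Fˣ) (v : W) :
    toGL F π (Matrix.GeneralLinearGroup.scalar (Fin 2) z) v = v := by
  have h : Matrix.ProjGenLinGroup.mk (Matrix.GeneralLinearGroup.scalar (Fin 2) z) = 1 :=
    Matrix.ProjGenLinGroup.mk_scalar z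
  rw [AsaiZeta.toGL, MonoidHom.comp_apply, h, map_one, Module.End.one_apply]

theorem sigma_of_mem_openCompact {n : ℕ} {f : W} (hf : ∀ k ∈ K0 p F n, toGL F π k f = f)
    {u : H10 p F} (hu : u ∈ openCompact p F n) : sigma p F π u.1 f = f := by
  obtain ⟨g, α, hg, rfl, hk⟩ := exists_of_mem_openCompact p F hu
  exact hf g hk

theorem zetaIntegrand_mul_left {n : ℕ} {f : W} (dx : Measure (X p F))
    [dx.IsAddHaarMeasure] {u : H10 p F} (hu : u.1 ∈ latticeStabilizer p F n) {ε : ℂ}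
    (hf : ∀ v, B (sigma p F π u.1 v) f = ε * B v f) (h : H10 p F) :
    zetaIntegrand p F dx π B (phiStar p F n) f (u * h)
      = ε * zetaIntegrand p F dx π B (phiStar p F n) f h := by
  rw [zetaIntegrand, zetaIntegrand, weilPairing_eq_overlap, weilPairing_eq_overlap,
    Subgroup.coe_mul, overlap_mul_left p F hu, map_mul, Module.End.mul_apply, hf]
  ring

theorem zetaIntegrand_mul_right {n : ℕ} {f : W} (dx : Measure (X p F))
    {u : H10 p F} (hu : u.1 ∈ latticeStabilizer p F n) {ε : ℂ}
    (hf : sigma p F π u.1 f = ε • f) (h : H10 p F) :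
    zetaIntegrand p F dx π B (phiStar p F n) f (h * u)
      = ε * zetaIntegrand p F dx π B (phiStar p F n) f h := by
  rw [zetaIntegrand, zetaIntegrand, weilPairing_eq_overlap, weilPairing_eq_overlap,
    Subgroup.coe_mul, overlap_mul_right p F hu, map_mul, Module.End.mul_apply, hf, map_smul,
    map_smul, LinearMap.smul_apply, smul_eq_mul]
  ring

theorem zetaIntegrand_openCompact_mul (hB : IsInvariantForm π B) {n : ℕ} {f : W}
    (hf : ∀ k ∈ K0 p F n, toGL F π k f = f) (dx : Measure (X p F))
    [dx.IsAddHaarMeasure] {u : H10 p F} (hu : u ∈ openCompact p F n) (h : H10 p F) :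
    zetaIntegrand p F dx π B (phiStar p F n) f (u * h)
      = zetaIntegrand p F dx π B (phiStar p F n) f h := by
  have h1 := zetaIntegrand_mul_left p F (π := π) dx (openCompact_mem_latticeStabilizer p F u hu) (ε := 1)
    (fun v => by
      rw [(hB.sigma p F).apply_left_of_fixed (sigma_of_mem_openCompact p F hf hu), one_mul]) h
  rwa [one_mul] at h1

theorem zetaIntegrand_mul_openCompact {n : ℕ} {f : W}
    (hf : ∀ k ∈ K0 p F n, toGL F π k f = f) (dx : Measure (X p F))
    {u : H10 p F} (hu : u ∈ openCompact p F n) (h : H10 p F) :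
    zetaIntegrand p F dx π B (phiStar p F n) f (h * u)
      = zetaIntegrand p F dx π B (phiStar p F n) f h := by
  have h1 := zetaIntegrand_mul_right p F (B := B) dx (openCompact_mem_latticeStabilizer p F u hu)
    (ε := 1) (by rw [sigma_of_mem_openCompact p F hf hu, one_smul]) h
  rwa [one_mul] at h1

theorem upperH_mem_openCompact (n : ℕ) {b : F} (hb : ‖b‖ ≤ 1) : upperH p F b ∈ openCompact p F n :=
  mkH_mem_openCompact p F (upper_mem_K0 p F n hb) _ _

theorem zetaIntegrand_torusH (hinert : ∀ x : F, x ≠ 0 → ∃ k : ℤ, ‖x‖ = (p : ℝ) ^ k)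
    (dx : Measure (X p F)) [dx.IsAddHaarMeasure] (hdx : IsSelfDual p F dx) {n : ℕ} (hn : n ≤ 1)
    (f : W) (m : ℕ) : zetaIntegrand p F dx π B (phiStar p F n) f (torusH p F m)
      = (p : ℂ)⁻¹ ^ (2 * m) * (p : ℂ)⁻¹ ^ (2 * n) * torusCoeff p F (toGL F π) B f m := by
  rw [zetaIntegrand, weilPairing_eq_overlap, overlap_torusH_eq p F hinert dx hdx hn]
  push_cast
  rfl

theorem zetaIntegrand_cell (hB : IsInvariantForm π B)
    (hinert : ∀ x : F, x ≠ 0 → ∃ k : ℤ, ‖x‖ = (p : ℝ) ^ k) {D : Finset F} (hD : IsDigits p F D)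
    (dx : Measure (X p F)) [dx.IsAddHaarMeasure] (hdx : IsSelfDual p F dx) {n : ℕ} (hn : n ≤ 1)
    {f : W} (hf : ∀ k ∈ K0 p F n, toGL F π k f = f) {A : ℕ → Set (H10 p F)}
    (hA : IsStepSeq p F D A) (h0 : A 0 = openCompact p F n) {m : ℕ} {h : H10 p F} (hm : h ∈ A m) :
    zetaIntegrand p F dx π B (phiStar p F n) f h
      = (p : ℂ)⁻¹ ^ (2 * m) * (p : ℂ)⁻¹ ^ (2 * n) * torusCoeff p F (toGL F π) B f m := by
  obtain ⟨b, hb, u, hu, rfl⟩ := hA.exists_eq hD hm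
  rw [h0] at hu
  rw [zetaIntegrand_mul_openCompact p F hf dx hu, zetaIntegrand_openCompact_mul p F hB hf dx
    (upperH_mem_openCompact p F n hb), zetaIntegrand_torusH p F hinert dx hdx hn]

theorem zetaIntegrand_flip_cell (hB : IsInvariantForm π B)
    (hinert : ∀ x : F, x ≠ 0 → ∃ k : ℤ, ‖x‖ = (p : ℝ) ^ k) {D : Finset F} (hD : IsDigits p F D)
    (dx : Measure (X p F)) [dx.IsAddHaarMeasure] (hdx : IsSelfDual p F dx)
    {f : W} (hf : ∀ k ∈ K0 p F 0, toGL F π k f = f) {A : ℕ → Set (H10 p F)}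
    (hA : IsStepSeq p F D A) (h0 : A 0 = openCompact p F 0) {m : ℕ} {h : H10 p F}
    (hm : (swapH p F * torusH p F 1)⁻¹ * h ∈ A m) :
    zetaIntegrand p F dx π B (phiStar p F 0) f h
      = (p : ℂ)⁻¹ ^ (2 * (m + 1)) * (p : ℂ)⁻¹ ^ (2 * 0)
        * torusCoeff p F (toGL F π) B f (m + 1) := by
  obtain ⟨b, hb, u, hu, e⟩ := hA.exists_eq hD hm
  rw [h0] at hu
  have e' : h = swapH p F * upperH p F (p * b) * torusH p F (m + 1) * u := by
    rw [inv_mul_eq_iff_eq_mul] at e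
    rw [e, add_comm m 1, ← torusH_mul_torusH, mul_assoc (swapH p F) (upperH p F _),
      ← mul_assoc (upperH p F _) (torusH p F 1), ← torusH_one_mul_upperH]
    simp only [mul_assoc]
  have hb' : ‖(p : F) * b‖ ≤ 1 := by
    rw [norm_mul, norm_prime]
    exact mul_le_one₀ (inv_le_one_of_one_le₀ (one_lt_prime p).le) (norm_nonneg _) hb
  rw [e', zetaIntegrand_mul_openCompact p F hf dx hu, zetaIntegrand_openCompact_mul p F hB hf dx
    (mul_mem (swapH_mem_openCompact p F) (upperH_mem_openCompact p F 0 hb')),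
    zetaIntegrand_torusH p F hinert dx hdx zero_le_one]

end Integrand

end AsaiZeta

namespace AsaiZeta

noncomputable section LFactors

set_option linter.unusedSectionVars false

variable (p : ℕ) [Fact p.Prime]
variable (F : Type*) [NormedField F] [NormedAlgebra ℚ_[p] F] [Algebra.IsQuadraticExtension ℚ_[p] F]

theorem charL_padic {χ : ℚ_[p]ˣ → ℂ} (h : ∀ u : ℚ_[p]ˣ, ‖(u : ℚ_[p])‖ = 1 → χ u = 1) (s : ℂ) :
    charL p ℚ_[p] χ s = (1 - χ (primeUnit p) * (p : ℂ) ^ (-s))⁻¹ := by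
  rw [charL, if_pos h, Module.finrank_self, pow_one]
  rfl

theorem incl_primeUnit : incl p F (primeUnit p) = primeF p F := by
  ext1
  change algebraMap ℚ_[p] F p = p
  rw [map_natCast]

theorem charL_quadratic {χ : Fˣ → ℂ} (h : ∀ u : Fˣ, ‖(u : F)‖ = 1 → χ u = 1) (s : ℂ) :
    charL p F χ s = (1 - χ (primeF p F) * ((p : ℂ) ^ 2) ^ (-s))⁻¹ := by
  rw [charL, if_pos h, Algebra.IsQuadraticExtension.finrank_eq_two, ← incl_primeUnit]
  rfl

theorem norm_incl (u : ℚ_[p]ˣ) : ‖(incl p F u : F)‖ = ‖(u : ℚ_[p])‖ := norm_algebraMap' F _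

theorem zetaP_natCast (k : ℕ) : zetaP p k = (1 - ((p : ℂ) ^ k)⁻¹)⁻¹ := by
  rw [zetaP, Complex.cpow_neg, Complex.cpow_natCast]

theorem one_sub_inv_prime_pow_ne_zero {k : ℕ} (hk : k ≠ 0) : (1 - ((p : ℂ) ^ k)⁻¹) ≠ 0 := by
  have hp := one_lt_prime p
  intro h
  have h1 : (p : ℂ) ^ k = 1 := inv_eq_one.1 (sub_eq_zero.1 h).symm
  have h2 : (p : ℝ) ^ k = 1 := by exact_mod_cast h1
  exact (one_lt_pow₀ hp hk).ne' h2

theorem charL_padic_incl_one {μ : Fˣ →* ℂˣ} (hμ : ∀ u : Fˣ, ‖(u : F)‖ = 1 → μ u = 1) :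
    charL p ℚ_[p] (fun x => (μ (incl p F x) : ℂ)) 1 = (1 - (μ (primeF p F) : ℂ) / p)⁻¹ := by
  rw [charL_padic, incl_primeUnit, Complex.cpow_neg_one, div_eq_mul_inv]
  intro u hu
  rw [hμ _ (by rw [norm_incl, hu]), Units.val_one]

end LFactors

noncomputable section Zeta

variable (p : ℕ) [Fact p.Prime]
variable (F : Type*) [NormedField F] [NormedAlgebra ℚ_[p] F] [Algebra.IsQuadraticExtension ℚ_[p] F]
  [IsUltrametricDist F]

variable {V : Type*} [AddCommGroup V] [Module ℂ V] {π : Representation ℂ (PGL(2, F)) V}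
  {B : V →ₗ[ℂ] V →ₗ⋆[ℂ] ℂ}

theorem zetaIntegral_spherical (hinert : ∀ x : F, x ≠ 0 → ∃ k : ℤ, ‖x‖ = (p : ℝ) ^ k)
    (dh : Measure (H10 p F)) [dh.IsHaarMeasure]
    (dx : Measure (X p F)) [dx.IsAddHaarMeasure] (hdx : IsSelfDual p F dx)
    {L : ℂ → ℂ} (hL : IsAsaiL p F π L) {f : V} (hf : IsNewVector p F π 0 f)
    (hB : IsInvariantForm π B) (hBf : B f f = 1) :
    Integrable (zetaIntegrand p F dx π B (phiStar p F 0) f) dh ∧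
      zetaIntegral p F dh dx π B (phiStar p F 0) f
        = dh.real (openCompact p F 0 : Set (H10 p F)) * (L 1 / (zetaP p 2 * zetaP p 4)) := by
  have hp0 : (p : ℂ) ≠ 0 := by exact_mod_cast (Fact.out : p.Prime).ne_zero
  obtain ⟨D, hD⟩ := exists_isDigits p F hinert
  cases hL with
  | special χ hχ e => exact absurd (special_not_spherical p F e.some hf.fixed) hf.ne_zero
  | principal μ ν hμ hν h₁ h₂ e =>
    obtain ⟨e⟩ := e
    have hz := toGL_scalar F (π := π)
    have hB' := hB.toGL F
    obtain ⟨hr, hs⟩ := principal_parameters p F hinert hD hμ hν h₁ h₂ e hB' hf.ne_zero hBf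
      hf.fixed hz
    have hc := hecke_of_principal p F hinert hD hμ hν e hf.fixed
    have hrec := torusCoeff_add_two p F hB' hD hf.fixed hz hc
    have hu1 := torusCoeff_one p F hB' hD hBf hf.fixed hc
    have hu0 := torusCoeff_zero p F (ρ := toGL F π) hBf
    have hαβ := mul_eq_one_of_principal p F e hf.ne_zero (primeF p F) (hz _ _)
    have hμν : charL p F (fun x => (μ x : ℂ) * ν x) 1 = (1 - ((p : ℂ) ^ 2)⁻¹)⁻¹ := by
      rw [charL_quadratic, hαβ, Complex.cpow_neg_one, one_mul]
      intro u hu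
      rw [hμ u hu, hν u hu, Units.val_one, one_mul]
    beta_reduce
    rw [charL_padic_incl_one p F hμ, charL_padic_incl_one p F hν, hμν]
    set u := torusCoeff p F (toGL F π) B f
    set α : ℂ := ((μ (primeF p F) : ℂˣ) : ℂ)
    set β : ℂ := ((ν (primeF p F) : ℂˣ) : ℂ)
    have hrec' : ∀ m, u (m + 2) = (α / p + β / p) * u (m + 1) - α / p * (β / p) * u m := by
      intro m
      have := hrec m
      field_simp
      linear_combination this + u m * hαβ
    have hsum := summable_of_recursion hr hs hrec'
    have htsum := tsum_of_recursion hr hs hrec'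
    have hv : ∀ m : ℕ, ((p : ℂ) ^ 2) ^ m * ((p : ℂ)⁻¹ ^ (2 * m) * (p : ℂ)⁻¹ ^ (2 * 0) * u m)
        = u m := by
      intro m
      rw [mul_zero, pow_zero, mul_one, ← mul_assoc, pow_mul, ← mul_pow, ← mul_pow,
        mul_inv_cancel₀ hp0, one_pow, one_pow, one_mul]
    have hv' : ∀ m : ℕ, ((p : ℂ) ^ 2) ^ m
        * ((p : ℂ)⁻¹ ^ (2 * (m + 1)) * (p : ℂ)⁻¹ ^ (2 * 0) * u (m + 1))
        = ((p : ℂ) ^ 2)⁻¹ * u (m + 1) := by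
      intro m
      rw [eq_inv_mul_iff_mul_eq₀ (pow_ne_zero 2 hp0), ← mul_assoc, ← pow_succ', hv]
    have key := integral_spherical p F hD hinert dh
      (zetaIntegrand p F dx π B (phiStar p F 0) f)
      (fun m => (p : ℂ)⁻¹ ^ (2 * m) * (p : ℂ)⁻¹ ^ (2 * 0) * u m)
      (fun m h hm => zetaIntegrand_cell p F hB hinert hD dx hdx zero_le_one hf.fixed
        (isStepSeq_sphCell p F hD hinert) (cell_sphCell_zero p F) hm)
      (fun m h hm => zetaIntegrand_flip_cell p F hB hinert hD dx hdx hf.fixed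
        (isStepSeq_sphCell p F hD hinert) (cell_sphCell_zero p F) hm)
      (by simpa only [hv] using hsum)
    refine ⟨key.1, key.2.trans ?_⟩
    congr 1
    simp only [hv, hv', tsum_mul_left]
    have h1 := hsum.tsum_eq_zero_add
    rw [hu0] at h1
    rw [hu0] at htsum
    have hr1 : 1 - α / p ≠ 0 := by
      intro h
      rw [← sub_eq_zero.1 h, norm_one] at hr
      exact lt_irrefl _ hr
    have hs1 : 1 - β / p ≠ 0 := by
      intro h
      rw [← sub_eq_zero.1 h, norm_one] at hs
      exact lt_irrefl _ hs
    have h2 := one_sub_inv_prime_pow_ne_zero p two_ne_zero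
    have h4 := one_sub_inv_prime_pow_ne_zero p four_ne_zero
    have hζ2 : zetaP p 2 = _ := zetaP_natCast p 2
    have hζ4 : zetaP p 4 = _ := zetaP_natCast p 4
    rw [hζ2, hζ4]
    have h5 : ∑' m, u (m + 1) = ∑' m, u m - 1 := by rw [h1]; ring
    rw [h5]
    set T := ∑' m, u m
    have e1 : (1 - α / p)⁻¹ * (1 - ((p : ℂ) ^ 2)⁻¹)⁻¹ * (1 - β / p)⁻¹
        / ((1 - ((p : ℂ) ^ 2)⁻¹)⁻¹ * (1 - ((p : ℂ) ^ 4)⁻¹)⁻¹)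
        = (1 - ((p : ℂ) ^ 4)⁻¹) / ((1 - α / p) * (1 - β / p)) := by
      generalize (1 - ((p : ℂ) ^ 4)⁻¹) = x at *
      generalize (1 - ((p : ℂ) ^ 2)⁻¹) = y at *
      generalize (1 - α / p) = z at *
      generalize (1 - β / p) = w at *
      field_simp
    rw [e1, eq_div_iff (mul_ne_zero hr1 hs1)]
    have e2 : (1 - α / p) * (1 - β / p) = 1 - (α / p + β / p) + ((p : ℂ) ^ 2)⁻¹ := by
      field_simp
      linear_combination hαβ
    have e3 : (1 + ((p : ℂ) ^ 2)⁻¹) * u 1 = α / p + β / p := by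
      field_simp
      linear_combination hu1
    have e4 : ((p : ℂ) ^ 4)⁻¹ = ((p : ℂ) ^ 2)⁻¹ * ((p : ℂ) ^ 2)⁻¹ := by
      field_simp
    rw [e4]
    generalize ((p : ℂ) ^ 2)⁻¹ = w at *
    generalize α / p + β / p = c at *
    linear_combination (1 + w) * htsum - w * e2 + e3

theorem zetaIntegral_iwahori (hinert : ∀ x : F, x ≠ 0 → ∃ k : ℤ, ‖x‖ = (p : ℝ) ^ k)
    (dh : Measure (H10 p F)) [dh.IsHaarMeasure]
    (dx : Measure (X p F)) [dx.IsAddHaarMeasure] (hdx : IsSelfDual p F dx)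
    {L : ℂ → ℂ} (hL : IsAsaiL p F π L) {f : V} (hf : IsNewVector p F π 1 f)
    (hB : IsInvariantForm π B) (hBf : B f f = 1) (ϖ : Fˣ) (hϖ : ‖(ϖ : F)‖ = (p : ℝ)⁻¹) :
    Integrable (zetaIntegrand p F dx π B (phiStar p F 1) f) dh ∧
      ∃ ε : ℂ, (ε = 1 ∨ ε = -1) ∧ sigma p F π (atkinLehner p F ϖ) f = ε • f ∧
        zetaIntegral p F dh dx π B (phiStar p F 1) f
          = dh.real (openCompact p F 1 : Set (H10 p F))
            * ((p : ℂ) ^ (-2 : ℤ) * (1 + ε) * (L 1 / (zetaP p 1 * zetaP p 2))) := by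
  have hp := one_lt_prime p
  have hp0 : (p : ℂ) ≠ 0 := by exact_mod_cast (Fact.out : p.Prime).ne_zero
  obtain ⟨D, hD⟩ := exists_isDigits p F hinert
  cases hL with
  | principal μ ν hμ hν h₁ h₂ e =>
    obtain ⟨v, hv0, hv⟩ := exists_spherical p F hμ hν e.some
    exact absurd (hf.minimal 0 one_pos v hv) hv0
  | special χ hχ e =>
    obtain ⟨e⟩ := e
    obtain ⟨hχu, hχ2, hhecke, hal⟩ := special_iwahori p F hinert hD e hf.ne_zero
      (fun z => toGL_scalar F z f) hf.fixed
    have hχϖ : χ ϖ = χ (primeF p F) :=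
      eq_of_norm_eq hχu (by rw [hϖ, primeF_val, norm_prime])
    have hcoeff := torusCoeff_of_iwahori_hecke p F (hB.toGL F) hD hBf hf.fixed hhecke
    have hal1 := hal (primeF p F) (norm_prime p F)
    have hal2 := hal ϖ hϖ
    rw [hχϖ] at hal2
    have hL1 : charL p ℚ_[p] (fun x => (χ (incl p F x) : ℂ)) (1 + 1)
        * charL p ℚ_[p] (fun x => tau p F x * (χ (incl p F x) : ℂ)) 1
        = (1 - (χ (primeF p F) : ℂ) * ((p : ℂ) ^ 2)⁻¹)⁻¹
          * (1 + (χ (primeF p F) : ℂ) * (p : ℂ)⁻¹)⁻¹ := by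
      rw [charL_padic, charL_padic, incl_primeUnit, Complex.cpow_neg_one,
        tau_prime p F hinert _ (primeUnit_val p), one_add_one_eq_two, Complex.cpow_neg,
        Complex.cpow_ofNat]
      · ring
      · intro u hu
        rw [hχu _ (by rw [norm_incl, hu]), tau_of_unit p F hinert u hu, Units.val_one, one_mul]
      · intro u hu
        rw [hχu _ (by rw [norm_incl, hu]), Units.val_one]
    have hχp := hχ2 (primeF p F)
    beta_reduce
    rw [hL1]
    set c : ℂ := ((χ (primeF p F) : ℂˣ) : ℂ)
    have hc : c = 1 ∨ c = -1 := mul_self_eq_one_iff.1 hχp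
    have hnorm : ‖c / (p : ℂ) ^ 2‖ < 1 := by
      have h1 : ‖c‖ = 1 := by rcases hc with h | h <;> simp [h]
      rw [norm_div, h1, norm_pow, Complex.norm_natCast, div_lt_one (by positivity)]
      exact one_lt_pow₀ hp two_ne_zero
    have hconj : (starRingEnd ℂ) (-c) = -c := by rcases hc with h | h <;> simp [h]
    have hstab := alH_mem_latticeStabilizer p F
    have hfix : sigma p F π (alH p F).1 f = (-c) • f := hal1
    have hinv : (alH p F).1⁻¹ = (alH p F).1 :=
      inv_eq_of_mul_eq_one_right (congrArg Subtype.val (alH_mul_alH p F))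
    have hv : ∀ m : ℕ, ((p : ℂ) ^ 2) ^ m * ((p : ℂ)⁻¹ ^ (2 * m) * (p : ℂ)⁻¹ ^ (2 * 1)
        * torusCoeff p F (toGL F π) B f m) = ((p : ℂ) ^ 2)⁻¹ * (c / (p : ℂ) ^ 2) ^ m := by
      intro m
      rw [hcoeff, mul_one, pow_mul, inv_pow, inv_pow]
      field_simp
    have hgeom := summable_geometric_of_norm_lt_one hnorm
    have key := integral_iwahori p F hD hinert dh
      (zetaIntegrand p F dx π B (phiStar p F 1) f)
      (fun m => (p : ℂ)⁻¹ ^ (2 * m) * (p : ℂ)⁻¹ ^ (2 * 1) * torusCoeff p F (toGL F π) B f m)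
      (-c) (by linear_combination hχp)
      (fun m h hm => zetaIntegrand_cell p F hB hinert hD dx hdx le_rfl hf.fixed
        (isStepSeq_iwaCell p F hD hinert) (cell_iwaCell_zero p F hinert) hm)
      (zetaIntegrand_mul_left p F dx hstab fun v => by
        rw [(hB.sigma p F).apply_left, hinv, hfix, map_smulₛₗ, hconj, smul_eq_mul])
      (zetaIntegrand_mul_right p F dx hstab hfix)
      (by simpa only [hv] using hgeom.mul_left _)
    refine ⟨key.1, -c, ?_, hal2, key.2.trans ?_⟩
    · rcases hc with h | h <;> simp [h]
    congr 1
    simp only [hv, tsum_mul_left, pow_succ (c / (p : ℂ) ^ 2), tsum_mul_right,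
      tsum_geometric_of_norm_lt_one hnorm]
    have h1 := one_sub_inv_prime_pow_ne_zero p one_ne_zero
    have h2 := one_sub_inv_prime_pow_ne_zero p two_ne_zero
    have hζ1 : zetaP p 1 = (1 - ((p : ℂ) ^ 1)⁻¹)⁻¹ := by
      rw [← zetaP_natCast, Nat.cast_one]
    have hζ2 : zetaP p 2 = _ := zetaP_natCast p 2
    rw [hζ1, hζ2, zpow_neg, zpow_ofNat]
    rcases hc with h | h
    · rw [h]
      ring
    · rw [h, pow_one] at *
      have h3 : 1 + ((p : ℂ) ^ 2)⁻¹ ≠ 0 := by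
        have : ((1 + ((p : ℝ) ^ 2)⁻¹ : ℝ) : ℂ) ≠ 0 := Complex.ofReal_ne_zero.2 (by positivity)
        push_cast at this
        exact this
      have e1 : (1 : ℂ) - -1 / (p : ℂ) ^ 2 = 1 + ((p : ℂ) ^ 2)⁻¹ := by ring
      have e2 : (1 : ℂ) - -1 * ((p : ℂ) ^ 2)⁻¹ = 1 + ((p : ℂ) ^ 2)⁻¹ := by ring
      have e3 : (1 : ℂ) + -1 * (p : ℂ)⁻¹ = 1 - (p : ℂ)⁻¹ := by ring
      rw [e1, e2, e3, neg_div, one_div]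
      generalize 1 - (p : ℂ)⁻¹ = a at *
      generalize ((p : ℂ) ^ 2)⁻¹ = b at *
      field_simp
      ring

end Zeta

end AsaiZeta

theorem propositionP (p : ℕ) [Fact p.Prime]
    (F : Type*) [NormedField F] [NormedAlgebra ℚ_[p] F] [IsUltrametricDist F]
    [Algebra.IsQuadraticExtension ℚ_[p] F]
    (hinert : ∀ x : F, x ≠ 0 → ∃ k : ℤ, ‖x‖ = (p : ℝ) ^ k)
    (dh : Measure (AsaiZeta.H10 p F)) [dh.IsHaarMeasure]
    (dx : Measure (AsaiZeta.X p F)) [dx.IsAddHaarMeasure] (hdx : AsaiZeta.IsSelfDual p F dx)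
    {V : Type*} [AddCommGroup V] [Module ℂ V]
    (π : Representation ℂ (PGL(2, F)) V)
    (L : ℂ → ℂ) (hL : AsaiZeta.IsAsaiL p F π L)
    (N : ℕ) (hN : Squarefree N)
    (f : V) (hf : AsaiZeta.IsNewVector p F π (padicValNat p N) f)
    (B : V →ₗ[ℂ] V →ₗ⋆[ℂ] ℂ) (hB : AsaiZeta.IsInvariantForm π B) (hBf : B f f = 1)
    (ϖ : Fˣ) (hϖ : ‖(ϖ : F)‖ = (p : ℝ)⁻¹) :
    MeasureTheory.Integrable
      (AsaiZeta.zetaIntegrand p F dx π B (AsaiZeta.phiStar p F (padicValNat p N)) f) dh ∧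
    (¬ p ∣ N →
      AsaiZeta.zetaIntegral p F dh dx π B (AsaiZeta.phiStar p F (padicValNat p N)) f
        = dh.real (AsaiZeta.openCompact p F (padicValNat p N) : Set (AsaiZeta.H10 p F))
          * (L 1 / (AsaiZeta.zetaP p 2 * AsaiZeta.zetaP p 4))) ∧
    (p ∣ N → ∃ ε : ℂ, (ε = 1 ∨ ε = -1) ∧
      AsaiZeta.sigma p F π (AsaiZeta.atkinLehner p F ϖ) f = ε • f ∧
      AsaiZeta.zetaIntegral p F dh dx π B (AsaiZeta.phiStar p F (padicValNat p N)) f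
        = dh.real (AsaiZeta.openCompact p F (padicValNat p N) : Set (AsaiZeta.H10 p F))
          * ((p : ℂ) ^ (-2 : ℤ) * (1 + ε)
            * (L 1 / (AsaiZeta.zetaP p 1 * AsaiZeta.zetaP p 2)))) := by
  by_cases hpN : p ∣ N
  · have hn : padicValNat p N = 1 := by
      have hN0 := hN.ne_zero
      refine le_antisymm ?_ (one_le_padicValNat_of_dvd hN0 hpN)
      by_contra! h
      have h2 : p ^ 2 ∣ N := (padicValNat_dvd_iff_le hN0).2 h
      rw [sq] at h2
      exact (Fact.out : p.Prime).one_lt.ne' (Nat.isUnit_iff.1 (hN p h2))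
    rw [hn] at hf ⊢
    obtain ⟨h1, h2⟩ := AsaiZeta.zetaIntegral_iwahori p F hinert dh dx hdx hL hf hB hBf ϖ hϖ
    exact ⟨h1, fun h => absurd hpN h, fun _ => h2⟩
  · have hn : padicValNat p N = 0 := padicValNat.eq_zero_of_not_dvd hpN
    rw [hn] at hf ⊢
    obtain ⟨h1, h2⟩ := AsaiZeta.zetaIntegral_spherical p F hinert dh dx hdx hL hf hB hBf
    exact ⟨h1, fun _ => h2, fun h => absurd h hpN⟩
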